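/- Let $n\ge 2$, $\alpha>0$, let $\ell$ be an integer with $\ell>\alpha$, let $1<p\le\infty$ with $1/p+1/p'=1$ (so $p'=1$ if $p=\infty$), and let $\mu,\nu\in\mathbb R$. Let $dx$ be the surface area measure on the unit sphere $S^n\subset\mathbb R^{n+1}$, let $\sigma_{n-1}=2\pi^{n/2}/\Gamma(n/2)$, and for $\varphi:S^n\to\mathbb C$ put $$(S^\alpha_{+}\varphi)(x)=\frac{2}{\Gamma(\alpha)\sigma_{n-1}}\int_{-1<y_{n+1}<x_{n+1}}\frac{(x_{n+1}-y_{n+1})^\alpha}{|x-y|^n}\varphi(y)\,dy,\qquad (S^\alpha_{-}\varphi)(x)=\frac{2}{\Gamma(\alpha)\sigma_{n-1}}\int_{x_{n+1}<y_{n+1}<1}\frac{(y_{n+1}-x_{n+1})^\alpha}{|x-y|^n}\varphi(y)\,dy .$$ Write $x\in S^n\setminus\{\pm e_{n+1}\}$ as $x=(\theta,\xi')$, meaning $x=(\xi'\sin\theta,-\cos\theta)$ with $0<\theta<\pi$, $\xi'\in S^{n-1}$, and put $t=\tan^2(\theta/2)$. For a function $\psi$ on $S^{n-1}$ and $0\le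 r<1$ let $\Pi[\psi](r,\xi')=\frac1{\sigma_{n-1}}\int_{S^{n-1}}\frac{1-r^2}{|r\xi'-\eta'|^n}\psi(\eta')\,d\eta'$ be the Poisson integral. For a function $f$ on $S^n$ and $u<0$ let $$(A_x^+f)(u)=\Big(1+\frac ut\Big)_+^{n/2-1}(1+t+u)^{\alpha-n/2}\,\Pi\big[f(2\arctan\sqrt{t+u},\,\cdot\,)\big]\Big(\big(1+\tfrac ut\big)^{1/2},\xi'\Big),$$ $$(A_x^-f)(u)=(1+t-u)^{\alpha-n/2}\,\Pi\big[f(2\arctan\sqrt{t-u},\,\cdot\,)\big]\Big(\big(1-\tfrac ut\big)^{-1/2},\xi'\Big),$$ where $(A_x^+f)(u)=0$ if $u\le -t$, and let $(A_x^\pm f)(0)=(1+t)^{\alpha-n/2}f(x)$. For $\varepsilon>0$ define $$(T^\alpha_{\pm,\varepsilon}f)(x)=\frac{2^{-\alpha}}{\varkappa(\alpha,\ell)}(1+t)^{\alpha+n/2}\int_\varepsilon^\infty\sum_{j=0}^{\ell}\binom{\ell}{j}(-1)^j(A_x^\pm f)(-j\tau)\,\frac{d\tau}{\tau^{1+\alpha}},\qquad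 \varkappa(\alpha,\ell)=\int_0^\infty\frac{(1-e^{-\tau})^\ell}{\tau^{1+\alpha}}\,d\tau .$$ Let $\varphi$ belong to the weighted space $L^p(S^n;w)$ with $w(x)=(1+x_{n+1})^\mu(1-x_{n+1})^\nu$, that is, $w\varphi\in L^p(S^n)$. (a) If $\mu<n/(2p')$ (and $\nu$ is arbitrary), then $\lim_{\varepsilon\to0^+}(T^\alpha_{+,\varepsilon}S^\alpha_+\varphi)(x)=\varphi(x)$ for almost every $x\in S^n$. (b) If $\nu<n/(2p')$ (and $\mu$ is arbitrary), then $\lim_{\varepsilon\to0^+}(T^\alpha_{-,\varepsilon}S^\alpha_-\varphi)(x)=\varphi(x)$ for almost every $x\in S^n$. In both cases the integrals involved converge absolutely: with the sign of the case, the integral $(S^\alpha_\pm\varphi)(x)$ for almost every $x$; the Poisson integrals of $(S^\alpha_\pm\varphi)(\theta,\cdot)$ for almost every $\theta\in(0,\pi)$; and, for almost every $x$ and all $\varepsilon>0$, the integral over $(\varepsilon,\infty)$ that defines $(T^\alpha_{\pm,\varepsilon}S^\alpha_\pm\varphi)(x)$. -/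

import Mathlib

open MeasureTheory Filter Topology
open scoped ENNReal

noncomputable section

namespace SphFrac

/-- The unit sphere in `ℝ^d`; thus `S^n` is `USphere (n + 1)` and `S^{n-1}` is `USphere n`. -/
abbrev USphere (d : ℕ) : Type :=
  Metric.sphere (0 : EuclideanSpace ℝ (Fin d)) 1

/-- The standard surface area measure on the unit sphere of `ℝ^d`. -/
abbrev surf (d : ℕ) : Measure (USphere d) :=
  (volume : Measure (EuclideanSpace ℝ (Fin d))).toSphere

/-- The last coordinate `x_{n+1}` of a point of `S^n`. -/
def lastCoord {n : ℕ} (x : USphere (n + 1)) : ℝ :=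
  (x : EuclideanSpace ℝ (Fin (n + 1))) (Fin.last n)

/-- `σ_{n-1} = 2 π^{n/2} / Γ(n/2)`, the surface area of `S^{n-1}`. -/
def sphereArea (n : ℕ) : ℝ :=
  2 * Real.pi ^ ((n : ℝ) / 2) / Real.Gamma ((n : ℝ) / 2)

/-- The weight `w(x) = (1 + x_{n+1})^μ (1 - x_{n+1})^ν` on `S^n`. -/
def weight {n : ℕ} (μ ν : ℝ) (x : USphere (n + 1)) : ℝ :=
  (1 + lastCoord x) ^ μ * (1 - lastCoord x) ^ ν

/-- `φ ∈ L^p(S^n; w)`, which means that `w φ ∈ L^p(S^n)`. -/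
def MemWeightedLp {n : ℕ} (φ : USphere (n + 1) → ℂ) (p : ℝ≥0∞)
    (w : USphere (n + 1) → ℝ) : Prop :=
  MemLp (fun x => w x • φ x) p (surf (n + 1))

/-- The spherical segment `⟨a, b⟩_S = {y ∈ S^n : a < y_{n+1} < b}`. -/
def sphSegment (n : ℕ) (a b : ℝ) : Set (USphere (n + 1)) :=
  {y | a < lastCoord y ∧ lastCoord y < b}

/-- The integrand of the left-sided spherical fractional integral. -/
def leftIntegrand {n : ℕ} (α : ℝ) (φ : USphere (n + 1) → ℂ)
    (x y : USphere (n + 1)) : ℂ :=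
  ((lastCoord x - lastCoord y) ^ α / dist x y ^ n) • φ y

/-- The integrand of the right-sided spherical fractional integral. -/
def rightIntegrand {n : ℕ} (α : ℝ) (φ : USphere (n + 1) → ℂ)
    (x y : USphere (n + 1)) : ℂ :=
  ((lastCoord y - lastCoord x) ^ α / dist x y ^ n) • φ y

/-- The left-sided spherical fractional integral `S^α_{a+} φ`. -/
def leftInt {n : ℕ} (α a : ℝ) (φ : USphere (n + 1) → ℂ) (x : USphere (n + 1)) : ℂ :=
  (2 / (Real.Gamma α * sphereArea n)) •
    ∫ y in sphSegment n a (lastCoord x), leftIntegrand α φ x y ∂(surf (n + 1))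

/-- The right-sided spherical fractional integral `S^α_{b-} φ`. -/
def rightInt {n : ℕ} (α b : ℝ) (φ : USphere (n + 1) → ℂ) (x : USphere (n + 1)) : ℂ :=
  (2 / (Real.Gamma α * sphereArea n)) •
    ∫ y in sphSegment n (lastCoord x) b, rightIntegrand α φ x y ∂(surf (n + 1))

/-- `S^α_+ = S^α_{-1+}`. -/
def Splus {n : ℕ} (α : ℝ) (φ : USphere (n + 1) → ℂ) : USphere (n + 1) → ℂ :=
  leftInt α (-1) φ

/-- `S^α_- = S^α_{1-}`. -/
def Sminus {n : ℕ} (α : ℝ) (φ : USphere (n + 1) → ℂ) : USphere (n + 1) → ℂ :=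
  rightInt α 1 φ

/-- The polar angle `θ ∈ [0, π]` of `x ∈ S^n`, counted from the south pole `-e_{n+1}`,
so that `x_{n+1} = -cos θ`. -/
def angle {n : ℕ} (x : USphere (n + 1)) : ℝ :=
  Real.arccos (-lastCoord x)

/-- The first `n` coordinates of a point of `S^n`. -/
def horiz {n : ℕ} (x : USphere (n + 1)) : EuclideanSpace ℝ (Fin n) :=
  WithLp.toLp 2 fun i => (x : EuclideanSpace ℝ (Fin (n + 1))) i.castSucc

/-- The direction `ξ' ∈ S^{n-1}` of `x = (θ, ξ')`; a unit vector unless `x` is a pole. -/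
def direction {n : ℕ} (x : USphere (n + 1)) : EuclideanSpace ℝ (Fin n) :=
  ‖horiz x‖⁻¹ • horiz x

/-- The point `(θ, ξ') = (sin θ ξ', -cos θ)` of `S^n`. -/
def polarPoint {n : ℕ} (θ : ℝ) (ξ' : USphere n) : USphere (n + 1) :=
  ⟨WithLp.toLp 2 (Fin.snoc (α := fun _ => ℝ)
      (fun i => Real.sin θ * (ξ' : EuclideanSpace ℝ (Fin n)) i) (-Real.cos θ)), by
    have h : ∑ i, ((ξ' : EuclideanSpace ℝ (Fin n)) i) ^ 2 = 1 := by
      have h1 : ‖(ξ' : EuclideanSpace ℝ (Fin n))‖ = 1 := mem_sphere_zero_iff_norm.1 ξ'.2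
      rw [← EuclideanSpace.real_norm_sq_eq, h1, one_pow]
    have h2 := Real.sin_sq_add_cos_sq θ
    rw [mem_sphere_zero_iff_norm, EuclideanSpace.norm_eq, Real.sqrt_eq_one,
      Fin.sum_univ_castSucc]
    simp [mul_pow, ← Finset.mul_sum, h, h2]⟩

/-- The Poisson integral `(Π ψ)(ξ', r)` of a function on `S^{n-1}`. -/
def poisson {n : ℕ} (ψ : USphere n → ℂ) (ξ' : EuclideanSpace ℝ (Fin n)) (r : ℝ) : ℂ :=
  (sphereArea n)⁻¹ •
    ∫ η, ((1 - r ^ 2) / ‖r • ξ' - (η : EuclideanSpace ℝ (Fin n))‖ ^ n) • ψ η ∂(surf n)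

/-- `a_+^b`, equal to `a^b` if `a > 0` and to `0` otherwise. -/
def plusPow (a b : ℝ) : ℝ := if 0 < a then a ^ b else 0

/-- `tan²(θ/2)` for `x = (θ, ξ')`. -/
def tanSq {n : ℕ} (x : USphere (n + 1)) : ℝ := Real.tan (angle x / 2) ^ 2

/-- The function `u ↦ (A_x^+ f)(u)` (used for `u ≤ 0` only). -/
def Aplus {n : ℕ} (α : ℝ) (f : USphere (n + 1) → ℂ) (x : USphere (n + 1)) (u : ℝ) : ℂ :=
  if u = 0 then ((1 + tanSq x) ^ (α - (n : ℝ) / 2)) • f x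
  else (plusPow (1 + u / tanSq x) ((n : ℝ) / 2 - 1) *
      (1 + tanSq x + u) ^ (α - (n : ℝ) / 2)) •
    poisson (fun η => f (polarPoint (2 * Real.arctan (Real.sqrt (tanSq x + u))) η))
      (direction x) ((1 + u / tanSq x) ^ (1 / 2 : ℝ))

/-- The function `u ↦ (A_x^- f)(u)` (used for `u ≤ 0` only). -/
def Aminus {n : ℕ} (α : ℝ) (f : USphere (n + 1) → ℂ) (x : USphere (n + 1)) (u : ℝ) : ℂ :=
  if u = 0 then ((1 + tanSq x) ^ (α - (n : ℝ) / 2)) • f x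
  else ((1 + tanSq x - u) ^ (α - (n : ℝ) / 2)) •
    poisson (fun η => f (polarPoint (2 * Real.arctan (Real.sqrt (tanSq x - u))) η))
      (direction x) ((1 - u / tanSq x) ^ (-(1 / 2) : ℝ))

/-- The finite difference `(Δ^ℓ_τ h)(u) = ∑_{j ≤ ℓ} (ℓ choose j) (-1)^j h(u - jτ)`. -/
def finDiff (ℓ : ℕ) (τ : ℝ) (h : ℝ → ℂ) (u : ℝ) : ℂ :=
  ∑ j ∈ Finset.range (ℓ + 1), ((ℓ.choose j : ℝ) * (-1) ^ j) • h (u - j * τ)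

/-- The normalizing constant `ϰ(α, ℓ)`. -/
def kappa (α : ℝ) (ℓ : ℕ) : ℝ :=
  ∫ τ in Set.Ioi (0 : ℝ), (1 - Real.exp (-τ)) ^ ℓ / τ ^ (1 + α)

/-- The integrand `(Δ^ℓ_τ h)(0) / τ^{1+α}` of a Marchaud-type integral. -/
def marchaudIntegrand (α : ℝ) (ℓ : ℕ) (h : ℝ → ℂ) (τ : ℝ) : ℂ :=
  (τ ^ (1 + α))⁻¹ • finDiff ℓ τ h 0

/-- The factor `2^{-α} ϰ(α, ℓ)⁻¹ (1 + tan²(θ/2))^{α + n/2}`. -/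
def marchaudFactor {n : ℕ} (α : ℝ) (ℓ : ℕ) (x : USphere (n + 1)) : ℝ :=
  2 ^ (-α) / kappa α ℓ * (1 + tanSq x) ^ (α + (n : ℝ) / 2)

/-- The truncated operator `T^α_{+,ε}`, with differences of order `ℓ`. -/
def Tplus {n : ℕ} (α : ℝ) (ℓ : ℕ) (ε : ℝ) (f : USphere (n + 1) → ℂ)
    (x : USphere (n + 1)) : ℂ :=
  marchaudFactor α ℓ x • ∫ τ in Set.Ioi ε, marchaudIntegrand α ℓ (Aplus α f x) τ

/-- The truncated operator `T^α_{-,ε}`, with differences of order `ℓ`. -/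
def Tminus {n : ℕ} (α : ℝ) (ℓ : ℕ) (ε : ℝ) (f : USphere (n + 1) → ℂ)
    (x : USphere (n + 1)) : ℂ :=
  marchaudFactor α ℓ x • ∫ τ in Set.Ioi ε, marchaudIntegrand α ℓ (Aminus α f x) τ

/-- On almost every parallel `θ = const`, the function `f` is integrable over `S^{n-1}`;
this says that the Poisson integrals of `f(θ, ·)` are absolutely convergent. -/
def IntegrableOnParallels {n : ℕ} (f : USphere (n + 1) → ℂ) : Prop :=
  ∀ᵐ θ ∂(volume.restrict (Set.Ioo 0 Real.pi)),
    Integrable (fun η => f (polarPoint θ η)) (surf n)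

end SphFrac

end

open SphFrac

noncomputable section

namespace SphFrac

/-! ### Finite differences of powers -/

/-! In the coordinates (t, ξ) with t = tan²(θ/2), both operators become one-dimensional fractional
integrals along a semigroup. The point (t, ξ) is the stereographic image of √t ξ, so the chordal
distance between (t, ξ) and (v, η) is |√t ξ - √v η| up to powers of 1 + t and 1 + v. The Poisson
kernel of ratio √(min t v / max t v) is a constant times |t - v| max(t, v)^{n/2-1} |√t ξ - √v
η|^{-n} (`transKernel_eq`). The spherical kernel times the surface density is therefore |t -
v|^{α-1} times a Poisson kernel times functions of t alone and of v alone (`tanDensity_mul_kernel`).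
Once these weights are absorbed, S^α_± φ turns into F = Γ(α)⁻¹ ∫ a^{α-1} U_a G da, where U_a G at
(t, ξ) is the Poisson integral of the slice G(t ∓ a, ·) (`tanFracInt_eq`).

Composing Poisson integrals multiplies the radii, and the ratios telescope along a monotone chain of
values of t. Hence U_a U_b = U_{a+b}, U_b F = Γ(α)⁻¹ ∫ (a - b)_+^{α-1} U_a G da, and A_x^± f(u) is
U_{-u} F up to a factor that depends on t only (`Aplus_tanPoint`, `Aminus_tanPoint`). A truncated
Marchaud derivative of such an integral is the average of a ↦ U_a G(z) against the dilates of a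
fixed integrable kernel (`marchaud_eq_average`). The mass Γ(α+1) ϰ(α, ℓ) of that kernel is read off
from the test function e^{-a}. The limit is thus the right multiple of G(z) wherever the means over
(0, b] of |U_a G(z) - G(z)| tend to 0 (`tendsto_marchaud`).

Almost every z has this property, by a local ergodic theorem. U_a contracts L¹ and L^∞, so Hopf's
maximal inequality gives a weak type (1,1) bound for the means over dyadic windows
(`transport_weak_type`). This reduces the claim to continuous functions, where it is the boundary
behaviour of the Poisson kernel (`ae_lebesgue_point`). The facts needed about that kernel, its mass
and its composition law, come from harmonicity and the maximum principle.

The condition on the weight exponent enters through Hölder's inequality alone: it makes φ integrable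
on every cap that stays away from the opposite pole, and this is all that the one-sided integral
requires. -/

theorem hasDerivAt_fwdDiff_iter (m : ℕ) (f f' : ℝ → ℝ) (x : ℝ)
    (h : ∀ y, x - m ≤ y → HasDerivAt f (f' y) y) :
    HasDerivAt ((fwdDiff (-1 : ℝ))^[m] f) ((fwdDiff (-1 : ℝ))^[m] f' x) x := by
  induction m generalizing f f' x with
  | zero => simpa using h x (by simp)
  | succ m ih =>
    rw [Function.iterate_succ_apply', Function.iterate_succ_apply']
    have h1 := ih f f' x (fun y hy => h y (by push_cast; linarith))
    have h2 := ih f f' (x + -1) (fun y hy => h y (by push_cast; linarith))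
    exact (h2.comp_add_const x (-1)).sub h1

/-- Each difference gains one power of x by the mean value inequality on [x - 1, x], applied to the
m-th difference, whose derivative is β times the m-th difference of y^{β-1}. This is why β is
quantified inside the induction. -/
theorem abs_fwdDiff_iter_rpow_le (m : ℕ) : ∀ β : ℝ, ∃ C : ℝ, 0 ≤ C ∧ ∀ x : ℝ, (m : ℝ) + 1 ≤ x →
    |(fwdDiff (-1 : ℝ))^[m] (fun y : ℝ => y ^ β) x| ≤ C * x ^ (β - m) := by
  induction m with
  | zero =>
    intro β
    refine ⟨1, zero_le_one, fun x hx => ?_⟩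
    have hx0 : 0 ≤ x := by norm_num at hx; linarith
    simp [abs_of_nonneg (Real.rpow_nonneg hx0 β)]
  | succ m ih =>
    intro β
    obtain ⟨C, hC, h⟩ := ih (β - 1)
    -- The factor |β| comes from differentiating the power. The power of 2 comes from replacing y by
    -- x, since x ≥ m + 2 forces x/2 ≤ y ≤ x.
    refine ⟨|β| * (C * 2 ^ |β - 1 - m|), by positivity, fun x hx => ?_⟩
    push_cast at hx
    rw [Function.iterate_succ_apply']
    set g := (fwdDiff (-1 : ℝ))^[m] (fun y : ℝ => y ^ β) with hg
    have hm : (0 : ℝ) ≤ m := Nat.cast_nonneg m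
    have hx0 : 0 < x := by linarith
    have hder : ∀ y ∈ Set.Icc (x - 1) x, HasDerivWithinAt g
        (β * (fwdDiff (-1 : ℝ))^[m] (fun y : ℝ => y ^ (β - 1)) y) (Set.Icc (x - 1) x) y := by
      intro y hy
      have := hasDerivAt_fwdDiff_iter m (fun y : ℝ => y ^ β) (fun y : ℝ => β * y ^ (β - 1)) y
        (fun z hz => Real.hasDerivAt_rpow_const (Or.inl (by linarith [hy.1])))
      have h2 := fwdDiff_iter_const_smul (h := (-1 : ℝ)) β (fun y : ℝ => y ^ (β - 1)) m
      have h3 : (fun y : ℝ => β * y ^ (β - 1)) = β • (fun y : ℝ => y ^ (β - 1)) := rfl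
      rw [h3, h2] at this
      exact this.hasDerivWithinAt
    have hbd : ∀ y ∈ Set.Icc (x - 1) x,
        ‖β * (fwdDiff (-1 : ℝ))^[m] (fun y : ℝ => y ^ (β - 1)) y‖ ≤
          |β| * (C * 2 ^ |β - 1 - m|) * x ^ (β - ((m + 1 : ℕ) : ℝ)) := by
      intro y hy
      have hy0 : 0 < y := by linarith [hy.1]
      rw [norm_mul, Real.norm_eq_abs, Real.norm_eq_abs, mul_assoc]
      refine mul_le_mul_of_nonneg_left ?_ (abs_nonneg _)
      refine (h y (by linarith [hy.1])).trans ?_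
      rw [mul_assoc]
      refine mul_le_mul_of_nonneg_left ?_ hC
      have e1 : β - ((m + 1 : ℕ) : ℝ) = β - 1 - m := by push_cast; ring
      rw [e1]
      have e2 : y ^ (β - 1 - m) = (y / x) ^ (β - 1 - m) * x ^ (β - 1 - m) := by
        rw [← Real.mul_rpow (by positivity) hx0.le, div_mul_cancel₀ _ hx0.ne']
      rw [e2]
      refine mul_le_mul_of_nonneg_right ?_ (by positivity)
      have hr1 : y / x ≤ 1 := (div_le_one hx0).2 hy.2
      have hr2 : 1 / 2 ≤ y / x := by
        rw [div_le_div_iff₀ two_pos hx0]; linarith [hy.1]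
      rcases le_total 0 (β - 1 - m) with hs | hs
      · exact (Real.rpow_le_one (by positivity) hr1 hs).trans
          (Real.one_le_rpow one_le_two (abs_nonneg _))
      · rw [abs_of_nonpos hs, Real.rpow_neg two_pos.le, ← Real.inv_rpow two_pos.le]
        exact Real.rpow_le_rpow_of_nonpos (by norm_num) (by simpa using hr2) hs
    have := Convex.norm_image_sub_le_of_norm_hasDerivWithin_le hder hbd (convex_Icc _ _)
      (Set.right_mem_Icc.2 (by linarith)) (Set.left_mem_Icc.2 (by linarith))
    have e3 : fwdDiff (-1 : ℝ) g x = g (x - 1) - g x := rfl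
    rw [e3, ← Real.norm_eq_abs]
    refine this.trans (le_of_eq ?_)
    simp

theorem abs_sum_choose_rpow_le (m : ℕ) (β : ℝ) : ∃ C : ℝ, 0 ≤ C ∧ ∀ x : ℝ, (m : ℝ) + 1 ≤ x →
    |∑ j ∈ Finset.range (m + 1), ((m.choose j : ℝ) * (-1) ^ j) * (x - j) ^ β| ≤
      C * x ^ (β - m) := by
  obtain ⟨C, hC, h⟩ := abs_fwdDiff_iter_rpow_le m β
  refine ⟨C, hC, fun x hx => le_trans (le_of_eq ?_) (h x hx)⟩
  rw [fwdDiff_iter_eq_sum_shift]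
  -- The two alternating sums differ by the global sign (-1)^m, which the absolute value removes.
  have : ∑ j ∈ Finset.range (m + 1), ((m.choose j : ℝ) * (-1) ^ j) * (x - j) ^ β =
      (-1) ^ m * ∑ k ∈ Finset.range (m + 1),
        ((-1 : ℤ) ^ (m - k) * (m.choose k)) • (x + k • (-1 : ℝ)) ^ β := by
    rw [Finset.mul_sum]
    refine Finset.sum_congr rfl fun j hj => ?_
    have hj' : j ≤ m := Nat.lt_succ_iff.1 (Finset.mem_range.1 hj)
    obtain ⟨i, rfl⟩ := Nat.exists_eq_add_of_le hj'
    have e : (-1 : ℝ) ^ (j + i) * (-1) ^ i = (-1) ^ j := by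
      rw [pow_add, mul_assoc, ← mul_pow]; simp
    simp only [zsmul_eq_mul, nsmul_eq_mul, add_tsub_cancel_left]
    push_cast
    rw [← e, mul_neg_one, ← sub_eq_add_neg]
    ring
  rw [this, abs_mul, abs_pow]
  simp

/-! ### The Marchaud averaging kernel -/

/-- The kernel by which a truncated Marchaud derivative of a fractional integral averages. -/
def marchaudKernel (α : ℝ) (ℓ : ℕ) (η : ℝ) : ℝ :=
  (∑ j ∈ Finset.range (ℓ + 1), ((ℓ.choose j : ℝ) * (-1) ^ j) * (max (η - j) 0) ^ α) / η

/-- A power-type majorant of `marchaudKernel`. -/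
def kernelMajorant (α : ℝ) (ℓ : ℕ) (η : ℝ) : ℝ := min (η ^ (α - 1)) (η ^ (α - 1 - ℓ))

theorem measurable_marchaudKernel (α : ℝ) (ℓ : ℕ) : Measurable (marchaudKernel α ℓ) := by
  unfold marchaudKernel; fun_prop

theorem measurable_kernelMajorant (α : ℝ) (ℓ : ℕ) : Measurable (kernelMajorant α ℓ) := by
  unfold kernelMajorant; fun_prop

theorem kernelMajorant_nonneg (α : ℝ) (ℓ : ℕ) {η : ℝ} (h : 0 ≤ η) : 0 ≤ kernelMajorant α ℓ η :=
  le_min (by positivity) (by positivity)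

/-- For η ≥ ℓ + 1 no positive part is active and the sum is a genuine ℓ-th difference of η^α, of
size η^{α-ℓ}. For η ≤ ℓ + 1 the sum is at most 2^ℓ η^α, and η^ℓ ≤ (ℓ + 1)^ℓ makes the two terms of
the minimum comparable there. -/
theorem abs_marchaudKernel_le {α : ℝ} (hα : 0 < α) (ℓ : ℕ) :
    ∃ C : ℝ, 0 < C ∧ ∀ η : ℝ, 0 < η → |marchaudKernel α ℓ η| ≤ C * kernelMajorant α ℓ η := by
  obtain ⟨C, hC, h⟩ := abs_sum_choose_rpow_le ℓ α
  refine ⟨C + 2 ^ ℓ * (ℓ + 1) ^ ℓ, by positivity, fun η hη => ?_⟩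
  have hl : (0 : ℝ) ≤ ℓ := Nat.cast_nonneg ℓ
  have e1 : η ^ (α - 1) = η ^ α / η := by rw [Real.rpow_sub_one hη.ne']
  have e2 : η ^ (α - 1 - ℓ) = η ^ (α - ℓ) / η := by
    rw [← Real.rpow_sub_one hη.ne']; congr 1; ring
  have e3 : η ^ (α - ℓ) * η ^ ℓ = η ^ α := by
    rw [← Real.rpow_add_natCast hη.ne']; congr 1; ring
  unfold marchaudKernel kernelMajorant
  rw [abs_div, abs_of_pos hη, e1, e2, min_div_div_right hη.le, mul_div_assoc']
  refine div_le_div_of_nonneg_right ?_ hη.le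
  rcases le_total ((ℓ : ℝ) + 1) η with h1 | h1
  · have hmin : min (η ^ α) (η ^ (α - ℓ)) = η ^ (α - ℓ) :=
      min_eq_right (Real.rpow_le_rpow_of_exponent_le (by linarith) (by linarith))
    rw [hmin]
    have : ∀ j ∈ Finset.range (ℓ + 1), ((ℓ.choose j : ℝ) * (-1) ^ j) * (max (η - j) 0) ^ α =
        ((ℓ.choose j : ℝ) * (-1) ^ j) * (η - j) ^ α := by
      intro j hj
      have hj' : (j : ℝ) ≤ ℓ := by exact_mod_cast Nat.lt_succ_iff.1 (Finset.mem_range.1 hj)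
      rw [max_eq_left (by linarith)]
    rw [Finset.sum_congr rfl this]
    refine (h η h1).trans (mul_le_mul_of_nonneg_right ?_ (by positivity))
    exact le_add_of_nonneg_right (by positivity)
  · have hsum : |∑ j ∈ Finset.range (ℓ + 1), ((ℓ.choose j : ℝ) * (-1) ^ j) *
        (max (η - j) 0) ^ α| ≤ 2 ^ ℓ * η ^ α := by
      refine (Finset.abs_sum_le_sum_abs _ _).trans ?_
      have e4 : (2 : ℝ) ^ ℓ = ∑ j ∈ Finset.range (ℓ + 1), (ℓ.choose j : ℝ) := by
        exact_mod_cast (Nat.sum_range_choose ℓ).symm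
      rw [e4, Finset.sum_mul]
      refine Finset.sum_le_sum fun j _ => ?_
      rw [abs_mul, abs_mul, abs_pow, abs_neg, abs_one, one_pow, mul_one, Nat.abs_cast]
      refine mul_le_mul_of_nonneg_left ?_ (Nat.cast_nonneg _)
      rw [abs_of_nonneg (by positivity)]
      refine Real.rpow_le_rpow (le_max_right _ _) (max_le ?_ hη.le) hα.le
      linarith [Nat.cast_nonneg (α := ℝ) j]
    refine hsum.trans ?_
    have hp : η ^ ℓ ≤ ((ℓ : ℝ) + 1) ^ ℓ := pow_le_pow_left₀ hη.le h1 _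
    have hone : (1 : ℝ) ≤ ((ℓ : ℝ) + 1) ^ ℓ := one_le_pow₀ (by linarith)
    have hA : η ^ α ≤ ((ℓ : ℝ) + 1) ^ ℓ * min (η ^ α) (η ^ (α - ℓ)) := by
      rw [mul_min_of_nonneg _ _ (by positivity)]
      refine le_min (le_mul_of_one_le_left (by positivity) hone) ?_
      rw [← e3, mul_comm]
      exact mul_le_mul_of_nonneg_right hp (by positivity)
    have hmin0 : 0 ≤ min (η ^ α) (η ^ (α - ℓ)) := le_min (by positivity) (by positivity)
    calc 2 ^ ℓ * η ^ α ≤ 2 ^ ℓ * (((ℓ : ℝ) + 1) ^ ℓ * min (η ^ α) (η ^ (α - ℓ))) :=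
          mul_le_mul_of_nonneg_left hA (by positivity)
      _ = 2 ^ ℓ * ((ℓ : ℝ) + 1) ^ ℓ * min (η ^ α) (η ^ (α - ℓ)) := by ring
      _ ≤ _ := mul_le_mul_of_nonneg_right (le_add_of_nonneg_left hC) hmin0

/-- At 0 the exponent α - 1 exceeds -1; at infinity α - 1 - ℓ is below -1. This is where ℓ > α
decides. -/
theorem integrableOn_kernelMajorant {α : ℝ} (hα : 0 < α) {ℓ : ℕ} (hℓ : α < ℓ) :
    IntegrableOn (kernelMajorant α ℓ) (Set.Ioi 0) := by
  rw [← Set.Ioc_union_Ioi_eq_Ioi zero_le_one]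
  refine IntegrableOn.union ?_ ?_
  · have h : IntegrableOn (fun η : ℝ => η ^ (α - 1)) (Set.Ioc 0 1) := by
      rw [← intervalIntegrable_iff_integrableOn_Ioc_of_le zero_le_one]
      exact intervalIntegral.intervalIntegrable_rpow' (by linarith)
    refine h.mono' (measurable_kernelMajorant α ℓ).aestronglyMeasurable ?_
    filter_upwards [ae_restrict_mem measurableSet_Ioc] with η hη
    rw [Real.norm_of_nonneg (kernelMajorant_nonneg α ℓ hη.1.le)]
    exact min_le_left _ _
  · have h : IntegrableOn (fun η : ℝ => η ^ (α - 1 - ℓ)) (Set.Ioi 1) :=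
      integrableOn_Ioi_rpow_of_lt (by linarith) one_pos
    refine h.mono' (measurable_kernelMajorant α ℓ).aestronglyMeasurable ?_
    filter_upwards [ae_restrict_mem measurableSet_Ioi] with η hη
    rw [Real.norm_of_nonneg (kernelMajorant_nonneg α ℓ (zero_le_one.trans hη.le))]
    exact min_le_right _ _

theorem rpow_le_two_rpow_mul {a b : ℝ} (ha : 0 < a) (hab : a ≤ b) (hb : b ≤ 2 * a) (r : ℝ) :
    a ^ r ≤ 2 ^ |r| * b ^ r := by
  have hb0 : 0 < b := ha.trans_le hab
  rcases le_total 0 r with hr | hr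
  · exact (Real.rpow_le_rpow ha.le hab hr).trans
      (le_mul_of_one_le_left (by positivity) (Real.one_le_rpow one_le_two (abs_nonneg _)))
  · rw [abs_of_nonpos hr, Real.rpow_neg two_pos.le, ← Real.inv_rpow two_pos.le,
      ← Real.mul_rpow (by norm_num) hb0.le]
    exact Real.rpow_le_rpow_of_nonpos (by positivity) (by linarith) hr

/-- A doubling bound in place of monotonicity: for α > 1 the majorant increases on (0, 1), so it is
not a decreasing kernel. -/
theorem kernelMajorant_le_of_le_two_mul (α : ℝ) (ℓ : ℕ) {a b : ℝ} (ha : 0 < a) (hab : a ≤ b)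
    (hb : b ≤ 2 * a) :
    kernelMajorant α ℓ a ≤ 2 ^ (|α - 1| + |α - 1 - ℓ|) * kernelMajorant α ℓ b := by
  have hb0 : 0 < b := ha.trans_le hab
  unfold kernelMajorant
  rw [mul_min_of_nonneg _ _ (by positivity)]
  refine min_le_min ?_ ?_
  · refine (rpow_le_two_rpow_mul ha hab hb _).trans (mul_le_mul_of_nonneg_right ?_ (by positivity))
    exact Real.rpow_le_rpow_of_exponent_le one_le_two (le_add_of_nonneg_right (abs_nonneg _))
  · refine (rpow_le_two_rpow_mul ha hab hb _).trans (mul_le_mul_of_nonneg_right ?_ (by positivity))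
    exact Real.rpow_le_rpow_of_exponent_le one_le_two (le_add_of_nonneg_left (abs_nonneg _))

/-- The dilated majorant `ε⁻¹ k(a/ε)`. -/
def dilatedMajorant (α : ℝ) (ℓ : ℕ) (ε a : ℝ) : ℝ≥0∞ :=
  ENNReal.ofReal (ε⁻¹ * kernelMajorant α ℓ (a / ε))

theorem measurable_dilatedMajorant (α : ℝ) (ℓ : ℕ) (ε : ℝ) :
    Measurable (dilatedMajorant α ℓ ε) := by
  have := measurable_kernelMajorant α ℓ
  unfold dilatedMajorant; fun_prop

theorem lintegral_Ioi_dilate (f : ℝ → ℝ) {ε : ℝ} (hε : 0 < ε) (hf : ∀ a, 0 < a → 0 ≤ f a)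
    (hi : IntegrableOn f (Set.Ioi 0)) :
    ∫⁻ a in Set.Ioi 0, ENNReal.ofReal (ε⁻¹ * f (a / ε)) =
      ENNReal.ofReal (∫ a in Set.Ioi 0, f a) := by
  have hi' : IntegrableOn (fun a => ε⁻¹ * f (a / ε)) (Set.Ioi 0) := by
    have := (integrableOn_Ioi_comp_mul_right_iff f 0 (inv_pos.2 hε)).2 (by simpa using hi)
    simpa [div_eq_mul_inv, IntegrableOn] using this.const_mul ε⁻¹
  rw [← ofReal_integral_eq_lintegral_ofReal hi']
  · congr 1
    rw [integral_const_mul]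
    have := integral_comp_mul_right_Ioi f 0 (inv_pos.2 hε)
    simp only [← div_eq_mul_inv, zero_div, inv_inv, smul_eq_mul] at this
    rw [this, inv_mul_cancel_left₀ hε.ne']
  · filter_upwards [ae_restrict_mem measurableSet_Ioi] with a ha
    have := hf (a / ε) (div_pos ha hε)
    positivity

theorem lintegral_dilatedMajorant {α : ℝ} (hα : 0 < α) {ℓ : ℕ} (hℓ : α < ℓ) {ε : ℝ} (hε : 0 < ε) :
    ∫⁻ a in Set.Ioi 0, dilatedMajorant α ℓ ε a =
      ENNReal.ofReal (∫ a in Set.Ioi 0, kernelMajorant α ℓ a) :=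
  lintegral_Ioi_dilate _ hε (fun _ ha => kernelMajorant_nonneg α ℓ ha.le)
    (integrableOn_kernelMajorant hα hℓ)

/-- Doubling bounds the value at a by its mean over (a, 2a] with respect to db/b. It plays the part
of integration by parts: inside an integral against q, Tonelli then exposes the means of q over (0,
b]. -/
theorem dilatedMajorant_le_lintegral (α : ℝ) (ℓ : ℕ) {ε a : ℝ} (hε : 0 < ε) (ha : 0 < a) :
    dilatedMajorant α ℓ ε a ≤ ENNReal.ofReal (2 * 2 ^ (|α - 1| + |α - 1 - ℓ|)) *
      ∫⁻ b in Set.Ioc a (2 * a), dilatedMajorant α ℓ ε b * ENNReal.ofReal b⁻¹ := by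
  set D : ℝ := 2 ^ (|α - 1| + |α - 1 - ℓ|) with hD
  have hD0 : 0 < D := by positivity
  -- The lower bound does not depend on b, so integrating it over an interval of length a leaves the
  -- factor 1/(2D).
  have key : ∀ b ∈ Set.Ioc a (2 * a),
      dilatedMajorant α ℓ ε a * ENNReal.ofReal (D * 2 * a)⁻¹ ≤
        dilatedMajorant α ℓ ε b * ENNReal.ofReal b⁻¹ := by
    intro b hb
    have hb0 : 0 < b := ha.trans hb.1
    have h1 := kernelMajorant_le_of_le_two_mul α ℓ (div_pos ha hε)
      (div_le_div_of_nonneg_right hb.1.le hε.le)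
      (by rw [← mul_div_assoc]; exact div_le_div_of_nonneg_right hb.2 hε.le)
    have h0 : 0 ≤ kernelMajorant α ℓ (b / ε) := kernelMajorant_nonneg α ℓ (by positivity)
    have h0' : 0 ≤ kernelMajorant α ℓ (a / ε) := kernelMajorant_nonneg α ℓ (by positivity)
    unfold dilatedMajorant
    rw [← ENNReal.ofReal_mul (by positivity), ← ENNReal.ofReal_mul (by positivity)]
    refine ENNReal.ofReal_le_ofReal ?_
    have h2 : (2 * a)⁻¹ ≤ b⁻¹ := inv_anti₀ hb0 hb.2
    calc ε⁻¹ * kernelMajorant α ℓ (a / ε) * (D * 2 * a)⁻¹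
        ≤ ε⁻¹ * (D * kernelMajorant α ℓ (b / ε)) * (D * 2 * a)⁻¹ := by gcongr
      _ = ε⁻¹ * kernelMajorant α ℓ (b / ε) * (2 * a)⁻¹ := by field_simp
      _ ≤ _ := by gcongr
  have h3 := setLIntegral_mono' measurableSet_Ioc key (μ := volume)
  rw [lintegral_const, Measure.restrict_apply_univ, Real.volume_Ioc, mul_assoc,
    ← ENNReal.ofReal_mul (by positivity)] at h3
  have h4 : (D * 2 * a)⁻¹ * (2 * a - a) = (2 * D)⁻¹ := by field_simp; ring
  rw [h4] at h3
  calc dilatedMajorant α ℓ ε a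
      = ENNReal.ofReal (2 * D) * (dilatedMajorant α ℓ ε a * ENNReal.ofReal (2 * D)⁻¹) := by
        rw [mul_comm, mul_assoc, ← ENNReal.ofReal_mul (by positivity), inv_mul_cancel₀ (by positivity)]
        simp
    _ ≤ _ := by gcongr

/-- Insert the bound by the db/b mean and swap the integrals: ∫ k(b) b⁻¹ (∫_0^b q) db ≤ ω ∫ k, and
the last integral does not depend on ε. The restriction a ≤ T/2 ensures that only b ≤ T occurs. -/
theorem lintegral_dilatedMajorant_mul_le {α : ℝ} (hα : 0 < α) {ℓ : ℕ} (hℓ : α < ℓ) {ε : ℝ}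
    (hε : 0 < ε) {q : ℝ → ℝ≥0∞} (hq : Measurable q) {T : ℝ} {ω : ℝ≥0∞}
    (h : ∀ b, 0 < b → b ≤ T → ∫⁻ a in Set.Ioc 0 b, q a ≤ ω * ENNReal.ofReal b) :
    ∫⁻ a in Set.Ioc 0 (T / 2), dilatedMajorant α ℓ ε a * q a ≤
      ENNReal.ofReal (2 * 2 ^ (|α - 1| + |α - 1 - ℓ|)) * ω *
        ENNReal.ofReal (∫ a in Set.Ioi 0, kernelMajorant α ℓ a) := by
  set D : ℝ≥0∞ := ENNReal.ofReal (2 * 2 ^ (|α - 1| + |α - 1 - ℓ|)) with hD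
  set k := dilatedMajorant α ℓ ε with hk
  have hkm : Measurable k := measurable_dilatedMajorant α ℓ ε
  -- The constraint b ≤ 2a is relaxed to b ≤ T, so that after the swap the inner integral runs over
  -- all of (0, b).
  let W : ℝ → ℝ → ℝ≥0∞ := fun a b =>
    {z : ℝ × ℝ | 0 < z.1 ∧ z.1 < z.2 ∧ z.2 ≤ T}.indicator
      (fun z => q z.1 * (k z.2 * ENNReal.ofReal z.2⁻¹)) (a, b)
  have hset : MeasurableSet {z : ℝ × ℝ | 0 < z.1 ∧ z.1 < z.2 ∧ z.2 ≤ T} :=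
    (measurableSet_lt measurable_const measurable_fst).inter
      ((measurableSet_lt measurable_fst measurable_snd).inter
        (measurableSet_le measurable_snd measurable_const))
  have hWm : Measurable (Function.uncurry W) := by
    refine Measurable.indicator (f := fun z : ℝ × ℝ => q z.1 * (k z.2 * ENNReal.ofReal z.2⁻¹)) ?_ hset
    fun_prop
  have hle : ∀ a ∈ Set.Ioc 0 (T / 2), k a * q a ≤ D * ∫⁻ b, W a b := by
    intro a ha
    calc k a * q a ≤ D * (∫⁻ b in Set.Ioc a (2 * a), k b * ENNReal.ofReal b⁻¹) * q a := by
          gcongr; exact dilatedMajorant_le_lintegral α ℓ hε ha.1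
      _ = D * ∫⁻ b in Set.Ioc a (2 * a), q a * (k b * ENNReal.ofReal b⁻¹) := by
          rw [lintegral_const_mul _ (by fun_prop)]; ring
      _ ≤ D * ∫⁻ b, W a b := by
          refine mul_le_mul_right ?_ _
          rw [← lintegral_indicator measurableSet_Ioc]
          refine lintegral_mono fun b => ?_
          by_cases hb : b ∈ Set.Ioc a (2 * a)
          · have : ((a, b) : ℝ × ℝ) ∈ {z : ℝ × ℝ | 0 < z.1 ∧ z.1 < z.2 ∧ z.2 ≤ T} :=
              ⟨ha.1, hb.1, by linarith [hb.2, ha.2]⟩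
            simp only [W, Set.indicator_of_mem hb, Set.indicator_of_mem this, le_refl]
          · simp [Set.indicator_of_notMem hb]
  calc ∫⁻ a in Set.Ioc 0 (T / 2), k a * q a
      ≤ ∫⁻ a in Set.Ioc 0 (T / 2), D * ∫⁻ b, W a b := setLIntegral_mono' measurableSet_Ioc hle
    _ ≤ ∫⁻ a, D * ∫⁻ b, W a b := setLIntegral_le_lintegral _ _
    _ = D * ∫⁻ a, ∫⁻ b, W a b := lintegral_const_mul _ hWm.lintegral_prod_right'
    _ = D * ∫⁻ b, ∫⁻ a, W a b := by rw [lintegral_lintegral_swap hWm.aemeasurable]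
    _ ≤ D * ∫⁻ b in Set.Ioi 0, ω * k b := by
        refine mul_le_mul_right ?_ _
        rw [← lintegral_indicator measurableSet_Ioi]
        refine lintegral_mono fun b => ?_
        by_cases hb : 0 < b ∧ b ≤ T
        · rw [Set.indicator_of_mem (show b ∈ Set.Ioi 0 from hb.1)]
          calc ∫⁻ a, W a b ≤ ∫⁻ a in Set.Ioc 0 b, q a * (k b * ENNReal.ofReal b⁻¹) := by
                rw [← lintegral_indicator measurableSet_Ioc]
                refine lintegral_mono fun a => ?_
                by_cases ha : ((a, b) : ℝ × ℝ) ∈ {z : ℝ × ℝ | 0 < z.1 ∧ z.1 < z.2 ∧ z.2 ≤ T}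
                · have : a ∈ Set.Ioc 0 b := ⟨ha.1, ha.2.1.le⟩
                  simp only [W, Set.indicator_of_mem ha, Set.indicator_of_mem this, le_refl]
                · simp only [W, Set.indicator_of_notMem ha, zero_le]
            _ = (∫⁻ a in Set.Ioc 0 b, q a) * (k b * ENNReal.ofReal b⁻¹) :=
                lintegral_mul_const _ hq
            _ ≤ ω * ENNReal.ofReal b * (k b * ENNReal.ofReal b⁻¹) := by
                gcongr; exact h b hb.1 hb.2
            _ = ω * k b * (ENNReal.ofReal b * ENNReal.ofReal b⁻¹) := by ring
            _ = ω * k b := by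
                rw [← ENNReal.ofReal_mul hb.1.le, mul_inv_cancel₀ hb.1.ne']; simp
        · have : ∀ a, W a b = 0 := fun a => by
            refine Set.indicator_of_notMem ?_ _
            rintro ⟨h1, h2, h3⟩
            exact hb ⟨lt_trans h1 h2, h3⟩
          simp [this]
    _ = D * ω * ENNReal.ofReal (∫ a in Set.Ioi 0, kernelMajorant α ℓ a) := by
        rw [lintegral_const_mul _ hkm, hk, lintegral_dilatedMajorant hα hℓ hε, mul_assoc]

/-- Averages against the dilated majorant vanish in the limit if `0` is a Lebesgue point. -/
theorem tendsto_lintegral_dilatedMajorant_mul {α : ℝ} (hα : 0 < α) {ℓ : ℕ} (hℓ : α < ℓ)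
    {q : ℝ → ℝ≥0∞} (hq : Measurable q)
    (hloc : ∀ ω : ℝ, 0 < ω → ∃ T > 0, ∀ b, 0 < b → b ≤ T →
      ∫⁻ a in Set.Ioc 0 b, q a ≤ ENNReal.ofReal ω * ENNReal.ofReal b)
    (htail : ∀ T : ℝ, 0 < T → ∫⁻ a in Set.Ioi T, ENNReal.ofReal (a ^ (α - 1 - ℓ)) * q a ≠ ∞) :
    Tendsto (fun ε : ℝ => ∫⁻ a in Set.Ioi 0, dilatedMajorant α ℓ ε a * q a) (𝓝[>] 0) (𝓝 0) := by
  rw [ENNReal.tendsto_nhds_zero]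
  intro δ hδ
  set M : ℝ≥0∞ := ENNReal.ofReal (2 * 2 ^ (|α - 1| + |α - 1 - ℓ|)) *
      ENNReal.ofReal (∫ a in Set.Ioi 0, kernelMajorant α ℓ a) with hM
  have hMtop : M ≠ ∞ := ENNReal.mul_ne_top ENNReal.ofReal_ne_top ENNReal.ofReal_ne_top
  have hδ2 : 0 < δ / 2 := ENNReal.half_pos hδ.ne'
  -- The near part, a ≤ T/2, is bounded by M ω uniformly in ε, so ω is fixed first. Then T and the
  -- finite tail integral A are fixed, and only the far part needs ε → 0.
  obtain ⟨ω, hω, hωM⟩ : ∃ ω : ℝ, 0 < ω ∧ M * ENNReal.ofReal ω ≤ δ / 2 := by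
    have h1 : Tendsto (fun ω : ℝ => M * ENNReal.ofReal ω) (𝓝[>] 0) (𝓝 0) := by
      have h2 : Tendsto (fun ω : ℝ => ENNReal.ofReal ω) (𝓝[>] 0) (𝓝 0) := by
        have := (ENNReal.continuous_ofReal.tendsto 0).mono_left
          (nhdsWithin_le_nhds (s := Set.Ioi (0 : ℝ)))
        simpa using this
      simpa using ENNReal.Tendsto.const_mul h2 (Or.inr hMtop)
    have h3 := (ENNReal.tendsto_nhds_zero.1 h1 (δ / 2) hδ2).and self_mem_nhdsWithin
    obtain ⟨ω, h4, h5⟩ := h3.exists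
    exact ⟨ω, h5, h4⟩
  obtain ⟨T, hT, hTq⟩ := hloc ω hω
  set A := ∫⁻ a in Set.Ioi (T / 2), ENNReal.ofReal (a ^ (α - 1 - ℓ)) * q a with hA
  have hAtop : A ≠ ∞ := htail (T / 2) (by positivity)
  have hsmall : Tendsto (fun ε : ℝ => ENNReal.ofReal (ε ^ ((ℓ : ℝ) - α)) * A) (𝓝[>] 0) (𝓝 0) := by
    have h1 : Tendsto (fun ε : ℝ => ε ^ ((ℓ : ℝ) - α)) (𝓝[>] 0) (𝓝 0) := by
      have := (Real.continuousAt_rpow_const 0 ((ℓ : ℝ) - α) (Or.inr (by linarith))).tendsto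
      rw [Real.zero_rpow (by linarith)] at this
      exact this.mono_left nhdsWithin_le_nhds
    have h2 := (ENNReal.continuous_ofReal.tendsto 0).comp h1
    rw [ENNReal.ofReal_zero] at h2
    simpa using ENNReal.Tendsto.mul_const h2 (Or.inr hAtop)
  filter_upwards [ENNReal.tendsto_nhds_zero.1 hsmall (δ / 2) hδ2, self_mem_nhdsWithin]
    with ε h1 hε
  have hε : 0 < ε := hε
  rw [← Set.Ioc_union_Ioi_eq_Ioi (by positivity : (0 : ℝ) ≤ T / 2)]
  refine (lintegral_union_le _ _ _).trans ?_
  rw [← ENNReal.add_halves δ]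
  refine add_le_add ?_ ?_
  · refine (lintegral_dilatedMajorant_mul_le hα hℓ hε hq hTq).trans (le_trans (le_of_eq ?_) hωM)
    rw [hM]; ring
  · refine le_trans ?_ h1
    rw [hA, ← lintegral_const_mul _ (by fun_prop)]
    refine setLIntegral_mono' measurableSet_Ioi fun a ha => ?_
    have ha0 : 0 < a := lt_trans (by positivity) (Set.mem_Ioi.1 ha)
    rw [← mul_assoc]
    gcongr
    unfold dilatedMajorant
    rw [← ENNReal.ofReal_mul (by positivity)]
    refine ENNReal.ofReal_le_ofReal ?_
    -- Away from 0 the steeper power of the minimum leaves a factor ε^{ℓ-α}, which tends to 0.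
    calc ε⁻¹ * kernelMajorant α ℓ (a / ε) ≤ ε⁻¹ * (a / ε) ^ (α - 1 - ℓ) := by
          gcongr; exact min_le_right _ _
      _ = ε ^ ((ℓ : ℝ) - α) * a ^ (α - 1 - ℓ) := by
          rw [Real.div_rpow ha0.le hε.le]
          have : ε ^ ((ℓ : ℝ) - α) = ε⁻¹ * (ε ^ (α - 1 - ℓ))⁻¹ := by
            rw [← Real.rpow_neg_one ε, ← Real.rpow_neg hε.le, ← Real.rpow_add hε]
            congr 1; ring
          rw [this]; ring

/-! ### Truncated Marchaud derivatives of fractional integrals on the half-line -/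

theorem measurable_plusPow (b : ℝ) : Measurable (fun a : ℝ => plusPow a b) := by
  unfold plusPow
  exact Measurable.ite measurableSet_Ioi (by fun_prop) measurable_const

theorem plusPow_nonneg (a b : ℝ) : 0 ≤ plusPow a b := by
  unfold plusPow
  split_ifs with h
  · positivity
  · exact le_rfl

/-- The kernel obtained from a fractional integral with lower limit `jτ`. -/
def marchaudInner (α j τ a : ℝ) : ℝ := (τ ^ (1 + α))⁻¹ * plusPow (a - j * τ) (α - 1)

theorem measurable_marchaudInner (α j : ℝ) :
    Measurable (fun z : ℝ × ℝ => marchaudInner α j z.1 z.2) := by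
  unfold marchaudInner
  exact (by fun_prop : Measurable fun z : ℝ × ℝ => (z.1 ^ (1 + α))⁻¹).mul
    ((measurable_plusPow (α - 1)).comp (by fun_prop))

/-- A primitive in τ of τ^{-1-α} (a - jτ)^{α-1} is -(a/τ - j)^α / (α a). This is the source of the
terms (η - j)_+^α / η in `marchaudKernel`. -/
theorem marchaudInner_integral {α : ℝ} (hα : 0 < α) {j ε a : ℝ} (hj : 0 ≤ j) (hε : 0 < ε)
    (ha : 0 < a) :
    IntegrableOn (fun τ => marchaudInner α j τ a) (Set.Ioi ε) ∧
      ∫ τ in Set.Ioi ε, marchaudInner α j τ a = (max (a / ε - j) 0) ^ α / (α * a) := by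
  rcases hj.eq_or_lt with rfl | hj
  · have h1 : ∀ τ ∈ Set.Ioi ε, marchaudInner α 0 τ a = a ^ (α - 1) * τ ^ (-(1 + α)) := by
      intro τ hτ
      have hτ0 : 0 < τ := hε.trans hτ
      simp only [marchaudInner, zero_mul, sub_zero, plusPow, if_pos ha]
      rw [Real.rpow_neg hτ0.le, mul_comm]
    constructor
    · refine IntegrableOn.congr_fun ?_ (fun τ hτ => (h1 τ hτ).symm) measurableSet_Ioi
      exact (integrableOn_Ioi_rpow_of_lt (by linarith) hε).const_mul _
    · rw [setIntegral_congr_fun measurableSet_Ioi h1, integral_const_mul,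
        integral_Ioi_rpow_of_lt (by linarith) hε, sub_zero, max_eq_left (by positivity),
        Real.div_rpow ha.le hε.le, Real.rpow_sub_one ha.ne']
      have e : -(1 + α) + 1 = -α := by ring
      rw [e, Real.rpow_neg hε.le]
      field_simp
  · have hzero : ∀ τ, a / j ≤ τ → marchaudInner α j τ a = 0 := by
      intro τ hτ
      rw [div_le_iff₀ hj] at hτ
      simp only [marchaudInner, plusPow]
      rw [if_neg (by linarith), mul_zero]
    rcases le_total (a / j) ε with h | h
    · have h0 : ∀ τ ∈ Set.Ioi ε, marchaudInner α j τ a = 0 := fun τ hτ =>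
        hzero τ (h.trans (le_of_lt hτ))
      constructor
      · exact integrableOn_zero.congr_fun (fun τ hτ => (h0 τ hτ).symm) measurableSet_Ioi
      · rw [setIntegral_congr_fun measurableSet_Ioi h0, max_eq_right]
        · simp [Real.zero_rpow hα.ne']
        · rw [sub_nonpos, div_le_iff₀ hε, mul_comm, ← div_le_iff₀ hj]; exact h
    · set g : ℝ → ℝ := fun τ => -(a / τ - j) ^ α / (α * a) with hg
      have hcont : ContinuousOn g (Set.Icc ε (a / j)) := by
        intro τ hτ
        have hτ0 : τ ≠ 0 := (hε.trans_le hτ.1).ne'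
        have h1 : ContinuousAt (fun τ : ℝ => a / τ - j) τ :=
          (continuousAt_const.div continuousAt_id hτ0).sub continuousAt_const
        exact ((h1.rpow_const (Or.inr hα.le)).neg.div_const _).continuousWithinAt
      have hderiv : ∀ τ ∈ Set.Ioo ε (a / j), HasDerivAt g (marchaudInner α j τ a) τ := by
        intro τ hτ
        have hτ0 : 0 < τ := hε.trans hτ.1
        have hpos : 0 < a - j * τ := by
          have := (lt_div_iff₀ hj).1 hτ.2
          linarith
        have hpos' : 0 < a / τ - j := by
          have : a / τ - j = (a - j * τ) / τ := by field_simp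
          rw [this]; positivity
        have h1 : HasDerivAt (fun τ : ℝ => a / τ - j) (-(a / τ ^ 2)) τ := by
          have := ((hasDerivAt_inv hτ0.ne').const_mul a).sub_const j
          refine this.congr_deriv ?_
          ring
        have h2 := ((h1.rpow_const (p := α) (Or.inl hpos'.ne')).neg).div_const (α * a)
        refine h2.congr_deriv ?_
        simp only [marchaudInner, plusPow, if_pos hpos]
        have e1 : a / τ - j = (a - j * τ) / τ := by field_simp
        rw [e1, Real.div_rpow hpos.le hτ0.le, Real.rpow_sub_one hτ0.ne', Real.rpow_add hτ0,
          Real.rpow_one]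
        field_simp
      have hnn : ∀ τ ∈ Set.Ioo ε (a / j), 0 ≤ marchaudInner α j τ a := fun τ hτ => by
        have hτ0 : 0 < τ := hε.trans hτ.1
        exact mul_nonneg (by positivity) (plusPow_nonneg _ _)
      -- For α < 1 the integrand is singular at τ = a/j. Being a nonnegative derivative of a
      -- function continuous up to that endpoint, it is still integrable.
      have hint := intervalIntegral.integrableOn_deriv_of_nonneg hcont hderiv hnn
      have hftc := intervalIntegral.integral_eq_sub_of_hasDerivAt_of_le h hcont hderiv
        ((intervalIntegrable_iff_integrableOn_Ioc_of_le h).2 hint)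
      have hdiff : ∀ τ ∈ Set.Ioi ε \ Set.Ioc ε (a / j), marchaudInner α j τ a = 0 := by
        rintro τ ⟨h1, h2⟩
        refine hzero τ ?_
        by_contra h3
        exact h2 ⟨h1, (not_le.1 h3).le⟩
      constructor
      · exact hint.of_forall_sdiff_eq_zero measurableSet_Ioi hdiff
      · rw [setIntegral_eq_of_subset_of_forall_sdiff_eq_zero measurableSet_Ioi
          Set.Ioc_subset_Ioi_self hdiff, ← intervalIntegral.integral_of_le h, hftc]
        have e2 : a / (a / j) - j = 0 := by field_simp; ring
        have e3 : 0 ≤ a / ε - j := by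
          rw [sub_nonneg, le_div_iff₀ hε, mul_comm, ← le_div_iff₀ hj]; exact h
        simp only [hg, e2, Real.zero_rpow hα.ne']
        rw [max_eq_left e3]
        ring

theorem max_sub_rpow_le {α : ℝ} (hα : 0 < α) {j ε a : ℝ} (hj : 0 ≤ j) (hε : 0 < ε)
    (ha : 0 < a) :
    (max (a / ε - j) 0) ^ α / (α * a) ≤ (α * ε ^ α)⁻¹ * a ^ (α - 1) := by
  have h : (max (a / ε - j) 0) ^ α ≤ (a / ε) ^ α :=
    Real.rpow_le_rpow (le_max_right _ _) (max_le (by linarith) (by positivity)) hα.le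
  calc _ ≤ (a / ε) ^ α / (α * a) := by gcongr
    _ = _ := by
      rw [Real.div_rpow ha.le hε.le, Real.rpow_sub_one ha.ne']
      field_simp

/-- Integrating the nonnegative kernel in τ first leaves at most a constant times a^{α-1} |H(a)|,
which is integrable by assumption. This justifies Fubini's theorem below. -/
theorem integrable_marchaudInner_prod {α : ℝ} (hα : 0 < α) {j ε : ℝ} (hj : 0 ≤ j) (hε : 0 < ε)
    {H : ℝ → ℂ} (hHm : StronglyMeasurable H)
    (hH : IntegrableOn (fun a => a ^ (α - 1) • H a) (Set.Ioi 0)) :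
    Integrable (fun z : ℝ × ℝ => marchaudInner α j z.1 z.2 • H z.2)
      ((volume.restrict (Set.Ioi ε)).prod (volume.restrict (Set.Ioi 0))) := by
  have hm : AEStronglyMeasurable (fun z : ℝ × ℝ => marchaudInner α j z.1 z.2 • H z.2)
      ((volume.restrict (Set.Ioi ε)).prod (volume.restrict (Set.Ioi 0))) :=
    ((measurable_marchaudInner α j).stronglyMeasurable.smul
      (hHm.comp_measurable measurable_snd)).aestronglyMeasurable
  rw [integrable_prod_iff' hm]
  constructor
  · filter_upwards [ae_restrict_mem measurableSet_Ioi] with a ha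
    exact (marchaudInner_integral hα hj hε ha).1.smul_const _
  · have hmeas : AEStronglyMeasurable (fun a : ℝ => ∫ τ in Set.Ioi ε,
        ‖marchaudInner α j τ a • H a‖) (volume.restrict (Set.Ioi 0)) := 
      hm.norm.prod_swap.integral_prod_right'
    refine (hH.norm.const_mul (α * ε ^ α)⁻¹).mono' hmeas ?_
    filter_upwards [ae_restrict_mem measurableSet_Ioi] with a ha
    have ha : 0 < a := ha
    have h1 : ∀ τ ∈ Set.Ioi ε, ‖marchaudInner α j τ a • H a‖ = marchaudInner α j τ a * ‖H a‖ := by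
      intro τ hτ
      have hτ0 : 0 < τ := hε.trans hτ
      rw [norm_smul, Real.norm_of_nonneg]
      exact mul_nonneg (by positivity) (plusPow_nonneg _ _)
    rw [setIntegral_congr_fun measurableSet_Ioi h1, integral_mul_const,
      (marchaudInner_integral hα hj hε ha).2, norm_smul, Real.norm_of_nonneg (by positivity),
      Real.norm_of_nonneg (by positivity), ← mul_assoc]
    exact mul_le_mul_of_nonneg_right (max_sub_rpow_le hα hj hε ha) (norm_nonneg _)

/-- A truncated Marchaud derivative of a fractional integral is an average of its density. -/
theorem marchaud_eq_average {α : ℝ} (hα : 0 < α) (ℓ : ℕ) {H h : ℝ → ℂ}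
    (hHm : StronglyMeasurable H)
    (hH : IntegrableOn (fun a => a ^ (α - 1) • H a) (Set.Ioi 0))
    (h0 : h 0 = (Real.Gamma α)⁻¹ • ∫ a in Set.Ioi 0, a ^ (α - 1) • H a)
    (hh : ∀ᵐ b ∂(volume.restrict (Set.Ioi (0 : ℝ))),
      h (-b) = (Real.Gamma α)⁻¹ • ∫ a in Set.Ioi 0, plusPow (a - b) (α - 1) • H a)
    {ε : ℝ} (hε : 0 < ε) :
    IntegrableOn (marchaudIntegrand α ℓ h) (Set.Ioi ε) ∧
    ∫ τ in Set.Ioi ε, marchaudIntegrand α ℓ h τ =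
      (Real.Gamma (α + 1))⁻¹ • ∫ a in Set.Ioi 0, (ε⁻¹ * marchaudKernel α ℓ (a / ε)) • H a := by
  have hterm : ∀ j : ℕ, ∀ᵐ τ ∂(volume.restrict (Set.Ioi ε)),
      (τ ^ (1 + α))⁻¹ • h (0 - j * τ) =
        (Real.Gamma α)⁻¹ • ∫ a in Set.Ioi 0, marchaudInner α j τ a • H a := by
    intro j
    have hshift : ∀ᵐ τ ∂(volume.restrict (Set.Ioi ε)), h (0 - j * τ) =
        (Real.Gamma α)⁻¹ • ∫ a in Set.Ioi 0, plusPow (a - j * τ) (α - 1) • H a := by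
      -- The formula for h(-b) is known for almost every b only. For j > 0 it passes to b = jτ
      -- because dilations preserve null sets; for j = 0 the single point b = 0 is needed, hence the
      -- separate hypothesis `h0`.
      rcases Nat.eq_zero_or_pos j with rfl | hj
      · refine Eventually.of_forall fun τ => ?_
        simp only [Nat.cast_zero, zero_mul, sub_zero, h0]
        congr 1
        refine setIntegral_congr_fun measurableSet_Ioi fun a ha => ?_
        simp only [plusPow, if_pos (Set.mem_Ioi.1 ha)]
      · have hj' : (0 : ℝ) < j := by exact_mod_cast hj
        rw [ae_restrict_iff' measurableSet_Ioi] at hh ⊢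
        have hq : Measure.QuasiMeasurePreserving (fun τ : ℝ => (j : ℝ) * τ) volume volume := by
          refine ⟨by fun_prop, ?_⟩
          rw [Real.map_volume_mul_left hj'.ne']
          exact Measure.smul_absolutelyContinuous
        filter_upwards [hq.ae hh] with τ hτ h1
        have := hτ (mul_pos hj' (hε.trans h1))
        rwa [zero_sub]
    filter_upwards [hshift] with τ hτ
    rw [hτ, smul_comm, ← integral_smul]
    simp only [marchaudInner, smul_smul]
  have hprod := fun j : ℕ => integrable_marchaudInner_prod hα (Nat.cast_nonneg j) hε hHm hH
  have hintj : ∀ j : ℕ, IntegrableOn (fun τ : ℝ => (τ ^ (1 + α))⁻¹ • h (0 - j * τ)) (Set.Ioi ε) :=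
    fun j => ((hprod j).integral_prod_left.smul (Real.Gamma α)⁻¹).congr
      ((hterm j).mono fun τ hτ => hτ.symm)
  have hswap : ∀ j : ℕ, ∫ τ in Set.Ioi ε, (τ ^ (1 + α))⁻¹ • h (0 - j * τ) =
      (Real.Gamma α)⁻¹ • ∫ a in Set.Ioi 0, ((max (a / ε - j) 0) ^ α / (α * a)) • H a := by
    intro j
    rw [integral_congr_ae (hterm j), integral_smul,
      integral_integral_swap (f := fun τ a => marchaudInner α j τ a • H a) (hprod j)]
    congr 1
    refine setIntegral_congr_fun measurableSet_Ioi fun a ha => ?_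
    rw [integral_smul_const, (marchaudInner_integral hα (Nat.cast_nonneg j) hε ha).2]
  have hK : ∀ j : ℕ, IntegrableOn (fun a : ℝ => ((max (a / ε - j) 0) ^ α / (α * a)) • H a)
      (Set.Ioi 0) := by
    intro j
    refine (hH.norm.const_mul (α * ε ^ α)⁻¹).mono' ?_ ?_
    · have : Measurable fun a : ℝ => (max (a / ε - j) 0) ^ α / (α * a) := by fun_prop
      exact this.aestronglyMeasurable.smul hHm.aestronglyMeasurable
    · filter_upwards [ae_restrict_mem measurableSet_Ioi] with a ha
      have ha : 0 < a := ha
      rw [norm_smul, norm_smul, Real.norm_of_nonneg (by positivity),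
        Real.norm_of_nonneg (by positivity), ← mul_assoc]
      exact mul_le_mul_of_nonneg_right (max_sub_rpow_le hα (Nat.cast_nonneg j) hε ha)
        (norm_nonneg _)
  have hsum : marchaudIntegrand α ℓ h = fun τ => ∑ j ∈ Finset.range (ℓ + 1),
      ((ℓ.choose j : ℝ) * (-1) ^ j) • ((τ ^ (1 + α))⁻¹ • h (0 - j * τ)) := by
    funext τ
    simp only [marchaudIntegrand, finDiff, Finset.smul_sum]
    exact Finset.sum_congr rfl fun j _ => smul_comm _ _ _
  rw [hsum]
  have hintj' : ∀ j ∈ Finset.range (ℓ + 1), Integrable (fun τ : ℝ =>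
      ((ℓ.choose j : ℝ) * (-1) ^ j) • ((τ ^ (1 + α))⁻¹ • h (0 - j * τ)))
      (volume.restrict (Set.Ioi ε)) :=
    fun j _ => (hintj j).smul ((ℓ.choose j : ℝ) * (-1) ^ j)
  have hK' : ∀ j ∈ Finset.range (ℓ + 1), Integrable (fun a : ℝ =>
      ((ℓ.choose j : ℝ) * (-1) ^ j) • (((max (a / ε - j) 0) ^ α / (α * a)) • H a))
      (volume.restrict (Set.Ioi 0)) :=
    fun j _ => (hK j).smul ((ℓ.choose j : ℝ) * (-1) ^ j)
  refine ⟨integrable_finsetSum _ hintj', ?_⟩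
  rw [integral_finsetSum _ hintj']
  simp only [integral_smul, hswap]
  simp only [smul_comm _ (Real.Gamma α)⁻¹]
  rw [← Finset.smul_sum]
  simp only [← integral_smul]
  -- The factor α in Γ(α + 1) = α Γ(α) is supplied by the denominator α a of the inner integral.
  rw [← integral_finsetSum _ hK', Real.Gamma_add_one hα.ne', mul_inv, mul_comm, ← integral_smul]
  refine setIntegral_congr_fun measurableSet_Ioi fun a ha => ?_
  have ha : 0 < a := ha
  simp only [smul_smul]
  rw [← Finset.sum_smul, smul_smul]
  congr 1
  simp only [marchaudKernel]
  rw [Finset.sum_div, Finset.mul_sum, Finset.mul_sum, Finset.mul_sum]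
  refine Finset.sum_congr rfl fun j _ => ?_
  field_simp

/-- Since 1 - e^{-τ} ≤ min(τ, 1), the integrand is at most the majorant with ℓ - α in place of α. -/
theorem integrableOn_kappa {α : ℝ} (hα : 0 < α) {ℓ : ℕ} (hℓ : α < ℓ) :
    IntegrableOn (fun τ : ℝ => (1 - Real.exp (-τ)) ^ ℓ / τ ^ (1 + α)) (Set.Ioi 0) := by
  refine (integrableOn_kernelMajorant (α := ℓ - α) (ℓ := ℓ) (by linarith) (by linarith)).mono'
    (Measurable.aestronglyMeasurable (by fun_prop)) ?_
  filter_upwards [ae_restrict_mem measurableSet_Ioi] with τ hτ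
  have hτ : 0 < τ := hτ
  have h1 : 0 ≤ 1 - Real.exp (-τ) := by
    rw [sub_nonneg]; exact Real.exp_le_one_iff.2 (by linarith)
  have h2 : 1 - Real.exp (-τ) ≤ 1 := by linarith [Real.exp_pos (-τ)]
  have h3 : 1 - Real.exp (-τ) ≤ τ := by linarith [Real.add_one_le_exp (-τ)]
  rw [Real.norm_of_nonneg (by positivity)]
  refine le_min ?_ ?_
  · have e : τ ^ ((ℓ : ℝ) - α - 1) = τ ^ ℓ / τ ^ (1 + α) := by
      rw [← Real.rpow_natCast τ ℓ, ← Real.rpow_sub hτ]; congr 1; ring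
    rw [e]
    gcongr
  · have e : τ ^ ((ℓ : ℝ) - α - 1 - ℓ) = 1 / τ ^ (1 + α) := by
      rw [one_div, ← Real.rpow_neg hτ.le]; congr 1; ring
    rw [e]
    gcongr
    exact pow_le_one₀ h1 h2

theorem kappa_pos {α : ℝ} (hα : 0 < α) {ℓ : ℕ} (hℓ : α < ℓ) : 0 < kappa α ℓ := by
  have hpos : ∀ τ ∈ Set.Ioi (0 : ℝ), 0 < (1 - Real.exp (-τ)) ^ ℓ / τ ^ (1 + α) := by
    intro τ hτ
    have hτ : 0 < τ := hτ
    have h1 : 0 < 1 - Real.exp (-τ) := by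
      rw [sub_pos]; exact Real.exp_lt_one_iff.2 (by linarith)
    positivity
  unfold kappa
  rw [setIntegral_pos_iff_support_of_nonneg_ae _ (integrableOn_kappa hα hℓ)]
  · have : Function.support (fun τ : ℝ => (1 - Real.exp (-τ)) ^ ℓ / τ ^ (1 + α)) ∩ Set.Ioi 0 =
        Set.Ioi 0 := Set.inter_eq_right.2 fun τ hτ => (hpos τ hτ).ne'
    rw [this]
    simp
  · filter_upwards [ae_restrict_mem measurableSet_Ioi] with τ hτ
    exact (hpos τ hτ).le

theorem tendsto_setIntegral_Ioi_zero {f : ℝ → ℝ} (hf : IntegrableOn f (Set.Ioi 0)) :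
    Tendsto (fun ε : ℝ => ∫ τ in Set.Ioi ε, f τ) (𝓝[>] 0) (𝓝 (∫ τ in Set.Ioi 0, f τ)) := by
  have h : Tendsto (fun ε : ℝ => ∫ τ in Set.Ioi 0, (Set.Ioi ε).indicator f τ) (𝓝[>] 0)
      (𝓝 (∫ τ in Set.Ioi 0, f τ)) := by
    refine tendsto_integral_filter_of_dominated_convergence (fun τ => ‖f τ‖) ?_ ?_ hf.norm ?_
    · exact Eventually.of_forall fun ε => hf.aestronglyMeasurable.indicator measurableSet_Ioi
    · exact Eventually.of_forall fun ε => Eventually.of_forall fun τ => norm_indicator_le_norm_self _ _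
    · filter_upwards [ae_restrict_mem measurableSet_Ioi] with τ hτ
      refine tendsto_const_nhds.congr' ?_
      filter_upwards [nhdsWithin_le_nhds (Iio_mem_nhds (Set.mem_Ioi.1 hτ))] with ε hε
      rw [Set.indicator_of_mem (show τ ∈ Set.Ioi ε from hε)]
  refine h.congr' ?_
  filter_upwards [self_mem_nhdsWithin] with ε hε
  rw [setIntegral_indicator measurableSet_Ioi, Set.inter_eq_right.2]
  exact Set.Ioi_subset_Ioi (le_of_lt hε)

theorem integrableOn_marchaudKernel {α : ℝ} (hα : 0 < α) {ℓ : ℕ} (hℓ : α < ℓ) :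
    IntegrableOn (marchaudKernel α ℓ) (Set.Ioi 0) := by
  obtain ⟨C, -, hC⟩ := abs_marchaudKernel_le hα ℓ
  refine ((integrableOn_kernelMajorant hα hℓ).const_mul C).mono'
    (measurable_marchaudKernel α ℓ).aestronglyMeasurable ?_
  filter_upwards [ae_restrict_mem measurableSet_Ioi] with a ha using hC a ha

theorem setIntegral_dilate {E : Type*} [NormedAddCommGroup E] [NormedSpace ℝ E]
    (f : ℝ → E) {ε : ℝ} (hε : 0 < ε) :
    ∫ a in Set.Ioi 0, ε⁻¹ • f (a / ε) = ∫ a in Set.Ioi 0, f a := by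
  rw [integral_smul]
  have := integral_comp_mul_right_Ioi f 0 (inv_pos.2 hε)
  simp only [← div_eq_mul_inv, zero_div, inv_inv] at this
  rw [this, smul_smul, inv_mul_cancel₀ hε.ne', one_smul]

/-- The exponential is reproduced by fractional integration over the half-line. It is the test
function from which the mass of the averaging kernel is computed. -/
theorem integral_plusPow_mul_exp {α : ℝ} (hα : 0 < α) {b : ℝ} (hb : 0 ≤ b) :
    ∫ a in Set.Ioi 0, plusPow (a - b) (α - 1) * Real.exp (-a) = Real.Gamma α * Real.exp (-b) := by
  have h1 : ∀ a, a ∉ Set.Ioi (0 : ℝ) → plusPow (a - b) (α - 1) * Real.exp (-a) = 0 := by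
    intro a ha
    have ha : a ≤ 0 := not_lt.1 ha
    rw [plusPow, if_neg (by linarith), zero_mul]
  rw [setIntegral_eq_integral_of_forall_compl_eq_zero h1]
  have h2 := integral_sub_right_eq_self (μ := volume)
    (fun a : ℝ => plusPow a (α - 1) * Real.exp (-(a + b))) b
  simp only [sub_add_cancel] at h2
  have h3 : ∀ a, a ∉ Set.Ioi (0 : ℝ) → plusPow a (α - 1) * Real.exp (-(a + b)) = 0 := by
    intro a ha
    rw [plusPow, if_neg (by simpa using ha), zero_mul]
  rw [h2, ← setIntegral_eq_integral_of_forall_compl_eq_zero h3, Real.Gamma_eq_integral hα,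
    ← integral_mul_const]
  refine setIntegral_congr_fun measurableSet_Ioi fun a ha => ?_
  simp only [plusPow, if_pos (Set.mem_Ioi.1 ha)]
  rw [neg_add, Real.exp_add]
  ring

theorem marchaudIntegrand_exp (α : ℝ) (ℓ : ℕ) (τ : ℝ) :
    marchaudIntegrand α ℓ (fun u => ((Real.exp u : ℝ) : ℂ)) τ =
      (((1 - Real.exp (-τ)) ^ ℓ / τ ^ (1 + α) : ℝ) : ℂ) := by
  have h : (1 - Real.exp (-τ)) ^ ℓ =
      ∑ j ∈ Finset.range (ℓ + 1), ((ℓ.choose j : ℝ) * (-1) ^ j) * Real.exp (0 - j * τ) := by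
    rw [sub_eq_add_neg, add_comm, add_pow]
    refine Finset.sum_congr rfl fun j _ => ?_
    rw [one_pow, mul_one, neg_pow, ← Real.exp_nat_mul, zero_sub, mul_neg]
    ring
  rw [h, div_eq_inv_mul]
  simp only [marchaudIntegrand, finDiff, Complex.real_smul]
  push_cast
  rfl

/-- Apply `marchaud_eq_average` to the density e^{-a}, where both sides are explicit by the binomial
theorem, and let ε → 0: one side tends to ϰ(α, ℓ), the other to the mass divided by Γ(α + 1). -/
theorem integral_marchaudKernel {α : ℝ} (hα : 0 < α) {ℓ : ℕ} (hℓ : α < ℓ) :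
    ∫ a in Set.Ioi 0, marchaudKernel α ℓ a = Real.Gamma (α + 1) * kappa α ℓ := by
  have hΓ : 0 < Real.Gamma α := Real.Gamma_pos_of_pos hα
  have hΓ1 : 0 < Real.Gamma (α + 1) := Real.Gamma_pos_of_pos (by linarith)
  have hG : IntegrableOn (fun a : ℝ => a ^ (α - 1) • ((Real.exp (-a) : ℝ) : ℂ)) (Set.Ioi 0) := by
    have := (Real.GammaIntegral_convergent hα).ofReal (𝕜 := ℂ)
    refine IntegrableOn.congr_fun this (fun a _ => ?_) measurableSet_Ioi
    simp [mul_comm]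
  have hform : ∀ b : ℝ, 0 ≤ b → ((Real.exp (-b) : ℝ) : ℂ) = (Real.Gamma α)⁻¹ •
      ∫ a in Set.Ioi 0, plusPow (a - b) (α - 1) • ((Real.exp (-a) : ℝ) : ℂ) := by
    intro b hb
    simp only [Complex.real_smul, ← Complex.ofReal_mul]
    rw [integral_complex_ofReal, integral_plusPow_mul_exp hα hb, ← Complex.ofReal_mul,
      inv_mul_cancel_left₀ hΓ.ne']
  have hkey : ∀ ε : ℝ, 0 < ε →
      (Real.Gamma (α + 1))⁻¹ * ∫ a in Set.Ioi 0, marchaudKernel α ℓ a * Real.exp (-(ε * a)) =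
        ∫ τ in Set.Ioi ε, (1 - Real.exp (-τ)) ^ ℓ / τ ^ (1 + α) := by
    intro ε hε
    have := (marchaud_eq_average hα ℓ (H := fun a => ((Real.exp (-a) : ℝ) : ℂ))
      (h := fun u => ((Real.exp u : ℝ) : ℂ))
      (Measurable.stronglyMeasurable (by fun_prop)) hG ?_ ?_ hε).2
    · simp only [marchaudIntegrand_exp, Complex.real_smul, ← Complex.ofReal_mul] at this
      rw [integral_complex_ofReal, integral_complex_ofReal, ← Complex.ofReal_mul,
        Complex.ofReal_inj] at this
      rw [this, ← setIntegral_dilate (fun a => marchaudKernel α ℓ a * Real.exp (-(ε * a))) hε]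
      congr 1
      refine setIntegral_congr_fun measurableSet_Ioi fun a _ => ?_
      simp only [smul_eq_mul]
      rw [mul_div_cancel₀ _ hε.ne', mul_assoc]
    · have := hform 0 le_rfl
      rw [neg_zero] at this
      rw [this]
      congr 1
      refine setIntegral_congr_fun measurableSet_Ioi fun a ha => ?_
      simp only [plusPow, sub_zero, if_pos (Set.mem_Ioi.1 ha)]
    · filter_upwards [ae_restrict_mem measurableSet_Ioi] with b hb using hform b (le_of_lt hb)
  have hlim1 := tendsto_setIntegral_Ioi_zero (integrableOn_kappa hα hℓ)
  have hlim2 : Tendsto (fun ε : ℝ => (Real.Gamma (α + 1))⁻¹ *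
      ∫ a in Set.Ioi 0, marchaudKernel α ℓ a * Real.exp (-(ε * a))) (𝓝[>] 0)
      (𝓝 ((Real.Gamma (α + 1))⁻¹ * ∫ a in Set.Ioi 0, marchaudKernel α ℓ a)) := by
    refine Tendsto.const_mul _ ?_
    refine tendsto_integral_filter_of_dominated_convergence (fun a => ‖marchaudKernel α ℓ a‖)
      ?_ ?_ (integrableOn_marchaudKernel hα hℓ).norm ?_
    · have := measurable_marchaudKernel α ℓ
      exact Eventually.of_forall fun ε => Measurable.aestronglyMeasurable (by fun_prop)
    · filter_upwards [self_mem_nhdsWithin] with ε hε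
      filter_upwards [ae_restrict_mem measurableSet_Ioi] with a ha
      rw [norm_mul, Real.norm_of_nonneg (Real.exp_pos _).le]
      refine mul_le_of_le_one_right (norm_nonneg _) (Real.exp_le_one_iff.2 ?_)
      have := mul_pos (Set.mem_Ioi.1 hε) (Set.mem_Ioi.1 ha)
      linarith
    · refine Eventually.of_forall fun a => ?_
      have hc : Continuous fun ε : ℝ => marchaudKernel α ℓ a * Real.exp (-(ε * a)) := by fun_prop
      have := (hc.tendsto 0).mono_left (nhdsWithin_le_nhds (s := Set.Ioi (0 : ℝ)))
      simpa using this
  have heq : (Real.Gamma (α + 1))⁻¹ * ∫ a in Set.Ioi 0, marchaudKernel α ℓ a = kappa α ℓ := by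
    refine tendsto_nhds_unique hlim2 (hlim1.congr' ?_)
    filter_upwards [self_mem_nhdsWithin] with ε hε using (hkey ε hε).symm
  rw [← heq, mul_inv_cancel_left₀ hΓ1.ne']

/-- Inversion of a fractional integral on the half-line at a Lebesgue point of the density. -/
theorem tendsto_marchaud {α : ℝ} (hα : 0 < α) {ℓ : ℕ} (hℓ : α < ℓ) {H h : ℝ → ℂ} {c : ℂ}
    (hHm : StronglyMeasurable H)
    (hH : IntegrableOn (fun a => a ^ (α - 1) • H a) (Set.Ioi 0))
    (hloc : ∀ ω : ℝ, 0 < ω → ∃ T > 0, ∀ b, 0 < b → b ≤ T →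
      ∫⁻ a in Set.Ioc 0 b, ‖H a - c‖ₑ ≤ ENNReal.ofReal ω * ENNReal.ofReal b)
    (h0 : h 0 = (Real.Gamma α)⁻¹ • ∫ a in Set.Ioi 0, a ^ (α - 1) • H a)
    (hh : ∀ᵐ b ∂(volume.restrict (Set.Ioi (0 : ℝ))),
      h (-b) = (Real.Gamma α)⁻¹ • ∫ a in Set.Ioi 0, plusPow (a - b) (α - 1) • H a) :
    Tendsto (fun ε : ℝ => ∫ τ in Set.Ioi ε, marchaudIntegrand α ℓ h τ) (𝓝[>] 0)
      (𝓝 (kappa α ℓ • c)) := by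
  have hΓ1 : 0 < Real.Gamma (α + 1) := Real.Gamma_pos_of_pos (by linarith)
  obtain ⟨C, hC0, hC⟩ := abs_marchaudKernel_le hα ℓ
  have hq : Measurable fun a => ‖H a - c‖ₑ := (hHm.sub stronglyMeasurable_const).enorm
  have htail : ∀ T : ℝ, 0 < T →
      ∫⁻ a in Set.Ioi T, ENNReal.ofReal (a ^ (α - 1 - ℓ)) * ‖H a - c‖ₑ ≠ ∞ := by
    intro T hT
    have hi : IntegrableOn (fun a : ℝ => a ^ (α - 1 - ℓ) • (H a - c)) (Set.Ioi T) := by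
      simp only [smul_sub]
      refine Integrable.sub ?_ ?_
      · have h1 : IntegrableOn (fun a => a ^ (α - 1) • H a) (Set.Ioi T) :=
          hH.mono_set (Set.Ioi_subset_Ioi hT.le)
        refine (h1.norm.const_mul (T ^ (-(ℓ : ℝ)))).mono' ?_ ?_
        · have : Measurable fun a : ℝ => a ^ (α - 1 - ℓ) := by fun_prop
          exact this.aestronglyMeasurable.smul hHm.aestronglyMeasurable
        · filter_upwards [ae_restrict_mem measurableSet_Ioi] with a ha
          have ha0 : 0 < a := hT.trans ha
          rw [norm_smul, norm_smul, Real.norm_of_nonneg (by positivity),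
            Real.norm_of_nonneg (by positivity), sub_eq_add_neg (α - 1), Real.rpow_add ha0,
            ← mul_assoc, mul_comm (T ^ (-(ℓ : ℝ)))]
          refine mul_le_mul_of_nonneg_right (mul_le_mul_of_nonneg_left ?_ (by positivity))
            (norm_nonneg _)
          exact Real.rpow_le_rpow_of_nonpos hT (le_of_lt ha) (neg_nonpos.2 (Nat.cast_nonneg ℓ))
      · exact (integrableOn_Ioi_rpow_of_lt (by linarith) hT).smul_const c
    have := hi.2
    rw [HasFiniteIntegral] at this
    refine ne_of_lt (lt_of_le_of_lt (le_of_eq ?_) this)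
    refine setLIntegral_congr_fun measurableSet_Ioi fun a ha => ?_
    have ha0 : 0 < a := hT.trans ha
    simp only [enorm_smul]
    rw [Real.enorm_eq_ofReal (by positivity)]
  have hkq : ∀ ε : ℝ, Measurable fun a => dilatedMajorant α ℓ ε a * ‖H a - c‖ₑ :=
    fun ε => (measurable_dilatedMajorant α ℓ ε).mul hq
  have hlim := tendsto_lintegral_dilatedMajorant_mul hα hℓ hq hloc htail
  have hKi : ∀ ε : ℝ, 0 < ε →
      IntegrableOn (fun a => ε⁻¹ * marchaudKernel α ℓ (a / ε)) (Set.Ioi 0) := by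
    intro ε hε
    have := (integrableOn_Ioi_comp_mul_right_iff (marchaudKernel α ℓ) 0 (inv_pos.2 hε)).2
      (by simpa using integrableOn_marchaudKernel hα hℓ)
    simpa [div_eq_mul_inv, IntegrableOn] using this.const_mul ε⁻¹
  have hbound : ∀ ε : ℝ, 0 < ε → ∀ a ∈ Set.Ioi (0 : ℝ),
      ‖(ε⁻¹ * marchaudKernel α ℓ (a / ε)) • (H a - c)‖ₑ ≤
        ENNReal.ofReal C * (dilatedMajorant α ℓ ε a * ‖H a - c‖ₑ) := by
    intro ε hε a ha
    have ha : 0 < a := ha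
    rw [enorm_smul, ← mul_assoc]
    gcongr
    rw [dilatedMajorant, ← ENNReal.ofReal_mul hC0.le, Real.enorm_eq_ofReal_abs]
    refine ENNReal.ofReal_le_ofReal ?_
    rw [abs_mul, abs_of_pos (inv_pos.2 hε), mul_left_comm]
    gcongr
    exact hC _ (by positivity)
  have hmean : Tendsto (fun ε : ℝ => ∫ a in Set.Ioi 0,
      (ε⁻¹ * marchaudKernel α ℓ (a / ε)) • (H a - c)) (𝓝[>] 0) (𝓝 0) := by
    rw [tendsto_zero_iff_enorm_tendsto_zero]
    have h2 : Tendsto (fun ε : ℝ => ENNReal.ofReal C * ∫⁻ a in Set.Ioi 0,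
        dilatedMajorant α ℓ ε a * ‖H a - c‖ₑ) (𝓝[>] 0) (𝓝 0) := by
      simpa using ENNReal.Tendsto.const_mul hlim (Or.inr ENNReal.ofReal_ne_top)
    refine tendsto_of_tendsto_of_tendsto_of_le_of_le' tendsto_const_nhds h2
      (Eventually.of_forall fun _ => zero_le) ?_
    filter_upwards [self_mem_nhdsWithin] with ε hε
    refine (enorm_integral_le_lintegral_enorm _).trans ?_
    rw [← lintegral_const_mul _ (hkq ε)]
    exact setLIntegral_mono' measurableSet_Ioi (hbound ε hε)
  -- Integrability of the kernel against H - c is taken from the limit of the lower integrals, which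
  -- are below 1 for small ε. It is what allows the average of H to be split into those of H - c and
  -- of c.
  have hfin : ∀ᶠ ε : ℝ in 𝓝[>] 0, IntegrableOn (fun a =>
      (ε⁻¹ * marchaudKernel α ℓ (a / ε)) • (H a - c)) (Set.Ioi 0) := by
    have h3 := hlim.eventually (gt_mem_nhds (show (0 : ℝ≥0∞) < 1 by simp))
    filter_upwards [h3, self_mem_nhdsWithin] with ε h4 hε
    have hKm : Measurable fun a : ℝ => ε⁻¹ * marchaudKernel α ℓ (a / ε) := by
      have := measurable_marchaudKernel α ℓ
      fun_prop
    refine ⟨hKm.aestronglyMeasurable.smul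
      (hHm.sub stronglyMeasurable_const).aestronglyMeasurable, ?_⟩
    rw [HasFiniteIntegral]
    refine (setLIntegral_mono' measurableSet_Ioi (hbound ε hε)).trans_lt ?_
    rw [lintegral_const_mul _ (hkq ε)]
    exact ENNReal.mul_lt_top ENNReal.ofReal_lt_top (h4.trans ENNReal.one_lt_top)
  have hfinal := (hmean.const_smul (Real.Gamma (α + 1))⁻¹).add_const (kappa α ℓ • c)
  rw [smul_zero, zero_add] at hfinal
  refine hfinal.congr' ?_
  filter_upwards [hfin, self_mem_nhdsWithin] with ε hint hε
  have hε : 0 < ε := hε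
  rw [(marchaud_eq_average hα ℓ hHm hH h0 hh hε).2]
  have hsplit : ∀ a : ℝ, (ε⁻¹ * marchaudKernel α ℓ (a / ε)) • H a =
      (ε⁻¹ * marchaudKernel α ℓ (a / ε)) • (H a - c) +
        (ε⁻¹ * marchaudKernel α ℓ (a / ε)) • c := fun a => by rw [← smul_add, sub_add_cancel]
  simp only [hsplit]
  rw [integral_add hint ((hKi ε hε).smul_const c), integral_smul_const, smul_add]
  have := setIntegral_dilate (marchaudKernel α ℓ) hε
  simp only [smul_eq_mul] at this
  rw [this, integral_marchaudKernel hα hℓ, smul_smul, inv_mul_cancel_left₀ hΓ1.ne']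

/-! ### Harmonicity along coordinate lines and the maximum principle -/

/-- The restrictions of `v` to the coordinate lines through `x` are twice differentiable at `x`,
and the second derivatives add up to zero. -/
def HarmonicOnLines {n : ℕ} (v : EuclideanSpace ℝ (Fin n) → ℝ) (x : EuclideanSpace ℝ (Fin n)) :
    Prop :=
  ∃ d : Fin n → ℝ, ∑ i, d i = 0 ∧ ∀ i, ∃ g' : ℝ → ℝ,
    (∀ᶠ h in 𝓝 (0 : ℝ), HasDerivAt (fun h => v (x + h • EuclideanSpace.single i (1 : ℝ))) (g' h) h) ∧
      HasDerivAt g' (d i) 0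

theorem HarmonicOnLines.sub {n : ℕ} {v w : EuclideanSpace ℝ (Fin n) → ℝ}
    {x : EuclideanSpace ℝ (Fin n)} (hv : HarmonicOnLines v x) (hw : HarmonicOnLines w x) :
    HarmonicOnLines (fun y => v y - w y) x := by
  obtain ⟨d, hd, h⟩ := hv
  obtain ⟨e, he, k⟩ := hw
  refine ⟨fun i => d i - e i, by rw [Finset.sum_sub_distrib, hd, he, sub_zero], fun i => ?_⟩
  obtain ⟨g, hg, hg'⟩ := h i
  obtain ⟨r, hr, hr'⟩ := k i
  refine ⟨fun y => g y - r y, ?_, hg'.sub hr'⟩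
  filter_upwards [hg, hr] with y h1 h2 using h1.sub h2

theorem HarmonicOnLines.neg {n : ℕ} {v : EuclideanSpace ℝ (Fin n) → ℝ}
    {x : EuclideanSpace ℝ (Fin n)} (hv : HarmonicOnLines v x) :
    HarmonicOnLines (fun y => - v y) x := by
  obtain ⟨d, hd, h⟩ := hv
  refine ⟨fun i => - d i, by rw [Finset.sum_neg_distrib, hd, neg_zero], fun i => ?_⟩
  obtain ⟨g, hg, hg'⟩ := h i
  refine ⟨fun y => - g y, ?_, hg'.neg⟩
  filter_upwards [hg] with y h1 using h1.neg

theorem HarmonicOnLines.comp_smul {n : ℕ} {v : EuclideanSpace ℝ (Fin n) → ℝ}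
    {x : EuclideanSpace ℝ (Fin n)} (r : ℝ) (hv : HarmonicOnLines v (r • x)) :
    HarmonicOnLines (fun y => v (r • y)) x := by
  obtain ⟨d, hd, h⟩ := hv
  refine ⟨fun i => r * (d i * r), by rw [← Finset.mul_sum, ← Finset.sum_mul, hd]; simp, fun i => ?_⟩
  obtain ⟨g, hg, hg'⟩ := h i
  have hlin : ∀ y : ℝ, HasDerivAt (fun h : ℝ => r * h) r y := fun y => by
    simpa using (hasDerivAt_id y).const_mul r
  refine ⟨fun y => g (r * y) * r, ?_, ?_⟩
  · have hc : Tendsto (fun h : ℝ => r * h) (𝓝 0) (𝓝 0) := by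
      have : Continuous fun h : ℝ => r * h := by fun_prop
      simpa using this.tendsto 0
    filter_upwards [hc.eventually hg] with y hy
    have := HasDerivAt.comp y hy (hlin y)
    simpa [Function.comp_def, smul_add, smul_smul] using this
  · have h0 : HasDerivAt g (d i) (r * 0) := by simpa using hg'
    have := (HasDerivAt.comp 0 h0 (hlin 0)).mul_const r
    refine this.congr_deriv ?_
    ring

/-- A positive second derivative at a critical point gives a local minimum. If the point were also a
local maximum, g would be locally constant and its second derivative would vanish. -/
theorem not_isLocalMax_of_deriv_pos {g g' : ℝ → ℝ} {d : ℝ}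
    (hg : ∀ᶠ h in 𝓝 (0 : ℝ), HasDerivAt g (g' h) h) (hg' : HasDerivAt g' d 0) (hd : 0 < d) :
    ¬ IsLocalMax g 0 := by
  intro hmax
  have h0 : HasDerivAt g (g' 0) 0 := hg.self_of_nhds
  have hg0 : g' 0 = 0 := hmax.hasDerivAt_eq_zero h0
  have hder : deriv g =ᶠ[𝓝 0] g' := hg.mono fun h hh => hh.deriv
  have hdd : deriv (deriv g) 0 = d := by rw [hder.deriv_eq, hg'.deriv]
  have hmin : IsLocalMin g 0 :=
    isLocalMin_of_deriv_deriv_pos (by rw [hdd]; exact hd) (by rw [h0.deriv, hg0]) h0.continuousAt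
  have hconst : g =ᶠ[𝓝 0] fun _ => g 0 := by
    filter_upwards [hmax, hmin] with y h1 h2 using le_antisymm h1 h2
  have h1 : deriv g =ᶠ[𝓝 0] fun _ => 0 := by
    have := hconst.deriv
    simpa using this
  have h2 : deriv (deriv g) 0 = 0 := by rw [h1.deriv_eq]; simp
  rw [hdd] at h2
  exact hd.ne' h2

/-- Maximum principle. Adding e |y|² makes the second derivatives along the axes add up to 2en > 0,
so at any interior point one of them is positive and that point is not a maximum. -/
theorem HarmonicOnLines.le_of_le_sphere {n : ℕ} (hn : 0 < n) {v : EuclideanSpace ℝ (Fin n) → ℝ}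
    {R c : ℝ} (hcont : ContinuousOn v (Metric.closedBall 0 R))
    (hharm : ∀ x ∈ Metric.ball (0 : EuclideanSpace ℝ (Fin n)) R, HarmonicOnLines v x)
    (hbd : ∀ x ∈ Metric.sphere (0 : EuclideanSpace ℝ (Fin n)) R, v x ≤ c)
    {x : EuclideanSpace ℝ (Fin n)} (hx : x ∈ Metric.ball 0 R) : v x ≤ c := by
  have hR : 0 < R := Metric.nonempty_ball.1 ⟨x, hx⟩
  refine le_of_forall_pos_le_add fun ε hε => ?_
  -- With this choice the perturbation e |y|² equals ε on the boundary sphere.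
  set e : ℝ := ε / R ^ 2 with he
  have he0 : 0 < e := by positivity
  set V : EuclideanSpace ℝ (Fin n) → ℝ := fun y => v y + e * ‖y‖ ^ 2 with hV
  have hVc : ContinuousOn V (Metric.closedBall 0 R) := by
    refine hcont.add (Continuous.continuousOn ?_)
    fun_prop
  obtain ⟨y, hy, hmax⟩ := (isCompact_closedBall (0 : EuclideanSpace ℝ (Fin n)) R).exists_isMaxOn
    ⟨x, Metric.ball_subset_closedBall hx⟩ hVc
  have hVx : v x ≤ V y := by
    have h1 := hmax (Metric.ball_subset_closedBall hx)
    have h2 : v x ≤ V x := le_add_of_nonneg_right (by positivity)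
    exact h2.trans h1
  refine hVx.trans ?_
  have hyR : ‖y‖ ≤ R := by simpa using hy
  rcases hyR.lt_or_eq with hlt | heq
  · exfalso
    obtain ⟨d, hd, h⟩ := hharm y (by simpa using hlt)
    obtain ⟨i, hi⟩ : ∃ i, 0 < d i + 2 * e := by
      by_contra! hcon
      have h1 : ∑ i, (d i + 2 * e) ≤ 0 := Finset.sum_nonpos fun i _ => hcon i
      rw [Finset.sum_add_distrib, hd] at h1
      simp only [Finset.sum_const, Finset.card_univ, Fintype.card_fin, nsmul_eq_mul, zero_add] at h1
      have : (0 : ℝ) < n := by exact_mod_cast hn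
      nlinarith [mul_pos this he0]
    obtain ⟨g', hg, hg'⟩ := h i
    have hnorm : ∀ h : ℝ, ‖y + h • EuclideanSpace.single i (1 : ℝ)‖ ^ 2 =
        ‖y‖ ^ 2 + 2 * h * y i + h ^ 2 := by
      intro h
      rw [norm_add_sq_real, inner_smul_right, norm_smul]
      simp [EuclideanSpace.inner_single_right]
      ring
    have hlocal : IsLocalMax (fun h : ℝ => V (y + h • EuclideanSpace.single i (1 : ℝ))) 0 := by
      have hc : Continuous fun h : ℝ => y + h • EuclideanSpace.single i (1 : ℝ) := by fun_prop
      have hn : Metric.closedBall (0 : EuclideanSpace ℝ (Fin n)) R ∈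
          𝓝 (y + (0 : ℝ) • EuclideanSpace.single i (1 : ℝ)) := by
        rw [zero_smul, add_zero]
        exact mem_of_superset (Metric.isOpen_ball.mem_nhds (by simpa using hlt))
          Metric.ball_subset_closedBall
      filter_upwards [hc.continuousAt.preimage_mem_nhds hn] with h hh
      have := hmax hh
      simpa using this
    refine not_isLocalMax_of_deriv_pos (g' := fun h => g' h + e * (2 * y i + 2 * h))
      (d := d i + 2 * e) ?_ ?_ hi hlocal
    · filter_upwards [hg] with h hh
      simp only [hV, hnorm]
      refine hh.add (HasDerivAt.const_mul e ?_)
      have h1 := (((hasDerivAt_id h).const_mul 2).mul_const (y i)).const_add (‖y‖ ^ 2)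
      have h2 := h1.add ((hasDerivAt_id h).pow 2)
      refine (h2.congr_deriv ?_)
      simp
    · refine hg'.add ?_
      have h1 := (((hasDerivAt_id (0 : ℝ)).const_mul 2).const_add (2 * y i)).const_mul e
      refine h1.congr_deriv ?_
      ring
  · have h1 := hbd y (by simpa using heq)
    simp only [hV, heq, he]
    rw [div_mul_cancel₀ _ (by positivity)]
    linarith

/-! ### Parametric integrals over a compact space -/

section Parametric

variable {S : Type*} [TopologicalSpace S] [CompactSpace S] [MeasurableSpace S] [BorelSpace S]
  {m : Measure S} [IsFiniteMeasure m]

theorem continuousOn_integral_of_isCompact {X : Type*} [TopologicalSpace X]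
    [FirstCountableTopology X] {F : X → S → ℝ} {K : Set X} (hK : IsCompact K)
    (hF : ContinuousOn (Function.uncurry F) (K ×ˢ Set.univ)) :
    ContinuousOn (fun x => ∫ s, F x s ∂m) K := by
  obtain ⟨C, hC⟩ := (hK.prod isCompact_univ).exists_bound_of_continuousOn hF
  have hFs : ∀ x ∈ K, Continuous (F x) := fun x hx =>
    hF.comp_continuous (by fun_prop : Continuous fun s : S => (x, s))
      (fun s => ⟨hx, Set.mem_univ s⟩)
  refine continuousOn_of_dominated (bound := fun _ => C) ?_ ?_ (integrable_const C) ?_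
  · intro x hx
    exact ((hFs x hx).measurable).aestronglyMeasurable
  · exact fun x hx => Eventually.of_forall fun s => hC (x, s) ⟨hx, Set.mem_univ s⟩
  · refine Eventually.of_forall fun s => ?_
    exact hF.comp (by fun_prop : Continuous fun x : X => (x, s)).continuousOn
      (fun x hx => ⟨hx, Set.mem_univ s⟩)

theorem hasDerivAt_integral_of_continuousOn {F F' : ℝ → S → ℝ} {δ : ℝ}
    (hF : ContinuousOn (Function.uncurry F) (Set.Icc (-δ) δ ×ˢ Set.univ))
    (hF' : ContinuousOn (Function.uncurry F') (Set.Icc (-δ) δ ×ˢ Set.univ))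
    (hder : ∀ h ∈ Set.Icc (-δ) δ, ∀ s, HasDerivAt (fun h => F h s) (F' h s) h)
    {h : ℝ} (hh : h ∈ Set.Ioo (-δ) δ) :
    HasDerivAt (fun h => ∫ s, F h s ∂m) (∫ s, F' h s ∂m) h := by
  obtain ⟨C, hC⟩ := (isCompact_Icc.prod isCompact_univ).exists_bound_of_continuousOn hF'
  obtain ⟨D, hD⟩ := (isCompact_Icc.prod isCompact_univ).exists_bound_of_continuousOn hF
  have hslice : ∀ {G : ℝ → S → ℝ}, ContinuousOn (Function.uncurry G) (Set.Icc (-δ) δ ×ˢ Set.univ) →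
      ∀ x ∈ Set.Icc (-δ) δ, Continuous (G x) := fun hG x hx =>
    hG.comp_continuous (by fun_prop : Continuous fun s : S => (x, s))
      (fun s => ⟨hx, Set.mem_univ s⟩)
  have hmem : Set.Icc (-δ) δ ∈ 𝓝 h := Icc_mem_nhds hh.1 hh.2
  refine (hasDerivAt_integral_of_dominated_loc_of_deriv_le (F := F) (F' := F')
    (bound := fun _ => C) hmem ?_ ?_ ?_ ?_ (integrable_const C) ?_).2
  · filter_upwards [hmem] with x hx
    exact ((hslice hF x hx).measurable).aestronglyMeasurable
  · exact (integrable_const D).mono'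
      ((hslice hF h (mem_of_mem_nhds hmem)).measurable).aestronglyMeasurable
      (Eventually.of_forall fun s => hD (h, s) ⟨mem_of_mem_nhds hmem, Set.mem_univ s⟩)
  · exact ((hslice hF' h (mem_of_mem_nhds hmem)).measurable).aestronglyMeasurable
  · exact Eventually.of_forall fun s x hx => hC (x, s) ⟨hx, Set.mem_univ s⟩
  · exact Eventually.of_forall fun s x hx => hder x hx s

end Parametric

/-! ### The Poisson kernel of the unit ball -/

/-- The Poisson kernel of the unit ball, not normalized. -/
def ballKernel {n : ℕ} (x η : EuclideanSpace ℝ (Fin n)) : ℝ := (1 - ‖x‖ ^ 2) / ‖x - η‖ ^ n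

/-- A quadratic polynomial times a power of another one; the restriction of the Poisson kernel to
a line has this form. -/
def quadPow (c a A B s h : ℝ) : ℝ := (c - 2 * a * h - h ^ 2) * (A + 2 * B * h + h ^ 2) ^ (-s)

/-- The derivative of `quadPow`. -/
def quadPowDeriv (c a A B s h : ℝ) : ℝ :=
  (-2 * a - 2 * h) * (A + 2 * B * h + h ^ 2) ^ (-s) +
    (c - 2 * a * h - h ^ 2) * (-s * (2 * B + 2 * h) * (A + 2 * B * h + h ^ 2) ^ (-s - 1))

/-- The second derivative of `quadPow`. -/
def quadPowDeriv₂ (c a A B s h : ℝ) : ℝ :=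
  -2 * (A + 2 * B * h + h ^ 2) ^ (-s) +
    2 * (-2 * a - 2 * h) * (-s * (2 * B + 2 * h) * (A + 2 * B * h + h ^ 2) ^ (-s - 1)) +
    (c - 2 * a * h - h ^ 2) * (-s * 2 * (A + 2 * B * h + h ^ 2) ^ (-s - 1) +
      -s * (-s - 1) * (2 * B + 2 * h) ^ 2 * (A + 2 * B * h + h ^ 2) ^ (-s - 1 - 1))

theorem hasDerivAt_quadPow {c a A B s h : ℝ} (hQ : 0 < A + 2 * B * h + h ^ 2) :
    HasDerivAt (quadPow c a A B s) (quadPowDeriv c a A B s h) h ∧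
      HasDerivAt (quadPowDeriv c a A B s) (quadPowDeriv₂ c a A B s h) h := by
  have hid := hasDerivAt_id' h
  have hN : HasDerivAt (fun h : ℝ => c - 2 * a * h - h ^ 2) (-2 * a - 2 * h) h := by
    have := ((hid.const_mul (2 * a)).const_sub c).sub (hid.fun_pow 2)
    refine this.congr_deriv ?_
    simp
  have hQd : HasDerivAt (fun h : ℝ => A + 2 * B * h + h ^ 2) (2 * B + 2 * h) h := by
    have := ((hid.const_mul (2 * B)).const_add A).add (hid.fun_pow 2)
    refine this.congr_deriv ?_
    simp
  have hN' : HasDerivAt (fun h : ℝ => -2 * a - 2 * h) (-2) h := by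
    have := (hid.const_mul 2).const_sub (-2 * a)
    refine this.congr_deriv ?_
    simp
  have hQ' : HasDerivAt (fun h : ℝ => 2 * B + 2 * h) 2 h := by
    have := (hid.const_mul 2).const_add (2 * B)
    refine this.congr_deriv ?_
    simp
  have hp1 := hQd.rpow_const (p := -s) (Or.inl hQ.ne')
  have hp2 := hQd.rpow_const (p := -s - 1) (Or.inl hQ.ne')
  constructor
  · refine (hN.mul hp1).congr_deriv ?_
    simp only [quadPowDeriv]
    ring
  · refine ((hN'.mul hp1).add (hN.mul ((hQ'.const_mul (-s)).mul hp2))).congr_deriv ?_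
    simp only [quadPowDeriv₂, Pi.mul_apply]
    ring

theorem continuous_slice {X S Z : Type*} [TopologicalSpace X] [TopologicalSpace S]
    [TopologicalSpace Z] {G : X → S → Z} {K : Set X}
    (hG : ContinuousOn (Function.uncurry G) (K ×ˢ Set.univ)) {x : X} (hx : x ∈ K) :
    Continuous (G x) :=
  hG.comp_continuous (by fun_prop : Continuous fun s : S => (x, s)) (fun s => ⟨hx, Set.mem_univ s⟩)

theorem continuousOn_quadPow {X : Type*} [TopologicalSpace X] {S : Set X} {A B h u : X → ℝ}
    (c a s : ℝ) (hA : Continuous A) (hB : Continuous B) (hh : Continuous h) (hu : Continuous u)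
    (hpos : ∀ z ∈ S, 0 < A z + 2 * B z * h z + h z ^ 2) :
    ContinuousOn (fun z => quadPow c a (A z) (B z) s (h z) * u z) S ∧
      ContinuousOn (fun z => quadPowDeriv c a (A z) (B z) s (h z) * u z) S ∧
      ContinuousOn (fun z => quadPowDeriv₂ c a (A z) (B z) s (h z) * u z) S := by
  have hp : ∀ r : ℝ, ContinuousOn (fun z => (A z + 2 * B z * h z + h z ^ 2) ^ r) S := fun r =>
    ContinuousOn.rpow_const (by fun_prop) fun z hz => Or.inl (hpos z hz).ne'
  have h1 := hp (-s)
  have h2 := hp (-s - 1)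
  have h3 := hp (-s - 1 - 1)
  refine ⟨?_, ?_, ?_⟩
  · unfold quadPow; fun_prop
  · unfold quadPowDeriv; fun_prop
  · unfold quadPowDeriv₂; fun_prop

theorem norm_line_sq {n : ℕ} (x : EuclideanSpace ℝ (Fin n)) (i : Fin n) (h : ℝ) :
    ‖x + h • EuclideanSpace.single i (1 : ℝ)‖ ^ 2 = ‖x‖ ^ 2 + 2 * x i * h + h ^ 2 := by
  rw [norm_add_sq_real, inner_smul_right, norm_smul]
  simp [EuclideanSpace.inner_single_right]
  ring

theorem ballKernel_line {n : ℕ} (x η : EuclideanSpace ℝ (Fin n)) (i : Fin n) (h : ℝ) :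
    ballKernel (x + h • EuclideanSpace.single i (1 : ℝ)) η =
      quadPow (1 - ‖x‖ ^ 2) (x i) (‖x - η‖ ^ 2) (x i - η i) ((n : ℝ) / 2) h := by
  have h1 : x + h • EuclideanSpace.single i (1 : ℝ) - η =
      (x - η) + h • EuclideanSpace.single i (1 : ℝ) := by abel
  have h2 : ‖x - η‖ ^ 2 + 2 * (x i - η i) * h + h ^ 2 =
      ‖x - η + h • EuclideanSpace.single i (1 : ℝ)‖ ^ 2 := by
    rw [norm_line_sq]; simp
  rw [ballKernel, quadPow, h1, h2, norm_line_sq, div_eq_mul_inv, Real.rpow_neg (by positivity),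
    ← Real.rpow_natCast_mul (norm_nonneg _)]
  congr 1
  · ring
  · congr 1
    rw [← Real.rpow_natCast]
    congr 1
    push_cast
    ring

/-- Harmonicity of the Poisson kernel. With A = |x - η|² and |η| = 1, Σ (x_i - η_i)² = A and 2 Σ x_i
(x_i - η_i) = |x|² + A - 1. Every term is then expressed by |x|², A and powers of A, and the sum
cancels because n = 2s. -/
theorem sum_quadPowDeriv₂ {n : ℕ} {x η : EuclideanSpace ℝ (Fin n)} (hη : ‖η‖ = 1)
    (hx : ‖x‖ < 1) :
    ∑ i, quadPowDeriv₂ (1 - ‖x‖ ^ 2) (x i) (‖x - η‖ ^ 2) (x i - η i) ((n : ℝ) / 2) 0 = 0 := by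
  have hA : 0 < ‖x - η‖ ^ 2 := by
    have : x - η ≠ 0 := by
      intro h
      rw [sub_eq_zero.1 h, hη] at hx
      exact lt_irrefl _ hx
    positivity
  set A := ‖x - η‖ ^ 2 with hAdef
  set s : ℝ := (n : ℝ) / 2 with hs
  have hB : ∑ i, (x i - η i) ^ 2 = A := by
    rw [hAdef, EuclideanSpace.real_norm_sq_eq]
    simp
  have hxB : 2 * ∑ i, x i * (x i - η i) = ‖x‖ ^ 2 + A - 1 := by
    have h1 : ‖x‖ ^ 2 = ∑ i, x i ^ 2 := EuclideanSpace.real_norm_sq_eq x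
    have h2 : (1 : ℝ) = ∑ i, η i ^ 2 := by rw [← EuclideanSpace.real_norm_sq_eq, hη]; norm_num
    rw [h1, ← hB, h2]
    rw [← Finset.sum_add_distrib, ← Finset.sum_sub_distrib, Finset.mul_sum]
    exact Finset.sum_congr rfl fun i _ => by ring
  have e1 : A ^ (-s) = A * A ^ (-s - 1) := by
    rw [Real.rpow_sub_one hA.ne']; field_simp
  have e2 : A ^ (-s - 1) = A * A ^ (-s - 1 - 1) := by
    rw [Real.rpow_sub_one hA.ne' (-s - 1)]; field_simp
  have e3 : ∀ i, quadPowDeriv₂ (1 - ‖x‖ ^ 2) (x i) A (x i - η i) s 0 =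
      (-2 * A ^ (-s) - (1 - ‖x‖ ^ 2) * s * 2 * A ^ (-s - 1)) +
        8 * s * A ^ (-s - 1) * (x i * (x i - η i)) +
        4 * (1 - ‖x‖ ^ 2) * s * (s + 1) * A ^ (-s - 1 - 1) * (x i - η i) ^ 2 := by
    intro i
    simp only [quadPowDeriv₂]
    ring_nf
  simp only [e3]
  rw [Finset.sum_add_distrib, Finset.sum_add_distrib, ← Finset.mul_sum, ← Finset.mul_sum, hB]
  simp only [Finset.sum_const, Finset.card_univ, Fintype.card_fin, nsmul_eq_mul]
  have hn : (n : ℝ) = 2 * s := by rw [hs]; ring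
  have hsum : ∑ i, x i * (x i - η i) = (‖x‖ ^ 2 + A - 1) / 2 := by linarith
  rw [hn, hsum, e1, e2]
  ring

theorem ballKernel_denom_pos {n : ℕ} {x η : EuclideanSpace ℝ (Fin n)} (hη : ‖η‖ = 1)
    (hx : ‖x‖ < 1) : 0 < ‖x - η‖ := by
  rw [norm_pos_iff, sub_ne_zero]
  rintro rfl
  exact hx.ne hη

theorem harmonicOnLines_ballKernel {n : ℕ} {x η : EuclideanSpace ℝ (Fin n)} (hη : ‖η‖ = 1)
    (hx : ‖x‖ < 1) : HarmonicOnLines (fun y => ballKernel y η) x := by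
  refine ⟨_, sum_quadPowDeriv₂ hη hx, fun i => ⟨quadPowDeriv (1 - ‖x‖ ^ 2) (x i) (‖x - η‖ ^ 2)
    (x i - η i) ((n : ℝ) / 2), ?_, ?_⟩⟩
  rotate_left
  · refine (hasDerivAt_quadPow ?_).2
    have := ballKernel_denom_pos hη hx
    simp only [mul_zero, add_zero, ne_eq, OfNat.ofNat_ne_zero, not_false_eq_true, zero_pow]
    positivity
  · have hc : Continuous fun h : ℝ => ‖x - η‖ ^ 2 + 2 * (x i - η i) * h + h ^ 2 := by fun_prop
    have h0 : 0 < ‖x - η‖ ^ 2 + 2 * (x i - η i) * 0 + 0 ^ 2 := by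
      have := ballKernel_denom_pos hη hx
      simp only [mul_zero, add_zero, ne_eq, OfNat.ofNat_ne_zero, not_false_eq_true, zero_pow]
      positivity
    filter_upwards [hc.continuousAt.eventually (lt_mem_nhds h0)] with h hh
    simp only [ballKernel_line]
    exact (hasDerivAt_quadPow hh).1

theorem continuousOn_ballKernel {n : ℕ} :
    ContinuousOn (fun z : EuclideanSpace ℝ (Fin n) × USphere n => ballKernel z.1 z.2)
      (Metric.ball 0 1 ×ˢ Set.univ) := by
  unfold ballKernel
  refine ContinuousOn.div (by fun_prop) (by fun_prop) ?_
  rintro ⟨x, η⟩ ⟨hx, -⟩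
  exact pow_ne_zero _ (ballKernel_denom_pos (mem_sphere_zero_iff_norm.1 η.2) (by simpa using hx)).ne'

theorem harmonicOnLines_integral_ballKernel {n : ℕ} {u : USphere n → ℝ} (hu : Continuous u)
    {x : EuclideanSpace ℝ (Fin n)} (hx : ‖x‖ < 1) :
    HarmonicOnLines (fun y => ∫ η, ballKernel y (η : EuclideanSpace ℝ (Fin n)) * u η ∂(surf n)) x := by
  -- Segments of half-length δ through x stay inside the open ball, so the base of the powers is
  -- positive on a compact set and one may differentiate under the integral.
  set δ : ℝ := (1 - ‖x‖) / 2 with hδ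
  have hδ0 : 0 < δ := by rw [hδ]; linarith
  have hQ : ∀ (i : Fin n), ∀ h ∈ Set.Icc (-δ) δ, ∀ η : USphere n,
      0 < ‖x - η‖ ^ 2 + 2 * (x i - (η : EuclideanSpace ℝ (Fin n)) i) * h + h ^ 2 := by
    intro i h hh η
    have h2 : ‖x - η‖ ^ 2 + 2 * (x i - (η : EuclideanSpace ℝ (Fin n)) i) * h + h ^ 2 =
        ‖x + h • EuclideanSpace.single i (1 : ℝ) - η‖ ^ 2 := by
      have := norm_line_sq (x - (η : EuclideanSpace ℝ (Fin n))) i h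
      rw [show x + h • EuclideanSpace.single i (1 : ℝ) - (η : EuclideanSpace ℝ (Fin n)) =
        (x - η) + h • EuclideanSpace.single i (1 : ℝ) by abel, this]
      simp
    rw [h2]
    have h3 : ‖x + h • EuclideanSpace.single i (1 : ℝ)‖ < 1 := by
      refine (norm_add_le _ _).trans_lt ?_
      rw [norm_smul, PiLp.norm_single, norm_one, mul_one, Real.norm_eq_abs]
      have := abs_le.2 hh
      linarith
    have := ballKernel_denom_pos (mem_sphere_zero_iff_norm.1 η.2) h3
    positivity
  set F0 : Fin n → ℝ → USphere n → ℝ := fun i h η =>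
    quadPow (1 - ‖x‖ ^ 2) (x i) (‖x - η‖ ^ 2) (x i - (η : EuclideanSpace ℝ (Fin n)) i)
      ((n : ℝ) / 2) h * u η with hF0
  set F1 : Fin n → ℝ → USphere n → ℝ := fun i h η =>
    quadPowDeriv (1 - ‖x‖ ^ 2) (x i) (‖x - η‖ ^ 2) (x i - (η : EuclideanSpace ℝ (Fin n)) i)
      ((n : ℝ) / 2) h * u η with hF1
  set F2 : Fin n → ℝ → USphere n → ℝ := fun i h η =>
    quadPowDeriv₂ (1 - ‖x‖ ^ 2) (x i) (‖x - η‖ ^ 2) (x i - (η : EuclideanSpace ℝ (Fin n)) i)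
      ((n : ℝ) / 2) h * u η with hF2
  have hcA : Continuous fun z : ℝ × USphere n => ‖x - z.2‖ ^ 2 := by fun_prop
  have hcB : ∀ i, Continuous fun z : ℝ × USphere n =>
      x i - (z.2 : EuclideanSpace ℝ (Fin n)) i := fun i => by fun_prop
  have hcu : Continuous fun z : ℝ × USphere n => u z.2 := by fun_prop
  have hc := fun i => continuousOn_quadPow (S := Set.Icc (-δ) δ ×ˢ (Set.univ : Set (USphere n)))
    (1 - ‖x‖ ^ 2) (x i) ((n : ℝ) / 2) hcA (hcB i) continuous_fst hcu
    (fun z hz => hQ i z.1 hz.1 z.2)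
  have hc0 : ∀ i, ContinuousOn (Function.uncurry (F0 i)) (Set.Icc (-δ) δ ×ˢ Set.univ) :=
    fun i => (hc i).1
  have hc1 : ∀ i, ContinuousOn (Function.uncurry (F1 i)) (Set.Icc (-δ) δ ×ˢ Set.univ) :=
    fun i => (hc i).2.1
  have hc2 : ∀ i, ContinuousOn (Function.uncurry (F2 i)) (Set.Icc (-δ) δ ×ˢ Set.univ) :=
    fun i => (hc i).2.2
  have h0mem : (0 : ℝ) ∈ Set.Ioo (-δ) δ := ⟨by linarith, hδ0⟩
  refine ⟨fun i => ∫ η, F2 i 0 η ∂(surf n), ?_, fun i =>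
    ⟨fun h => ∫ η, F1 i h η ∂(surf n), ?_, ?_⟩⟩
  · have hint : ∀ i, Integrable (F2 i 0) (surf n) := by
      intro i
      have hcont : Continuous (F2 i 0) := continuous_slice (hc2 i) (Set.Ioo_subset_Icc_self h0mem)
      exact hcont.integrable_of_hasCompactSupport (HasCompactSupport.of_compactSpace _)
    rw [← integral_finsetSum _ fun i _ => hint i]
    have : ∀ η : USphere n, ∑ i, F2 i 0 η = 0 := by
      intro η
      simp only [hF2]
      rw [← Finset.sum_mul, sum_quadPowDeriv₂ (mem_sphere_zero_iff_norm.1 η.2) hx, zero_mul]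
    simp [this]
  · filter_upwards [Ioo_mem_nhds h0mem.1 h0mem.2] with h hh
    simp only [ballKernel_line]
    exact hasDerivAt_integral_of_continuousOn (hc0 i) (hc1 i)
      (fun h hh η => (hasDerivAt_quadPow (hQ i h hh η)).1.mul_const _) hh
  · exact hasDerivAt_integral_of_continuousOn (hc1 i) (hc2 i)
      (fun h hh η => (hasDerivAt_quadPow (hQ i h hh η)).2.mul_const _) h0mem

/-! ### Invariance and total mass of the surface measure -/

/-- The action of a linear isometry on the unit sphere. -/
def sphereMap {n : ℕ} (A : EuclideanSpace ℝ (Fin n) ≃ₗᵢ[ℝ] EuclideanSpace ℝ (Fin n))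
    (η : USphere n) : USphere n :=
  ⟨A η, by rw [mem_sphere_zero_iff_norm, A.norm_map]; exact mem_sphere_zero_iff_norm.1 η.2⟩

theorem continuous_sphereMap {n : ℕ}
    (A : EuclideanSpace ℝ (Fin n) ≃ₗᵢ[ℝ] EuclideanSpace ℝ (Fin n)) :
    Continuous (sphereMap A) :=
  (A.continuous.comp continuous_subtype_val).subtype_mk _

-- The surface measure of a set is n times the volume of the cone over it, and a linear isometry
-- maps cones to cones and preserves volume.
open scoped Pointwise in
theorem measurePreserving_sphereMap {n : ℕ}
    (A : EuclideanSpace ℝ (Fin n) ≃ₗᵢ[ℝ] EuclideanSpace ℝ (Fin n)) :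
    MeasurePreserving (sphereMap A) (surf n) (surf n) := by
  have hm := (continuous_sphereMap A).measurable
  refine ⟨hm, Measure.ext fun s hs => ?_⟩
  rw [Measure.map_apply hm hs, Measure.toSphere_apply' _ (hm hs), Measure.toSphere_apply' _ hs]
  congr 1
  have hpre : Set.Ioo (0 : ℝ) 1 • ((↑) '' (sphereMap A ⁻¹' s) : Set (EuclideanSpace ℝ (Fin n))) =
      A ⁻¹' (Set.Ioo (0 : ℝ) 1 • ((↑) '' s)) := by
    ext x
    simp only [Set.mem_smul, Set.mem_image, Set.mem_preimage]
    constructor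
    · rintro ⟨r, hr, _, ⟨η, hη, rfl⟩, rfl⟩
      exact ⟨r, hr, _, ⟨sphereMap A η, hη, rfl⟩, by simp [sphereMap]⟩
    · rintro ⟨r, hr, _, ⟨ζ, hζ, rfl⟩, h⟩
      refine ⟨r, hr, A.symm ζ, ⟨sphereMap A.symm ζ, ?_, rfl⟩, ?_⟩
      · have : sphereMap A (sphereMap A.symm ζ) = ζ := Subtype.ext (by simp [sphereMap])
        simpa [this] using hζ
      · apply A.injective
        rw [← h]
        simp
  rw [hpre]
  exact (A.measurePreserving).measure_preimage_equiv (f := A.toHomeomorph.toMeasurableEquiv) _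

theorem sphereArea_pos {n : ℕ} (hn : 0 < n) : 0 < sphereArea n := by
  unfold sphereArea
  have : 0 < Real.Gamma ((n : ℝ) / 2) := Real.Gamma_pos_of_pos (by positivity)
  positivity

theorem surf_univ {n : ℕ} (hn : 0 < n) : (surf n) Set.univ = ENNReal.ofReal (sphereArea n) := by
  have : Nonempty (Fin n) := ⟨⟨0, hn⟩⟩
  have hn' : (0 : ℝ) < n := by exact_mod_cast hn
  rw [surf, Measure.toSphere_apply_univ, EuclideanSpace.volume_ball]
  simp only [finrank_euclideanSpace, Fintype.card_fin, ENNReal.ofReal_one, one_pow, one_mul]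
  rw [← ENNReal.ofReal_natCast, ← ENNReal.ofReal_mul hn'.le]
  congr 1
  have hΓ : 0 < Real.Gamma ((n : ℝ) / 2) := Real.Gamma_pos_of_pos (by positivity)
  rw [sphereArea, Real.Gamma_add_one (by positivity), Real.sqrt_eq_rpow, ← Real.rpow_mul_natCast
    Real.pi_pos.le]
  have : (1 : ℝ) / 2 * n = n / 2 := by ring
  rw [this]
  field_simp

theorem surf_real_univ {n : ℕ} (hn : 0 < n) : (surf n).real Set.univ = sphereArea n := by
  rw [measureReal_def, surf_univ hn, ENNReal.toReal_ofReal (sphereArea_pos hn).le]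

/-! ### Total mass and boundary behaviour of the Poisson kernel -/

theorem ballKernel_nonneg {n : ℕ} {x η : EuclideanSpace ℝ (Fin n)} (hx : ‖x‖ ≤ 1) :
    0 ≤ ballKernel x η := by
  unfold ballKernel
  have : ‖x‖ ^ 2 ≤ 1 := pow_le_one₀ (norm_nonneg _) hx
  exact div_nonneg (by linarith) (by positivity)

theorem continuous_ballKernel_right {n : ℕ} {x : EuclideanSpace ℝ (Fin n)} (hx : ‖x‖ < 1) :
    Continuous fun η : USphere n => ballKernel x (η : EuclideanSpace ℝ (Fin n)) :=
  continuous_slice (G := fun x (η : USphere n) => ballKernel x (η : EuclideanSpace ℝ (Fin n)))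
    continuousOn_ballKernel (by simpa using hx : x ∈ Metric.ball 0 1)

theorem integrable_of_continuous {n : ℕ} {u : USphere n → ℝ} (hu : Continuous u) :
    Integrable u (surf n) :=
  hu.integrable_of_hasCompactSupport (HasCompactSupport.of_compactSpace _)

theorem continuousOn_integral_ballKernel {n : ℕ} {u : USphere n → ℝ} (hu : Continuous u) {R : ℝ}
    (hR : R < 1) :
    ContinuousOn (fun x => ∫ η, ballKernel x (η : EuclideanSpace ℝ (Fin n)) * u η ∂(surf n))
      (Metric.closedBall 0 R) := by
  refine continuousOn_integral_of_isCompact (isCompact_closedBall _ _) ?_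
  have h1 : ContinuousOn (fun z : EuclideanSpace ℝ (Fin n) × USphere n => ballKernel z.1 z.2)
      (Metric.closedBall 0 R ×ˢ Set.univ) :=
    continuousOn_ballKernel.mono (Set.prod_mono (Metric.closedBall_subset_ball hR) le_rfl)
  exact h1.mul (hu.comp continuous_snd).continuousOn

theorem integral_ballKernel_map {n : ℕ}
    (A : EuclideanSpace ℝ (Fin n) ≃ₗᵢ[ℝ] EuclideanSpace ℝ (Fin n)) (x : EuclideanSpace ℝ (Fin n)) :
    ∫ η, ballKernel (A x) (η : EuclideanSpace ℝ (Fin n)) ∂(surf n) =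
      ∫ η, ballKernel x (η : EuclideanSpace ℝ (Fin n)) ∂(surf n) := by
  have hm := measurePreserving_sphereMap A
  have hmeas : Measurable fun η : USphere n => ballKernel (A x) (η : EuclideanSpace ℝ (Fin n)) := by
    unfold ballKernel
    fun_prop
  rw [← hm.map_eq, integral_map hm.measurable.aemeasurable hmeas.aestronglyMeasurable, hm.map_eq]
  congr 1
  funext η
  simp only [ballKernel, sphereMap]
  rw [A.norm_map, ← map_sub, A.norm_map]

/-- The total mass is harmonic in x and depends on |x| only. It is therefore constant on each
sphere, hence inside it by the maximum principle for it and its negative; at the centre the kernel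
is identically 1. -/
theorem integral_ballKernel {n : ℕ} (hn : 0 < n) {x : EuclideanSpace ℝ (Fin n)} (hx : ‖x‖ < 1) :
    ∫ η, ballKernel x (η : EuclideanSpace ℝ (Fin n)) ∂(surf n) = sphereArea n := by
  set w : EuclideanSpace ℝ (Fin n) → ℝ :=
    fun x => ∫ η, ballKernel x (η : EuclideanSpace ℝ (Fin n)) ∂(surf n) with hw
  have hharm : ∀ x : EuclideanSpace ℝ (Fin n), ‖x‖ < 1 → HarmonicOnLines w x := fun x hx => by
    simpa using harmonicOnLines_integral_ballKernel (u := fun _ => (1 : ℝ)) continuous_const hx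
  have hcont : ∀ R : ℝ, R < 1 → ContinuousOn w (Metric.closedBall 0 R) := fun R hR => by
    simpa using continuousOn_integral_ballKernel (u := fun _ : USphere n => (1 : ℝ))
      continuous_const hR
  have hrot : ∀ x y : EuclideanSpace ℝ (Fin n), ‖x‖ = ‖y‖ → w x = w y := by
    intro x y h
    -- If |x| = |y|, reflection in the hyperplane orthogonal to x - y carries x to y.
    have := integral_ballKernel_map ((ℝ ∙ (x - y))ᗮ.reflection) x
    rw [Submodule.reflection_sub h] at this
    exact this.symm
  have h0 : w 0 = sphereArea n := by
    have : ∀ η : USphere n, ballKernel (0 : EuclideanSpace ℝ (Fin n)) η = 1 := fun η => by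
      simp [ballKernel]
    simp only [hw, this, integral_const, smul_eq_mul, mul_one]
    exact surf_real_univ hn
  obtain ⟨R, hxR, hR1⟩ := exists_between hx
  have hR0 : 0 < R := (norm_nonneg x).trans_lt hxR
  set z : EuclideanSpace ℝ (Fin n) := EuclideanSpace.single ⟨0, hn⟩ R with hz
  have hzn : ‖z‖ = R := by rw [hz, PiLp.norm_single, Real.norm_of_nonneg hR0.le]
  have heq : ∀ y ∈ Metric.ball (0 : EuclideanSpace ℝ (Fin n)) R, w y = w z := by
    intro y hy
    refine le_antisymm ?_ ?_
    · refine HarmonicOnLines.le_of_le_sphere hn (hcont R hR1) (fun x hx => hharm x ?_) ?_ hy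
      · have : ‖x‖ < R := by simpa using hx
        exact this.trans hR1
      · intro x hx
        exact (hrot x z (by rw [hzn]; simpa using hx)).le
    · have := HarmonicOnLines.le_of_le_sphere hn (hcont R hR1).neg (c := -w z)
        (fun x hx => (hharm x ?_).neg) ?_ hy
      · exact neg_le_neg_iff.1 this
      · have : ‖x‖ < R := by simpa using hx
        exact this.trans hR1
      · intro x hx
        exact neg_le_neg (hrot x z (by rw [hzn]; simpa using hx)).ge
  rw [← h0, heq 0 (by simpa using hR0)]
  exact heq x (by simpa using hxR)

/-- As x approaches ξ the numerator 1 - |x|² tends to 0, while |x - η| stays above δ/2 for η outside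
the δ-neighbourhood of ξ. -/
theorem eventually_ballKernel_le {n : ℕ} (ξ : USphere n) {δ ε : ℝ} (hδ : 0 < δ) (hε : 0 < ε) :
    ∀ᶠ x in 𝓝[Metric.ball 0 1] (ξ : EuclideanSpace ℝ (Fin n)), ∀ η : USphere n,
      δ ≤ dist η ξ → ballKernel x (η : EuclideanSpace ℝ (Fin n)) ≤ ε := by
  have h1 : ∀ᶠ x in 𝓝 (ξ : EuclideanSpace ℝ (Fin n)), 1 - ‖x‖ ^ 2 < ε * (δ / 2) ^ n := by
    have hc : Continuous fun x : EuclideanSpace ℝ (Fin n) => 1 - ‖x‖ ^ 2 := by fun_prop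
    refine hc.continuousAt.eventually_lt_const ?_
    simp only [mem_sphere_zero_iff_norm.1 ξ.2]
    have : 0 < ε * (δ / 2) ^ n := by positivity
    simpa using this
  have h2 : ∀ᶠ x in 𝓝 (ξ : EuclideanSpace ℝ (Fin n)),
      dist x (ξ : EuclideanSpace ℝ (Fin n)) < δ / 2 :=
    Metric.ball_mem_nhds _ (by positivity)
  filter_upwards [nhdsWithin_le_nhds h1, nhdsWithin_le_nhds h2] with x h3 h4 η h5
  have h6 : δ / 2 ≤ ‖x - η‖ := by
    rw [← dist_eq_norm]
    have h7 := dist_triangle (η : EuclideanSpace ℝ (Fin n)) x (ξ : EuclideanSpace ℝ (Fin n))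
    rw [Subtype.dist_eq] at h5
    rw [dist_comm x]
    linarith
  unfold ballKernel
  have h8 : 0 < ‖x - η‖ := lt_of_lt_of_le (by positivity) h6
  rw [div_le_iff₀ (by positivity)]
  refine h3.le.trans ?_
  gcongr

/-- The kernel is nonnegative, of constant mass, and concentrates at ξ: near ξ use continuity of u,
away from ξ the uniform bound κ on the kernel. The constants make each part contribute ε/4. -/
theorem tendsto_integral_ballKernel {n : ℕ} (hn : 0 < n) {u : USphere n → ℝ} (hu : Continuous u)
    (ξ : USphere n) :
    Tendsto (fun x => ∫ η, ballKernel x (η : EuclideanSpace ℝ (Fin n)) * u η ∂(surf n))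
      (𝓝[Metric.ball 0 1] (ξ : EuclideanSpace ℝ (Fin n))) (𝓝 (sphereArea n * u ξ)) := by
  have hσ := sphereArea_pos hn
  rw [Metric.tendsto_nhds]
  intro ε hε
  obtain ⟨δ, hδ, hδu⟩ := Metric.continuous_iff.1 hu ξ (ε / (4 * sphereArea n)) (by positivity)
  obtain ⟨M, hM⟩ := isCompact_univ.exists_bound_of_continuousOn hu.continuousOn
  have hM0 : 0 ≤ M := (norm_nonneg _).trans (hM ξ (Set.mem_univ _))
  set κ : ℝ := ε / (4 * (2 * M + 1) * sphereArea n) with hκ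
  filter_upwards [eventually_ballKernel_le ξ hδ (show 0 < κ by positivity), self_mem_nhdsWithin]
    with x hx hxb
  have hx1 : ‖x‖ < 1 := by simpa using hxb
  have hPc := continuous_ballKernel_right hx1
  have hP0 : ∀ η : USphere n, 0 ≤ ballKernel x (η : EuclideanSpace ℝ (Fin n)) := fun η =>
    ballKernel_nonneg hx1.le
  have hdiff : ∫ η, ballKernel x (η : EuclideanSpace ℝ (Fin n)) * u η ∂(surf n) -
      sphereArea n * u ξ =
      ∫ η, ballKernel x (η : EuclideanSpace ℝ (Fin n)) * (u η - u ξ) ∂(surf n) := by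
    rw [← integral_ballKernel hn hx1, ← integral_mul_const, ← integral_sub]
    · simp only [mul_sub]
    · exact integrable_of_continuous (hPc.mul hu)
    · exact integrable_of_continuous (hPc.mul continuous_const)
  rw [Real.dist_eq, hdiff, ← Real.norm_eq_abs]
  have hpt : ∀ η : USphere n, ‖ballKernel x (η : EuclideanSpace ℝ (Fin n)) * (u η - u ξ)‖ ≤
      ballKernel x (η : EuclideanSpace ℝ (Fin n)) * (ε / (4 * sphereArea n)) +
        κ * (2 * M + 1) := by
    intro η
    rw [norm_mul, Real.norm_of_nonneg (hP0 η)]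
    rcases lt_or_ge (dist η ξ) δ with h | h
    · have h1 : ‖u η - u ξ‖ ≤ ε / (4 * sphereArea n) := (hδu η h).le
      have h2 : 0 ≤ κ * (2 * M + 1) := by positivity
      have := mul_le_mul_of_nonneg_left h1 (hP0 η)
      linarith
    · have h1 : ‖u η - u ξ‖ ≤ 2 * M + 1 := by
        have := norm_sub_le (u η) (u ξ)
        linarith [hM η (Set.mem_univ _), hM ξ (Set.mem_univ _)]
      have h2 : 0 ≤ ballKernel x (η : EuclideanSpace ℝ (Fin n)) * (ε / (4 * sphereArea n)) :=
        mul_nonneg (hP0 η) (by positivity)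
      have := mul_le_mul (hx η h) h1 (norm_nonneg _) (by positivity)
      linarith
  refine (norm_integral_le_of_norm_le (integrable_of_continuous (by fun_prop))
    (Eventually.of_forall hpt)).trans_lt ?_
  rw [integral_add (integrable_of_continuous (by fun_prop)) (integrable_const _),
    integral_mul_const, integral_ballKernel hn hx1, integral_const, surf_real_univ hn, smul_eq_mul]
  have e1 : sphereArea n * (ε / (4 * sphereArea n)) = ε / 4 := by field_simp
  have e2 : sphereArea n * (κ * (2 * M + 1)) = ε / 4 := by rw [hκ]; field_simp
  rw [e1, e2]
  linarith

/-- The Poisson integral formula for dilates of the Poisson kernel itself. -/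
theorem integral_ballKernel_mul_ballKernel {n : ℕ} (hn : 0 < n) {r : ℝ} (hr0 : 0 ≤ r) (hr : r < 1)
    (ζ : USphere n) {x : EuclideanSpace ℝ (Fin n)} (hx : ‖x‖ < 1) :
    ∫ η, ballKernel x (η : EuclideanSpace ℝ (Fin n)) *
      ballKernel (r • (η : EuclideanSpace ℝ (Fin n))) (ζ : EuclideanSpace ℝ (Fin n)) ∂(surf n) =
      sphereArea n * ballKernel (r • x) (ζ : EuclideanSpace ℝ (Fin n)) := by
  have hσ := sphereArea_pos hn
  set U : EuclideanSpace ℝ (Fin n) → ℝ :=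
    fun y => sphereArea n * ballKernel (r • y) (ζ : EuclideanSpace ℝ (Fin n)) with hU
  set u : USphere n → ℝ := fun η =>
    ballKernel (r • (η : EuclideanSpace ℝ (Fin n))) (ζ : EuclideanSpace ℝ (Fin n)) with hu
  set w : EuclideanSpace ℝ (Fin n) → ℝ :=
    fun x => ∫ η, ballKernel x (η : EuclideanSpace ℝ (Fin n)) * u η ∂(surf n) with hw
  have hζ : ‖(ζ : EuclideanSpace ℝ (Fin n))‖ = 1 := mem_sphere_zero_iff_norm.1 ζ.2
  have hrx : ∀ y : EuclideanSpace ℝ (Fin n), ‖y‖ ≤ 1 → ‖r • y‖ < 1 := by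
    intro y hy
    rw [norm_smul, Real.norm_of_nonneg hr0]
    exact (mul_le_of_le_one_right hr0 hy).trans_lt hr
  have hUc : ContinuousOn U (Metric.closedBall 0 1) := by
    refine continuousOn_const.mul ?_
    unfold ballKernel
    refine ContinuousOn.div (by fun_prop) (by fun_prop) fun y hy => ?_
    exact pow_ne_zero _ (ballKernel_denom_pos hζ (hrx y (by simpa using hy))).ne'
  have huc : Continuous u := by
    rw [hu]
    unfold ballKernel
    refine Continuous.div (by fun_prop) (by fun_prop) fun η => ?_
    exact pow_ne_zero _
      (ballKernel_denom_pos hζ (hrx η (mem_sphere_zero_iff_norm.1 η.2).le)).ne'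
  have hUharm : ∀ y : EuclideanSpace ℝ (Fin n), ‖y‖ < 1 → HarmonicOnLines U y := by
    intro y hy
    have h1 := (harmonicOnLines_ballKernel hζ (hrx y hy.le)).comp_smul r
    obtain ⟨d, hd, h⟩ := h1
    refine ⟨fun i => sphereArea n * d i, by rw [← Finset.mul_sum, hd, mul_zero], fun i => ?_⟩
    obtain ⟨g, hg, hg'⟩ := h i
    exact ⟨fun z => sphereArea n * g z, hg.mono fun z hz => hz.const_mul _, hg'.const_mul _⟩
  have hwharm : ∀ y : EuclideanSpace ℝ (Fin n), ‖y‖ < 1 → HarmonicOnLines w y := fun y hy =>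
    harmonicOnLines_integral_ballKernel huc hy
  -- Uniqueness for the Dirichlet problem: both sides are harmonic in x with the same boundary
  -- values. The Poisson integral `w` is used in the open ball only, so the difference is extended
  -- by 0, and `hvcont` shows that the extension is continuous on the closed ball.
  set v : EuclideanSpace ℝ (Fin n) → ℝ :=
    fun y => if ‖y‖ < 1 then w y - U y else 0 with hv
  have hveq : ∀ y : EuclideanSpace ℝ (Fin n), ‖y‖ < 1 → v =ᶠ[𝓝 y] fun y => w y - U y := by
    intro y hy
    have : ∀ᶠ z in 𝓝 y, ‖z‖ < 1 := continuous_norm.continuousAt.eventually_lt_const hy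
    filter_upwards [this] with z hz
    simp only [hv, if_pos hz]
  have hvharm : ∀ y : EuclideanSpace ℝ (Fin n), ‖y‖ < 1 → HarmonicOnLines v y := by
    intro y hy
    obtain ⟨d, hd, h⟩ := (hwharm y hy).sub (hUharm y hy)
    refine ⟨d, hd, fun i => ?_⟩
    obtain ⟨g, hg, hg'⟩ := h i
    refine ⟨g, ?_, hg'⟩
    have hc : Continuous fun h : ℝ => y + h • EuclideanSpace.single i (1 : ℝ) := by fun_prop
    have hc0 : Tendsto (fun h : ℝ => y + h • EuclideanSpace.single i (1 : ℝ)) (𝓝 0) (𝓝 y) := by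
      simpa using hc.tendsto 0
    filter_upwards [hg, (hc0.eventually (hveq y hy)).eventually_nhds] with z h1 h2
    exact h1.congr_of_eventuallyEq h2
  have hvcont : ContinuousOn v (Metric.closedBall 0 1) := by
    intro y hy
    have hy1 : ‖y‖ ≤ 1 := by simpa using hy
    rcases hy1.lt_or_eq with hlt | heq
    · obtain ⟨R, hyR, hR1⟩ := exists_between hlt
      have hnb : Metric.closedBall (0 : EuclideanSpace ℝ (Fin n)) R ∈ 𝓝 y :=
        mem_of_superset (Metric.isOpen_ball.mem_nhds (by simpa using hyR))
          Metric.ball_subset_closedBall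
      have h1 : ContinuousAt w y := (continuousOn_integral_ballKernel huc hR1).continuousAt hnb
      have h2 : ContinuousAt U y := hUc.continuousAt
        (mem_of_superset hnb (Metric.closedBall_subset_closedBall hR1.le))
      exact ((h1.sub h2).congr (hveq y hlt).symm).continuousWithinAt
    · have hvy : v y = 0 := by simp only [hv, if_neg (show ¬ ‖y‖ < 1 by linarith)]
      have hlim : Tendsto (fun z => w z - U z) (𝓝[Metric.ball 0 1] y) (𝓝 0) := by
        have h1 := tendsto_integral_ballKernel hn huc ⟨y, by simpa using heq⟩
        have h2 : Tendsto U (𝓝[Metric.ball 0 1] y) (𝓝 (U y)) :=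
          (hUc y hy).mono_left (nhdsWithin_mono _ Metric.ball_subset_closedBall)
        have h3 := h1.sub h2
        simpa [hU, hu] using h3
      rw [ContinuousWithinAt, hvy, Metric.tendsto_nhds]
      intro ε hε
      have h4 := Metric.tendsto_nhds.1 hlim ε hε
      rw [eventually_nhdsWithin_iff] at h4
      filter_upwards [nhdsWithin_le_nhds h4] with z hz
      by_cases hz1 : ‖z‖ < 1
      · have := hz (by simpa using hz1)
        simpa only [hv, if_pos hz1] using this
      · simp only [hv, if_neg hz1, dist_self, hε]
  have hzero : v x = 0 := by
    have hxb : x ∈ Metric.ball (0 : EuclideanSpace ℝ (Fin n)) 1 := by simpa using hx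
    have hbd : ∀ y ∈ Metric.sphere (0 : EuclideanSpace ℝ (Fin n)) 1, v y = 0 := by
      intro y hy
      have : ‖y‖ = 1 := by simpa using hy
      simp [hv, this]
    refine le_antisymm ?_ ?_
    · exact HarmonicOnLines.le_of_le_sphere hn hvcont (fun y hy => hvharm y (by simpa using hy))
        (fun y hy => (hbd y hy).le) hxb
    · have := HarmonicOnLines.le_of_le_sphere hn hvcont.neg (c := 0)
        (fun y hy => (hvharm y (by simpa using hy)).neg)
        (fun y hy => by simp [hbd y hy]) hxb
      simpa using this
  have : w x - U x = 0 := by simpa only [hv, if_pos hx] using hzero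
  exact sub_eq_zero.1 this

/-! ### Hopf's maximal inequality -/

section Hopf

variable {X : Type*} [MeasurableSpace X]

/-- The partial sums `f + T f + ⋯ + T^{k-1} f`. -/
def orbitSum (T : (X → ℝ≥0∞) → X → ℝ≥0∞) (f : X → ℝ≥0∞) : ℕ → X → ℝ≥0∞
  | 0 => 0
  | k + 1 => fun x => f x + T (orbitSum T f k) x

variable {T : (X → ℝ≥0∞) → X → ℝ≥0∞} {f : X → ℝ≥0∞}

theorem measurable_orbitSum (hm : ∀ g, Measurable g → Measurable (T g)) (hf : Measurable f)
    (k : ℕ) : Measurable (orbitSum T f k) := by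
  induction k with
  | zero => exact measurable_const
  | succ k ih => exact hf.add (hm _ ih)

theorem lintegral_orbitSum_le {ν : Measure X} (hm : ∀ g, Measurable g → Measurable (T g))
    (hint : ∀ g, Measurable g → ∫⁻ x, T g x ∂ν ≤ ∫⁻ x, g x ∂ν) (hf : Measurable f) (k : ℕ) :
    ∫⁻ x, orbitSum T f k x ∂ν ≤ k * ∫⁻ x, f x ∂ν := by
  induction k with
  | zero => simp [orbitSum]
  | succ k ih =>
    simp only [orbitSum]
    rw [lintegral_add_left hf]
    push_cast
    rw [add_mul, one_mul, add_comm]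
    gcongr
    exact (hint _ (measurable_orbitSum hm hf k)).trans ih

/-- **Hopf's maximal inequality** for a positive contraction of `L¹` and `L^∞`. -/
theorem hopf_maximal_inequality {ν : Measure X} (hm : ∀ g, Measurable g → Measurable (T g))
    (hmono : ∀ g h, g ≤ h → T g ≤ T h)
    (hadd : ∀ (g : X → ℝ≥0∞) (c : ℝ≥0∞), Measurable g → ∀ x, T (fun y => g y + c) x ≤ T g x + c)
    (hint : ∀ g, Measurable g → ∫⁻ x, T g x ∂ν ≤ ∫⁻ x, g x ∂ν)
    (hf : Measurable f) (hfi : ∫⁻ x, f x ∂ν ≠ ∞) {c : ℝ≥0∞} (hc : c ≠ ∞) (N : ℕ) :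
    c * ν {x | ∃ k ≤ N, k * c < orbitSum T f k x} ≤ ∫⁻ x, f x ∂ν := by
  -- Subtraction in `ℝ≥0∞` is truncated, so M is the maximum of the positive parts of S_k - kc for k
  -- ≤ N.
  set M : X → ℝ≥0∞ := fun x =>
    (Finset.range (N + 1)).sup fun k => orbitSum T f k x - k * c with hM
  set E : Set X := {x | ∃ k ≤ N, k * c < orbitSum T f k x} with hE
  have hSm := measurable_orbitSum hm hf
  have hMm : Measurable M := by
    have h1 := Finset.measurable_range_sup'' (n := N) (f := fun k x => orbitSum T f k x - k * c)
      fun k _ => (hSm k).sub_const _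
    have h2 : M = fun x => (Finset.range (N + 1)).sup' Finset.nonempty_range_add_one
        fun k => orbitSum T f k x - k * c := funext fun x => (Finset.sup'_eq_sup _ _).symm
    rw [h2]
    exact h1
  have hEm : MeasurableSet E := by
    have : E = ⋃ k ∈ Finset.range (N + 1), {x | k * c < orbitSum T f k x} := by
      ext x
      simp [hE]
    rw [this]
    exact Finset.measurableSet_biUnion _ fun k _ => measurableSet_lt measurable_const (hSm k)
  have hkc : ∀ k : ℕ, (k : ℝ≥0∞) * c ≠ ∞ := fun k => ENNReal.mul_ne_top (by simp) hc
  have hMle : ∀ k ≤ N, ∀ x, orbitSum T f k x - k * c ≤ M x := fun k hk x =>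
    Finset.le_sup (f := fun k => orbitSum T f k x - k * c)
      (Finset.mem_range.2 (Nat.lt_succ_of_le hk))
  have hMzero : ∀ x, x ∉ E → M x = 0 := by
    intro x hx
    refine le_antisymm (Finset.sup_le fun k hk => ?_) zero_le
    rw [nonpos_iff_eq_zero, tsub_eq_zero_iff_le]
    by_contra hcon
    exact hx ⟨k, Nat.lt_succ_iff.1 (Finset.mem_range.1 hk), not_le.1 hcon⟩
  -- On E the maximum is attained at some k + 1 ≥ 1. There M + c = S_{k+1} - kc = f + T S_k - kc,
  -- and S_k ≤ M + kc gives T S_k ≤ T M + kc. Only monotonicity of T and subadditivity for constants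
  -- are used.
  have hkey : ∀ x ∈ E, M x + c ≤ f x + T M x := by
    rintro x ⟨k₀, hk₀, hlt⟩
    have hpos : 0 < M x := (tsub_pos_of_lt hlt).trans_le (hMle k₀ hk₀ x)
    obtain ⟨k, hk, hkM⟩ := Finset.exists_mem_eq_sup (Finset.range (N + 1)) ⟨0, by simp⟩
      (fun k => orbitSum T f k x - k * c)
    have hMx : M x = orbitSum T f k x - k * c := hkM
    have hkN : k ≤ N := Nat.lt_succ_iff.1 (Finset.mem_range.1 hk)
    cases k with
    | zero =>
      simp [orbitSum] at hMx
      exact absurd hMx hpos.ne'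
    | succ k =>
      have h1 : ((k + 1 : ℕ) : ℝ≥0∞) * c ≤ orbitSum T f (k + 1) x := by
        rw [hMx] at hpos
        exact (tsub_pos_iff_lt.1 hpos).le
      have hsucc : ((k + 1 : ℕ) : ℝ≥0∞) * c = k * c + c := by push_cast; ring
      have h2 : M x + c = orbitSum T f (k + 1) x - k * c := by
        rw [hMx]
        refine (ENNReal.eq_sub_of_add_eq (hkc k) ?_)
        rw [add_assoc, add_comm c, ← hsucc, tsub_add_cancel_of_le h1]
      rw [h2]
      have h3 : T (orbitSum T f k) x ≤ T M x + k * c := by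
        refine (hmono _ (fun y => M y + k * c) (fun y => ?_) x).trans (hadd M _ hMm x)
        exact tsub_le_iff_right.1 (hMle k (Nat.le_of_succ_le hkN) y)
      rw [tsub_le_iff_right]
      simp only [orbitSum]
      rw [add_assoc]
      gcongr
  -- Integrating the pointwise inequality leaves ∫ M on both sides; it may be cancelled only if
  -- finite.
  have hMfin : ∫⁻ x, M x ∂ν ≠ ∞ := by
    have hle : ∀ x, M x ≤ ∑ k ∈ Finset.range (N + 1), orbitSum T f k x := fun x =>
      Finset.sup_le fun k hk => tsub_le_self.trans
        (Finset.single_le_sum (f := fun k => orbitSum T f k x) (fun _ _ => zero_le) hk)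
    refine ne_of_lt ((lintegral_mono hle).trans_lt ?_)
    rw [lintegral_finsetSum _ fun k _ => hSm k]
    refine ENNReal.sum_lt_top.2 fun k _ => ?_
    exact (lintegral_orbitSum_le hm hint hf k).trans_lt
      (ENNReal.mul_lt_top (by simp) hfi.lt_top)
  have hsum : ∫⁻ x, M x ∂ν + c * ν E ≤ ∫⁻ x, M x ∂ν + ∫⁻ x, f x ∂ν := by
    calc ∫⁻ x, M x ∂ν + c * ν E = ∫⁻ x in E, (M x + c) ∂ν := by
          rw [lintegral_add_left hMm, setLIntegral_const]
          congr 1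
          rw [← lintegral_indicator hEm]
          refine lintegral_congr fun x => ?_
          by_cases hx : x ∈ E
          · rw [Set.indicator_of_mem hx]
          · rw [Set.indicator_of_notMem hx, hMzero x hx]
      _ ≤ ∫⁻ x in E, (f x + T M x) ∂ν := setLIntegral_mono' hEm hkey
      _ ≤ ∫⁻ x, (f x + T M x) ∂ν := setLIntegral_le_lintegral _ _
      _ = ∫⁻ x, f x ∂ν + ∫⁻ x, T M x ∂ν := lintegral_add_left hf _
      _ ≤ ∫⁻ x, f x ∂ν + ∫⁻ x, M x ∂ν := add_le_add_right (hint M hMm) _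
      _ = _ := add_comm _ _
  exact (ENNReal.add_le_add_iff_left hMfin).1 hsum

end Hopf

/-! ### The transport kernel -/

/-- The Poisson kernel of ratio `√(min t v / max t v)`, which carries functions on the parallel
with parameter `v` to the parallel with parameter `t`. -/
def transKernel {n : ℕ} (t v : ℝ) (ξ η : USphere n) : ℝ :=
  if 0 < t ∧ 0 < v ∧ t ≠ v then
    (sphereArea n)⁻¹ * ballKernel (√(min t v / max t v) • (ξ : EuclideanSpace ℝ (Fin n))) η
  else 0

theorem sqrt_min_div_max_lt_one {t v : ℝ} (ht : 0 < t) (h : t ≠ v) :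
    √(min t v / max t v) < 1 := by
  rw [Real.sqrt_lt' one_pos, one_pow, div_lt_one (lt_max_of_lt_left ht)]
  exact min_lt_max.2 h

theorem norm_smul_sphere {n : ℕ} {r : ℝ} (hr : 0 ≤ r) (ξ : USphere n) :
    ‖r • (ξ : EuclideanSpace ℝ (Fin n))‖ = r := by
  rw [norm_smul, mem_sphere_zero_iff_norm.1 ξ.2, mul_one, Real.norm_of_nonneg hr]

theorem transKernel_nonneg {n : ℕ} (t v : ℝ) (ξ η : USphere n) : 0 ≤ transKernel t v ξ η := by
  unfold transKernel
  split_ifs with h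
  · refine mul_nonneg (inv_nonneg.2 ?_) (ballKernel_nonneg ?_)
    · unfold sphereArea
      have : 0 ≤ Real.Gamma ((n : ℝ) / 2) := Real.Gamma_nonneg_of_nonneg (by positivity)
      positivity
    · rw [norm_smul_sphere (Real.sqrt_nonneg _)]
      exact (sqrt_min_div_max_lt_one h.1 h.2.2).le
  · exact le_rfl

theorem measurable_transKernel {n : ℕ} :
    Measurable fun z : (ℝ × ℝ) × USphere n × USphere n =>
      transKernel z.1.1 z.1.2 z.2.1 z.2.2 := by
  unfold transKernel ballKernel
  refine Measurable.ite ?_ (by fun_prop) measurable_const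
  have h1 : MeasurableSet {z : (ℝ × ℝ) × USphere n × USphere n | 0 < z.1.1} :=
    measurableSet_lt measurable_const (by fun_prop)
  have h2 : MeasurableSet {z : (ℝ × ℝ) × USphere n × USphere n | 0 < z.1.2} :=
    measurableSet_lt measurable_const (by fun_prop)
  have h3 : MeasurableSet {z : (ℝ × ℝ) × USphere n × USphere n | z.1.1 = z.1.2} :=
    measurableSet_eq_fun (by fun_prop) (by fun_prop)
  exact h1.inter (h2.inter h3.compl)

/-- Unit vectors ξ, η satisfy |rξ - η|² = r² + 1 - 2r⟨ξ, η⟩. The resulting symmetry of the Poisson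
kernel is what makes it a contraction of L¹ as well as of L^∞. -/
theorem norm_smul_sub_comm {n : ℕ} (r : ℝ) (ξ η : USphere n) :
    ‖r • (ξ : EuclideanSpace ℝ (Fin n)) - η‖ = ‖r • (η : EuclideanSpace ℝ (Fin n)) - ξ‖ := by
  have hξ : ‖(ξ : EuclideanSpace ℝ (Fin n))‖ = 1 := mem_sphere_zero_iff_norm.1 ξ.2
  have hη : ‖(η : EuclideanSpace ℝ (Fin n))‖ = 1 := mem_sphere_zero_iff_norm.1 η.2
  rw [← sq_eq_sq₀ (norm_nonneg _) (norm_nonneg _), norm_sub_sq_real, norm_sub_sq_real, norm_smul,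
    norm_smul, hξ, hη, inner_smul_left, inner_smul_left, real_inner_comm]

theorem transKernel_symm {n : ℕ} (t v : ℝ) (ξ η : USphere n) :
    transKernel t v ξ η = transKernel t v η ξ := by
  unfold transKernel ballKernel
  rw [norm_smul_sub_comm, norm_smul, norm_smul, mem_sphere_zero_iff_norm.1 ξ.2,
    mem_sphere_zero_iff_norm.1 η.2]

theorem continuous_transKernel {n : ℕ} (t v : ℝ) (ξ : USphere n) :
    Continuous (transKernel t v ξ) := by
  unfold transKernel
  split_ifs with h
  · refine continuous_const.mul (continuous_ballKernel_right ?_)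
    rw [norm_smul_sphere (Real.sqrt_nonneg _)]
    exact sqrt_min_div_max_lt_one h.1 h.2.2
  · exact continuous_const

theorem integral_transKernel {n : ℕ} (hn : 0 < n) {t v : ℝ} (ht : 0 < t) (hv : 0 < v) (h : t ≠ v)
    (ξ : USphere n) : ∫ η, transKernel t v ξ η ∂(surf n) = 1 := by
  unfold transKernel
  simp only [if_pos (And.intro ht (And.intro hv h))]
  rw [integral_const_mul, integral_ballKernel hn, inv_mul_cancel₀ (sphereArea_pos hn).ne']
  rw [norm_smul_sphere (Real.sqrt_nonneg _)]
  exact sqrt_min_div_max_lt_one ht h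

theorem lintegral_transKernel {n : ℕ} (hn : 0 < n) {t v : ℝ} (ht : 0 < t) (hv : 0 < v) (h : t ≠ v)
    (ξ : USphere n) : ∫⁻ η, ENNReal.ofReal (transKernel t v ξ η) ∂(surf n) = 1 := by
  rw [← ofReal_integral_eq_lintegral_ofReal
    (integrable_of_continuous (continuous_transKernel t v ξ))
    (Eventually.of_forall fun η => transKernel_nonneg _ _ _ _), integral_transKernel hn ht hv h,
    ENNReal.ofReal_one]

theorem lintegral_transKernel_le {n : ℕ} (hn : 0 < n) (t v : ℝ) (ξ : USphere n) :
    ∫⁻ η, ENNReal.ofReal (transKernel t v ξ η) ∂(surf n) ≤ 1 := by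
  by_cases h : 0 < t ∧ 0 < v ∧ t ≠ v
  · exact (lintegral_transKernel hn h.1 h.2.1 h.2.2 ξ).le
  · simp [transKernel, h]

/-- When v lies between u and t, the ratios satisfy (u/v)(v/t) = u/t, or the same with inverses. The
composition is then the Poisson integral formula applied to a dilate of the Poisson kernel. -/
theorem transKernel_comp {n : ℕ} (hn : 0 < n) {t v u : ℝ} (ht : 0 < t) (hv : 0 < v) (hu : 0 < u)
    (h : (u < v ∧ v < t) ∨ (t < v ∧ v < u)) (ξ ζ : USphere n) :
    ∫ η, transKernel t v ξ η * transKernel v u η ζ ∂(surf n) = transKernel t u ξ ζ := by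
  have htv : t ≠ v := by rcases h with h | h <;> [exact h.2.ne'; exact h.1.ne]
  have hvu : v ≠ u := by rcases h with h | h <;> [exact h.1.ne'; exact h.2.ne]
  have htu : t ≠ u := by
    rcases h with h | h <;> [exact (h.1.trans h.2).ne'; exact (h.1.trans h.2).ne]
  have hmul : √(min v u / max v u) * √(min t v / max t v) = √(min t u / max t u) := by
    rw [← Real.sqrt_mul (by positivity)]
    congr 1
    rcases h with ⟨h1, h2⟩ | ⟨h1, h2⟩
    · rw [min_eq_right h1.le, max_eq_left h1.le, min_eq_right h2.le, max_eq_left h2.le,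
        min_eq_right (h1.trans h2).le, max_eq_left (h1.trans h2).le]
      field_simp
    · rw [min_eq_left h1.le, max_eq_right h1.le, min_eq_left h2.le, max_eq_right h2.le,
        min_eq_left (h1.trans h2).le, max_eq_right (h1.trans h2).le]
      field_simp
  unfold transKernel
  simp only [if_pos (And.intro ht (And.intro hv htv)), if_pos (And.intro hv (And.intro hu hvu)),
    if_pos (And.intro ht (And.intro hu htu))]
  have hσ := (sphereArea_pos hn).ne'
  have hre : ∀ η : USphere n, (sphereArea n)⁻¹ *
      ballKernel (√(min t v / max t v) • (ξ : EuclideanSpace ℝ (Fin n))) η *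
      ((sphereArea n)⁻¹ * ballKernel (√(min v u / max v u) • (η : EuclideanSpace ℝ (Fin n))) ζ) =
      ((sphereArea n)⁻¹ * (sphereArea n)⁻¹) *
      (ballKernel (√(min t v / max t v) • (ξ : EuclideanSpace ℝ (Fin n))) η *
        ballKernel (√(min v u / max v u) • (η : EuclideanSpace ℝ (Fin n))) ζ) := fun η => by ring
  simp only [hre]
  rw [integral_const_mul, integral_ballKernel_mul_ballKernel hn (Real.sqrt_nonneg _)
    (sqrt_min_div_max_lt_one hv hvu), smul_smul, hmul]
  · field_simp
  · rw [norm_smul_sphere (Real.sqrt_nonneg _)]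
    exact sqrt_min_div_max_lt_one ht htv

theorem lintegral_transKernel_comp {n : ℕ} (hn : 0 < n) {t v u : ℝ} (ht : 0 < t) (hv : 0 < v)
    (hu : 0 < u) (h : (u < v ∧ v < t) ∨ (t < v ∧ v < u)) (ξ ζ : USphere n) :
    ∫⁻ η, ENNReal.ofReal (transKernel t v ξ η) * ENNReal.ofReal (transKernel v u η ζ) ∂(surf n) =
      ENNReal.ofReal (transKernel t u ξ ζ) := by
  simp only [← ENNReal.ofReal_mul (transKernel_nonneg _ _ _ _)]
  rw [← ofReal_integral_eq_lintegral_ofReal, transKernel_comp hn ht hv hu h]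
  · simp only [transKernel_symm v u _ ζ]
    exact integrable_of_continuous
      ((continuous_transKernel t v ξ).mul (continuous_transKernel v u ζ))
  · exact Eventually.of_forall fun η =>
      mul_nonneg (transKernel_nonneg _ _ _ _) (transKernel_nonneg _ _ _ _)

/-! ### The transport semigroup and its maximal inequality -/

/-- The action on nonnegative functions of the semigroup generated by the transport kernel;
`s = 1` and `s = -1` are the two directions of time. -/
def transport {n : ℕ} (s a : ℝ) (f : ℝ × USphere n → ℝ≥0∞) (z : ℝ × USphere n) : ℝ≥0∞ :=
  ∫⁻ η, ENNReal.ofReal (transKernel z.1 (z.1 - s * a) z.2 η) * f (z.1 - s * a, η) ∂(surf n)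

/-- The integral of the semigroup over the times in `(0, b]`. -/
def transportMean {n : ℕ} (s : ℝ) (f : ℝ × USphere n → ℝ≥0∞) (b : ℝ) (z : ℝ × USphere n) :
    ℝ≥0∞ :=
  ∫⁻ a in Set.Ioc 0 b, transport s a f z

section Transport

variable {n : ℕ} {s : ℝ} {f : ℝ × USphere n → ℝ≥0∞}

theorem measurable_transport_uncurry (s : ℝ) (hf : Measurable f) :
    Measurable fun w : ℝ × ℝ × USphere n => transport s w.1 f w.2 := by
  have h1 : Measurable fun w : (ℝ × ℝ × USphere n) × USphere n =>
      ENNReal.ofReal (transKernel w.1.2.1 (w.1.2.1 - s * w.1.1) w.1.2.2 w.2) *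
        f (w.1.2.1 - s * w.1.1, w.2) := by
    have h2 := measurable_transKernel.comp (f := fun w : (ℝ × ℝ × USphere n) × USphere n =>
      ((w.1.2.1, w.1.2.1 - s * w.1.1), (w.1.2.2, w.2))) (by fun_prop)
    have h3 := hf.comp (f := fun w : (ℝ × ℝ × USphere n) × USphere n =>
      (w.1.2.1 - s * w.1.1, w.2)) (by fun_prop)
    exact h2.ennreal_ofReal.mul h3
  exact h1.lintegral_prod_right'

theorem measurable_transport (s a : ℝ) (hf : Measurable f) : Measurable (transport s a f) :=
  (measurable_transport_uncurry s hf).comp (by fun_prop : Measurable fun z => (a, z))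

theorem measurable_transport_time (s : ℝ) (hf : Measurable f) (z : ℝ × USphere n) :
    Measurable fun a => transport s a f z :=
  (measurable_transport_uncurry s hf).comp (by fun_prop : Measurable fun a => (a, z))

theorem measurable_transportMean (s : ℝ) (hf : Measurable f) (b : ℝ) :
    Measurable (transportMean s f b) :=
  ((measurable_transport_uncurry s hf).comp measurable_swap).lintegral_prod_right'
    (ν := volume.restrict (Set.Ioc 0 b))

theorem transport_mono {s a : ℝ} {f g : ℝ × USphere n → ℝ≥0∞} (h : f ≤ g) :
    transport s a f ≤ transport s a g := fun z => by
  unfold transport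
  gcongr with η
  exact h _

theorem transport_add_const_le (hn : 0 < n) (s a : ℝ) (c : ℝ≥0∞) (z : ℝ × USphere n) :
    transport s a (fun y => f y + c) z ≤ transport s a f z + c := by
  unfold transport
  simp only [mul_add]
  have hk : Measurable fun η => ENNReal.ofReal (transKernel z.1 (z.1 - s * a) z.2 η) :=
    (continuous_transKernel _ _ _).measurable.ennreal_ofReal
  rw [lintegral_add_right _ (hk.mul_const c), lintegral_mul_const _ hk]
  gcongr
  exact mul_le_of_le_one_left zero_le (lintegral_transKernel_le hn _ _ _)

/-- Tonelli's theorem and the symmetry of the kernel: its mass is at most 1 in either variable. -/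
theorem lintegral_transport_slice_le (hn : 0 < n) (s a : ℝ) (hf : Measurable f) (t : ℝ) :
    ∫⁻ ξ, transport s a f (t, ξ) ∂(surf n) ≤ ∫⁻ η, f (t - s * a, η) ∂(surf n) := by
  unfold transport
  have hm : Measurable fun w : USphere n × USphere n =>
      ENNReal.ofReal (transKernel t (t - s * a) w.1 w.2) * f (t - s * a, w.2) := by
    have h2 := measurable_transKernel.comp (f := fun w : USphere n × USphere n =>
      ((t, t - s * a), w)) (by fun_prop)
    exact h2.ennreal_ofReal.mul (hf.comp (by fun_prop))
  rw [lintegral_lintegral_swap hm.aemeasurable]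
  refine lintegral_mono fun η => ?_
  simp only
  rw [lintegral_mul_const]
  · refine mul_le_of_le_one_left zero_le ?_
    simp only [transKernel_symm _ _ _ η]
    exact lintegral_transKernel_le hn _ _ _
  · simp only [transKernel_symm _ _ _ η]
    exact (continuous_transKernel _ _ _).measurable.ennreal_ofReal

theorem lintegral_transport_le (hn : 0 < n) (s a : ℝ) (hf : Measurable f) :
    ∫⁻ z, transport s a f z ∂(volume.prod (surf n)) ≤ ∫⁻ z, f z ∂(volume.prod (surf n)) := by
  rw [lintegral_prod _ (measurable_transport s a hf).aemeasurable,
    lintegral_prod _ hf.aemeasurable]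
  refine (lintegral_mono fun t => lintegral_transport_slice_le hn s a hf t).trans (le_of_eq ?_)
  exact lintegral_sub_right_eq_self (fun t => ∫⁻ η, f (t, η) ∂(surf n)) (s * a)

theorem transport_eq_zero {s a : ℝ} {z : ℝ × USphere n} (h : ¬ (0 < z.1 ∧ 0 < z.1 - s * a)) :
    transport s a f z = 0 := by
  unfold transport transKernel
  rw [← lintegral_zero]
  refine lintegral_congr fun η => ?_
  rw [if_neg (fun h' => h ⟨h'.1, h'.2.1⟩)]
  simp

/-- The composition law of the kernel, with Tonelli's theorem. If t or the final value leaves the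
half-line, both sides vanish. Positive times are needed since the kernel is set to 0 for equal
parameters, so `transport` at time 0 is zero and not the identity. -/
theorem transport_transport (hn : 0 < n) (hs : s = 1 ∨ s = -1) {a b : ℝ} (ha : 0 < a) (hb : 0 < b)
    (hf : Measurable f) (z : ℝ × USphere n) :
    transport s a (transport s b f) z = transport s (a + b) f z := by
  obtain ⟨t, ξ⟩ := z
  have hv : t - s * a - s * b = t - s * (a + b) := by ring
  by_cases h : 0 < t ∧ 0 < t - s * (a + b)
  · have htv : 0 < t - s * a := by
      rcases hs with rfl | rfl
      · linarith [h.2]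
      · linarith [h.1]
    have hord : (t - s * (a + b) < t - s * a ∧ t - s * a < t) ∨
        (t < t - s * a ∧ t - s * a < t - s * (a + b)) := by
      rcases hs with rfl | rfl
      · left; constructor <;> linarith
      · right; constructor <;> linarith
    unfold transport
    simp only [hv]
    have hk : Measurable fun w : USphere n × USphere n =>
        transKernel (t - s * a) (t - s * (a + b)) w.1 w.2 :=
      measurable_transKernel.comp (f := fun w : USphere n × USphere n =>
        ((t - s * a, t - s * (a + b)), w)) (by fun_prop)
    have hk1 : Measurable fun η : USphere n => transKernel t (t - s * a) ξ η :=
      (continuous_transKernel _ _ _).measurable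
    have hfm : Measurable fun ζ : USphere n => f (t - s * (a + b), ζ) := hf.comp (by fun_prop)
    calc ∫⁻ η, ENNReal.ofReal (transKernel t (t - s * a) ξ η) *
          ∫⁻ ζ, ENNReal.ofReal (transKernel (t - s * a) (t - s * (a + b)) η ζ) *
            f (t - s * (a + b), ζ) ∂(surf n) ∂(surf n)
        = ∫⁻ η, ∫⁻ ζ, ENNReal.ofReal (transKernel t (t - s * a) ξ η) *
            (ENNReal.ofReal (transKernel (t - s * a) (t - s * (a + b)) η ζ) *
              f (t - s * (a + b), ζ)) ∂(surf n) ∂(surf n) := by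
          refine lintegral_congr fun η => (lintegral_const_mul _ ?_).symm
          exact (hk.comp (by fun_prop : Measurable fun ζ => (η, ζ))).ennreal_ofReal.mul hfm
      _ = ∫⁻ ζ, ∫⁻ η, ENNReal.ofReal (transKernel t (t - s * a) ξ η) *
            (ENNReal.ofReal (transKernel (t - s * a) (t - s * (a + b)) η ζ) *
              f (t - s * (a + b), ζ)) ∂(surf n) ∂(surf n) := by
          refine lintegral_lintegral_swap (Measurable.aemeasurable ?_)
          exact (hk1.comp measurable_fst).ennreal_ofReal.mul
            (hk.ennreal_ofReal.mul (hfm.comp measurable_snd))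
      _ = _ := by
          refine lintegral_congr fun ζ => ?_
          simp only [← mul_assoc]
          rw [lintegral_mul_const, lintegral_transKernel_comp hn h.1 htv h.2 hord]
          exact hk1.ennreal_ofReal.mul
            (hk.comp (by fun_prop : Measurable fun η => (η, ζ))).ennreal_ofReal
  · rw [transport_eq_zero (s := s) (a := a + b) (f := f) (z := (t, ξ)) h]
    by_cases ht : 0 < t
    · have h2 : ¬ 0 < t - s * (a + b) := fun h' => h ⟨ht, h'⟩
      unfold transport
      rw [← lintegral_zero]
      refine lintegral_congr fun η => ?_
      have := transport_eq_zero (s := s) (a := b) (f := f) (z := (t - s * a, η))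
        (fun h' => h2 (by rw [← hv]; exact h'.2))
      unfold transport at this
      rw [this, mul_zero]
    · exact transport_eq_zero fun h' => ht h'.1

theorem transport_transportMean (hn : 0 < n) (hs : s = 1 ∨ s = -1) {δ : ℝ} (hδ : 0 < δ) (b : ℝ)
    (hf : Measurable f) (z : ℝ × USphere n) :
    transport s δ (transportMean s f b) z = ∫⁻ a in Set.Ioc δ (δ + b), transport s a f z := by
  have h1 : transport s δ (transportMean s f b) z =
      ∫⁻ a in Set.Ioc 0 b, transport s δ (transport s a f) z := by
    unfold transport transportMean
    have hk1 : Measurable fun η : USphere n =>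
        ENNReal.ofReal (transKernel z.1 (z.1 - s * δ) z.2 η) :=
      (continuous_transKernel _ _ _).measurable.ennreal_ofReal
    have hm := measurable_transport_uncurry s hf
    have hm1 : ∀ η : USphere n, Measurable fun a : ℝ => transport s a f (z.1 - s * δ, η) :=
      fun η => hm.comp (by fun_prop : Measurable fun a : ℝ => (a, (z.1 - s * δ, η)))
    rw [← lintegral_lintegral_swap]
    · refine lintegral_congr fun η => ?_
      exact (lintegral_const_mul _ (hm1 η)).symm
    · refine Measurable.aemeasurable ?_
      exact (hk1.comp measurable_fst).mul (hm.comp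
        (by fun_prop : Measurable fun w : USphere n × ℝ => (w.2, (z.1 - s * δ, w.1))))
  rw [h1]
  have h2 : ∀ a ∈ Set.Ioc 0 b, transport s δ (transport s a f) z = transport s (δ + a) f z :=
    fun a ha => transport_transport hn hs hδ ha.1 hf z
  rw [setLIntegral_congr_fun measurableSet_Ioc h2, ← lintegral_indicator measurableSet_Ioc,
    ← lintegral_indicator measurableSet_Ioc,
    ← lintegral_add_left_eq_self ((Set.Ioc δ (δ + b)).indicator fun a => transport s a f z) δ]
  refine lintegral_congr fun a => ?_
  by_cases ha : a ∈ Set.Ioc 0 b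
  · rw [Set.indicator_of_mem ha, Set.indicator_of_mem]
    exact ⟨by linarith [ha.1], by linarith [ha.2]⟩
  · rw [Set.indicator_of_notMem ha, Set.indicator_of_notMem]
    exact fun h => ha ⟨by linarith [h.1], by linarith [h.2]⟩

/-- Each step of length δ shifts the window (0, b] to (δ, δ + b], and the windows tile. Hopf's
discrete inequality thereby controls the continuous means over all windows (0, kδ]. -/
theorem orbitSum_transport (hn : 0 < n) (hs : s = 1 ∨ s = -1) {δ : ℝ} (hδ : 0 < δ)
    (hf : Measurable f) (k : ℕ) :
    orbitSum (transport s δ) (transportMean s f δ) k = transportMean s f (k * δ) := by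
  induction k with
  | zero => funext z; simp [orbitSum, transportMean]
  | succ k ih =>
    funext z
    simp only [orbitSum]
    rw [ih, transport_transportMean hn hs hδ _ hf]
    unfold transportMean
    have hk : (0 : ℝ) ≤ k * δ := by positivity
    rw [← lintegral_union measurableSet_Ioc, Set.Ioc_union_Ioc_eq_Ioc hδ.le (by linarith)]
    · congr 2
      push_cast
      ring_nf
    · exact Set.Ioc_disjoint_Ioc_of_le le_rfl

theorem lintegral_transportMean_le (hn : 0 < n) (s b : ℝ) (hf : Measurable f) :
    ∫⁻ z, transportMean s f b z ∂(volume.prod (surf n)) ≤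
      ENNReal.ofReal b * ∫⁻ z, f z ∂(volume.prod (surf n)) := by
  unfold transportMean
  rw [lintegral_lintegral_swap]
  · calc ∫⁻ a in Set.Ioc 0 b, ∫⁻ z, transport s a f z ∂(volume.prod (surf n))
        ≤ ∫⁻ a in Set.Ioc 0 b, ∫⁻ z, f z ∂(volume.prod (surf n)) :=
          lintegral_mono fun a => lintegral_transport_le hn s a hf
      _ = _ := by rw [setLIntegral_const, Real.volume_Ioc, sub_zero, mul_comm]
  · exact ((measurable_transport_uncurry s hf).comp measurable_swap).aemeasurable

/-- The weak type `(1, 1)` inequality for the transport semigroup. -/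
theorem transport_weak_type (hn : 0 < n) (hs : s = 1 ∨ s = -1) (hf : Measurable f)
    (hfi : ∫⁻ z, f z ∂(volume.prod (surf n)) ≠ ∞) {c : ℝ≥0∞} (hc : c ≠ ∞) :
    c * (volume.prod (surf n)) {z | ∃ m : ℕ, c * ENNReal.ofReal ((1 / 2) ^ m) <
      transportMean s f ((1 / 2) ^ m) z} ≤ ∫⁻ z, f z ∂(volume.prod (surf n)) := by
  set ν : Measure (ℝ × USphere n) := volume.prod (surf n)
  set E : ℕ → Set (ℝ × USphere n) := fun M => {z | ∃ m ≤ M, c * ENNReal.ofReal ((1 / 2) ^ m) <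
      transportMean s f ((1 / 2) ^ m) z} with hE
  have hEmono : Monotone E := fun M N h z ⟨m, hm, hz⟩ => ⟨m, hm.trans h, hz⟩
  have hunion : {z | ∃ m : ℕ, c * ENNReal.ofReal ((1 / 2) ^ m) <
      transportMean s f ((1 / 2) ^ m) z} = ⋃ M, E M := by
    ext z
    simp only [hE, Set.mem_ofPred_eq, Set.mem_iUnion]
    constructor
    · rintro ⟨m, hm⟩
      exact ⟨m, m, le_rfl, hm⟩
    · rintro ⟨_, m, -, hm⟩
      exact ⟨m, hm⟩
  rw [hunion, hEmono.measure_iUnion, ENNReal.mul_iSup]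
  refine iSup_le fun M => ?_
  -- All windows 2^{-m} with m ≤ M are multiples 2^{M-m} δ of the finest one, with at most 2^M
  -- steps. The factor δ appears on both sides of the maximal inequality and cancels, so the bound
  -- is uniform in M.
  set δ : ℝ := (1 / 2) ^ M with hδ
  have hδ0 : 0 < δ := by positivity
  have hofδ : ENNReal.ofReal δ ≠ 0 := by simpa using hδ0
  have hH := hopf_maximal_inequality (T := transport s δ) (f := transportMean s f δ) (ν := ν)
    (fun g hg => measurable_transport s δ hg) (fun g h hgh => transport_mono hgh)
    (fun g c _ z => transport_add_const_le hn s δ c z)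
    (fun g hg => lintegral_transport_le hn s δ hg)
    (measurable_transportMean s hf δ)
    (ne_of_lt ((lintegral_transportMean_le hn s δ hf).trans_lt
      (ENNReal.mul_lt_top ENNReal.ofReal_lt_top hfi.lt_top)))
    (c := c * ENNReal.ofReal δ) (ENNReal.mul_ne_top hc ENNReal.ofReal_ne_top) (2 ^ M)
  have hsub : E M ⊆ {z | ∃ k : ℕ, k ≤ 2 ^ M ∧ (k : ℝ≥0∞) * (c * ENNReal.ofReal δ) <
      orbitSum (transport s δ) (transportMean s f δ) k z} := by
    rintro z ⟨m, hm, hz⟩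
    have hkδ : ((2 ^ (M - m) : ℕ) : ℝ) * δ = (1 / 2) ^ m := by
      obtain ⟨i, rfl⟩ := Nat.exists_eq_add_of_le hm
      rw [hδ, add_tsub_cancel_left, pow_add]
      push_cast
      rw [mul_left_comm, ← mul_pow]
      norm_num
    refine ⟨2 ^ (M - m), Nat.pow_le_pow_right two_pos (Nat.sub_le _ _), ?_⟩
    rw [orbitSum_transport hn hs hδ0 hf, hkδ]
    refine lt_of_le_of_lt (le_of_eq ?_) hz
    rw [← hkδ, ENNReal.ofReal_mul (by positivity), ENNReal.ofReal_natCast]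
    ring
  have h1 : ENNReal.ofReal δ * (c * ν (E M)) ≤ ENNReal.ofReal δ * ∫⁻ z, f z ∂ν := by
    refine le_trans ?_ (hH.trans (lintegral_transportMean_le hn s δ hf))
    rw [← mul_assoc, mul_comm (ENNReal.ofReal δ)]
    gcongr
  exact (ENNReal.mul_le_mul_iff_right hofδ ENNReal.ofReal_ne_top).1 h1

end Transport

/-! ### Lebesgue points of the transport semigroup -/

/-- The action of the transport semigroup on complex functions. -/
def transportC {n : ℕ} (s : ℝ) (G : ℝ × USphere n → ℂ) (z : ℝ × USphere n) (a : ℝ) : ℂ :=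
  ∫ η, transKernel z.1 (z.1 - s * a) z.2 η • G (z.1 - s * a, η) ∂(surf n)

section LebesguePoints

variable {n : ℕ} {s : ℝ} {G : ℝ × USphere n → ℂ}

theorem stronglyMeasurable_transportC_uncurry (s : ℝ) (hG : Measurable G) :
    StronglyMeasurable fun w : ℝ × ℝ × USphere n => transportC s G w.2 w.1 := by
  have h1 : Measurable fun w : (ℝ × ℝ × USphere n) × USphere n =>
      transKernel w.1.2.1 (w.1.2.1 - s * w.1.1) w.1.2.2 w.2 •
        G (w.1.2.1 - s * w.1.1, w.2) := by
    have h2 := measurable_transKernel.comp (f := fun w : (ℝ × ℝ × USphere n) × USphere n =>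
      ((w.1.2.1, w.1.2.1 - s * w.1.1), (w.1.2.2, w.2))) (by fun_prop)
    have h3 := hG.comp (f := fun w : (ℝ × ℝ × USphere n) × USphere n =>
      (w.1.2.1 - s * w.1.1, w.2)) (by fun_prop)
    exact h2.smul h3
  exact h1.stronglyMeasurable.integral_prod_right'

theorem stronglyMeasurable_transportC (s : ℝ) (hG : Measurable G) (z : ℝ × USphere n) :
    StronglyMeasurable (transportC s G z) :=
  (stronglyMeasurable_transportC_uncurry s hG).comp_measurable
    (by fun_prop : Measurable fun a => (a, z))

theorem enorm_transportC_le (s : ℝ) (G : ℝ × USphere n → ℂ) (z : ℝ × USphere n) (a : ℝ) :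
    ‖transportC s G z a‖ₑ ≤ transport s a (fun y => ‖G y‖ₑ) z := by
  unfold transportC transport
  refine (enorm_integral_le_lintegral_enorm _).trans (le_of_eq ?_)
  refine lintegral_congr fun η => ?_
  rw [enorm_smul, Real.enorm_eq_ofReal (transKernel_nonneg _ _ _ _)]

theorem integrable_transKernel_smul {t v : ℝ} {ξ : USphere n} {g : USphere n → ℂ}
    (hg : Integrable g (surf n)) : Integrable (fun η => transKernel t v ξ η • g η) (surf n) := by
  obtain ⟨C, hC⟩ := isCompact_univ.exists_bound_of_continuousOn
    (continuous_transKernel t v ξ).continuousOn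
  exact hg.bdd_smul C (continuous_transKernel t v ξ).aestronglyMeasurable
    (Eventually.of_forall fun η => hC η (Set.mem_univ _))

theorem tendsto_time (hs : s = 1 ∨ s = -1) (t : ℝ) :
    Tendsto (fun a : ℝ => t - s * a) (𝓝[>] 0) (𝓝 t) ∧ ∀ᶠ a in 𝓝[>] (0 : ℝ), t - s * a ≠ t := by
  constructor
  · have hc : Continuous fun a : ℝ => t - s * a := by fun_prop
    have := hc.tendsto 0
    simp only [mul_zero, sub_zero] at this
    exact this.mono_left nhdsWithin_le_nhds
  · filter_upwards [self_mem_nhdsWithin] with a ha h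
    have ha : 0 < a := ha
    rcases hs with rfl | rfl <;> linarith

/-- As a → 0 the point √(min/max) ξ tends to ξ from inside the ball, so the kernel concentrates at ξ
while the slice moves to t. Joint continuity of c handles both motions at once. -/
theorem tendsto_transportC (hn : 0 < n) (hs : s = 1 ∨ s = -1) {c : ℝ × USphere n → ℂ}
    (hc : Continuous c) {M : ℝ} (hM : ∀ z, ‖c z‖ ≤ M) {z : ℝ × USphere n} (hz : 0 < z.1) :
    Tendsto (transportC s c z) (𝓝[>] 0) (𝓝 (c z)) := by
  obtain ⟨t, ξ⟩ := z
  have hz : 0 < t := hz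
  have hσ := sphereArea_pos hn
  have hM0 : 0 ≤ M := (norm_nonneg _).trans (hM (t, ξ))
  obtain ⟨hlim, hne⟩ := tendsto_time hs t
  rw [Metric.tendsto_nhds]
  intro ε hε
  obtain ⟨δ, hδ, hδc⟩ := Metric.continuous_iff.1 hc (t, ξ) (ε / 4) (by positivity)
  set κ : ℝ := ε / (4 * (2 * M + 1)) with hκ
  have hκ0 : 0 < κ := by positivity
  have hball := eventually_ballKernel_le ξ hδ hκ0
  have hpt : Tendsto (fun a : ℝ => √(min t (t - s * a) / max t (t - s * a)) •
      (ξ : EuclideanSpace ℝ (Fin n))) (𝓝[>] 0)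
      (𝓝[Metric.ball 0 1] (ξ : EuclideanSpace ℝ (Fin n))) := by
    refine tendsto_nhdsWithin_iff.2 ⟨?_, ?_⟩
    · have h1 : Tendsto (fun a : ℝ => √(min t (t - s * a) / max t (t - s * a))) (𝓝[>] 0)
          (𝓝 √(min t t / max t t)) := by
        refine (Real.continuous_sqrt.tendsto _).comp (Tendsto.div ?_ ?_ ?_)
        · exact tendsto_const_nhds.min hlim
        · exact tendsto_const_nhds.max hlim
        · simpa using hz.ne'
      have h2 : √(min t t / max t t) = 1 := by simp [div_self hz.ne']
      rw [h2] at h1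
      simpa using h1.smul_const (ξ : EuclideanSpace ℝ (Fin n))
    · filter_upwards [hne] with a ha
      rw [mem_ball_zero_iff, norm_smul_sphere (Real.sqrt_nonneg _)]
      exact sqrt_min_div_max_lt_one hz ha.symm
  filter_upwards [hpt.eventually hball, hne, hlim.eventually (lt_mem_nhds hz),
    hlim.eventually (Metric.ball_mem_nhds t hδ)] with a h1 h2 h3 h4
  have h2 : t ≠ t - s * a := h2.symm
  set v := t - s * a with hv
  have hk := continuous_transKernel t v ξ
  have hcv : Continuous fun η => c (v, η) := hc.comp (by fun_prop)
  have hi : ∀ g : USphere n → ℂ, Continuous g → Integrable g (surf n) := fun g hg =>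
    hg.integrable_of_hasCompactSupport (HasCompactSupport.of_compactSpace _)
  have hdiff : transportC s c (t, ξ) a - c (t, ξ) =
      ∫ η, transKernel t v ξ η • (c (v, η) - c (t, ξ)) ∂(surf n) := by
    have e1 : ∫ η, transKernel t v ξ η • c (t, ξ) ∂(surf n) = c (t, ξ) := by
      rw [integral_smul_const, integral_transKernel hn hz h3 h2, one_smul]
    have i1 : Integrable (fun η => transKernel t v ξ η • c (v, η)) (surf n) := hi _ (hk.smul hcv)
    have i2 : Integrable (fun η => transKernel t v ξ η • c (t, ξ)) (surf n) :=
      hi _ (hk.smul continuous_const)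
    simp only [smul_sub]
    rw [integral_sub i1 i2, e1]
    rfl
  rw [dist_eq_norm, hdiff]
  have hbd : ∀ η : USphere n, ‖transKernel t v ξ η • (c (v, η) - c (t, ξ))‖ ≤
      transKernel t v ξ η * (ε / 4) + (sphereArea n)⁻¹ * κ * (2 * M + 1) := by
    intro η
    have hk0 := transKernel_nonneg t v ξ η
    rw [norm_smul, Real.norm_of_nonneg hk0]
    rcases lt_or_ge (dist η ξ) δ with h | h
    · have h5 : dist ((v, η) : ℝ × USphere n) (t, ξ) < δ := by
        rw [Prod.dist_eq]
        exact max_lt h4 h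
      have h6 : ‖c (v, η) - c (t, ξ)‖ ≤ ε / 4 := by
        rw [← dist_eq_norm]; exact (hδc _ h5).le
      have h7 : 0 ≤ (sphereArea n)⁻¹ * κ * (2 * M + 1) := by positivity
      have := mul_le_mul_of_nonneg_left h6 hk0
      linarith
    · have h5 : transKernel t v ξ η ≤ (sphereArea n)⁻¹ * κ := by
        unfold transKernel
        rw [if_pos ⟨hz, h3, h2⟩]
        gcongr
        exact h1 η h
      have h6 : ‖c (v, η) - c (t, ξ)‖ ≤ 2 * M + 1 := by
        have := norm_sub_le (c (v, η)) (c (t, ξ))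
        linarith [hM (v, η), hM (t, ξ)]
      have := mul_le_mul h5 h6 (norm_nonneg _) (by positivity)
      have h7 : 0 ≤ transKernel t v ξ η * (ε / 4) := by positivity
      linarith
  refine (norm_integral_le_of_norm_le (integrable_of_continuous (by fun_prop))
    (Eventually.of_forall hbd)).trans_lt ?_
  rw [integral_add (integrable_of_continuous (by fun_prop)) (integrable_const _),
    integral_mul_const, integral_transKernel hn hz h3 h2, integral_const, surf_real_univ hn,
    smul_eq_mul]
  have e2 : sphereArea n * ((sphereArea n)⁻¹ * κ * (2 * M + 1)) = ε / 4 := by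
    rw [hκ]; field_simp
  rw [e2]
  linarith

/-- Choose m with 2^{-m-1} < b ≤ 2^{-m}; enlarging the window to 2^{-m} < 2b costs a factor 2. -/
theorem transportMean_le_of_dyadic {f : ℝ × USphere n → ℝ≥0∞} {z : ℝ × USphere n} {c : ℝ≥0∞}
    (h : ∀ m : ℕ, transportMean s f ((1 / 2) ^ m) z ≤ c * ENNReal.ofReal ((1 / 2) ^ m))
    {b : ℝ} (hb0 : 0 < b) (hb1 : b ≤ 1) :
    transportMean s f b z ≤ c * ENNReal.ofReal (2 * b) := by
  obtain ⟨m, hm1, hm2⟩ := exists_nat_pow_near_of_lt_one hb0 hb1 (by norm_num : (0 : ℝ) < 1 / 2)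
    (by norm_num)
  refine le_trans ?_ ((h m).trans ?_)
  · exact lintegral_mono_set (Set.Ioc_subset_Ioc_right hm2)
  · gcongr
    rw [pow_succ] at hm1
    linarith

/-- **Local ergodic theorem**: almost every point is a Lebesgue point, in the sense of the
transport semigroup, of an integrable function. -/
theorem ae_lebesgue_point (hn : 0 < n) (hs : s = 1 ∨ s = -1) (hGm : Measurable G)
    (hG : Integrable G (volume.prod (surf n))) :
    ∀ᵐ z ∂((volume : Measure ℝ).prod (surf n)), 0 < z.1 → ∀ ω : ℝ, 0 < ω → ∃ T > 0, ∀ b, 0 < b → b ≤ T →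
      ∫⁻ a in Set.Ioc 0 b, ‖transportC s G z a - G z‖ₑ ≤
        ENNReal.ofReal ω * ENNReal.ofReal b := by
  set ν : Measure (ℝ × USphere n) := volume.prod (surf n) with hν
  have hslice : ∀ᵐ v : ℝ, Integrable (fun η => G (v, η)) (surf n) := hG.prod_right_ae
  have hslice' : ∀ t : ℝ, ∀ᵐ a : ℝ, Integrable (fun η => G (t - s * a, η)) (surf n) := by
    intro t
    have hq : Measure.QuasiMeasurePreserving (fun a : ℝ => t - s * a) volume volume := by
      rcases hs with rfl | rfl
      · simpa using (Measure.measurePreserving_sub_left volume t).quasiMeasurePreserving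
      · simpa [sub_neg_eq_add] using (measurePreserving_add_left volume t).quasiMeasurePreserving
    exact hq.ae hslice
  have hfix : ∀ ω : ℝ, 0 < ω → ∀ᵐ z ∂ν, 0 < z.1 → ∃ T > 0, ∀ b, 0 < b → b ≤ T →
      ∫⁻ a in Set.Ioc 0 b, ‖transportC s G z a - G z‖ₑ ≤ ENNReal.ofReal ω * ENNReal.ofReal b := by
    intro ω hω
    rw [ae_iff]
    set B : Set (ℝ × USphere n) := {z | ¬ (0 < z.1 → ∃ T > 0, ∀ b, 0 < b → b ≤ T →
      ∫⁻ a in Set.Ioc 0 b, ‖transportC s G z a - G z‖ₑ ≤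
        ENNReal.ofReal ω * ENNReal.ofReal b)} with hB
    -- The four quarters of ω: the maximal function of G - c counts twice because of the dyadic
    -- factor 2, the error U_a c - c once, and |G - c| at z once.
    set lam : ℝ≥0∞ := ENNReal.ofReal (ω / 4) with hlam
    have hlam0 : lam ≠ 0 := by simpa [hlam] using hω
    have hlamt : lam ≠ ∞ := ENNReal.ofReal_ne_top
    have hbound : ∀ ε : ℝ, 0 < ε → lam * ν B ≤ 2 * ENNReal.ofReal ε := by
      intro ε hε
      -- With c continuous of compact support and L¹-close to G, a bad point must lie where the
      -- maximal function of |G - c| exceeds λ or where |G - c| ≥ λ. The weak type bound and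
      -- Markov's inequality make both sets small.
      obtain ⟨c, hcs, hcle, hcc, hci⟩ := hG.exists_hasCompactSupport_lintegral_sub_le
        (ε := ENNReal.ofReal ε) (by simpa using hε)
      set f : ℝ × USphere n → ℝ≥0∞ := fun y => ‖G y - c y‖ₑ with hf
      have hfm : Measurable f := (hGm.sub hcc.measurable).enorm
      obtain ⟨M, hM⟩ := hcs.exists_bound_of_continuous hcc
      have hsub : B ⊆ {z | ∃ m : ℕ, lam * ENNReal.ofReal ((1 / 2) ^ m) <
          transportMean s f ((1 / 2) ^ m) z} ∪ {z | lam ≤ f z} := by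
        intro z hzB
        by_contra hcon
        rw [Set.mem_union, not_or] at hcon
        obtain ⟨hcon1, hcon2⟩ := hcon
        simp only [Set.mem_ofPred_eq, not_exists, not_lt, not_le] at hcon1 hcon2
        apply hzB
        intro hz
        have hlim := tendsto_transportC hn hs hcc hM hz
        have hev : ∀ᶠ a in 𝓝[>] (0 : ℝ), ‖transportC s c z a - c z‖ₑ ≤ lam := by
          have h1 := Metric.tendsto_nhds.1 hlim (ω / 4) (by positivity)
          filter_upwards [h1] with a ha
          rw [← ofReal_norm, hlam]
          rw [dist_eq_norm] at ha
          exact ENNReal.ofReal_le_ofReal ha.le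
        obtain ⟨T, hT0, hT⟩ := (mem_nhdsGT_iff_exists_Ioc_subset).1 hev
        refine ⟨min T 1, lt_min hT0 one_pos, fun b hb0 hb => ?_⟩
        have hae : ∀ᵐ a ∂(volume.restrict (Set.Ioc 0 b)), ‖transportC s G z a - G z‖ₑ ≤
            transport s a f z + (lam + lam) := by
          filter_upwards [ae_restrict_mem measurableSet_Ioc, ae_restrict_of_ae (hslice' z.1)]
            with a ha hint
          have hcint : Integrable (fun η => c (z.1 - s * a, η)) (surf n) :=
            (hcc.comp (by fun_prop)).integrable_of_hasCompactSupport
              (HasCompactSupport.of_compactSpace _)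
          have e1 : transportC s G z a - transportC s c z a =
              transportC s (fun y => G y - c y) z a := by
            simp only [transportC]
            rw [← integral_sub (integrable_transKernel_smul hint)
              (integrable_transKernel_smul hcint)]
            simp only [smul_sub]
          have e2 : transportC s G z a - G z = transportC s (fun y => G y - c y) z a +
              ((transportC s c z a - c z) - (G z - c z)) := by rw [← e1]; ring
          rw [e2]
          refine (enorm_add_le _ _).trans (add_le_add (enorm_transportC_le _ _ _ _) ?_)
          refine enorm_sub_le.trans (add_le_add ?_ hcon2.le)
          exact hT ⟨ha.1, ha.2.trans (hb.trans (min_le_left _ _))⟩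
        calc ∫⁻ a in Set.Ioc 0 b, ‖transportC s G z a - G z‖ₑ
            ≤ ∫⁻ a in Set.Ioc 0 b, (transport s a f z + (lam + lam)) := lintegral_mono_ae hae
          _ = transportMean s f b z + (lam + lam) * ENNReal.ofReal b := by
              rw [lintegral_add_right _ measurable_const, setLIntegral_const, Real.volume_Ioc,
                sub_zero]
              rfl
          _ ≤ lam * ENNReal.ofReal (2 * b) + (lam + lam) * ENNReal.ofReal b := by
              gcongr
              exact transportMean_le_of_dyadic hcon1 hb0 (hb.trans (min_le_right _ _))
          _ = ENNReal.ofReal ω * ENNReal.ofReal b := by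
              rw [hlam, ← ENNReal.ofReal_add (by positivity) (by positivity),
                ← ENNReal.ofReal_mul (by positivity), ← ENNReal.ofReal_mul (by positivity),
                ← ENNReal.ofReal_add (by positivity) (by positivity),
                ← ENNReal.ofReal_mul (by positivity)]
              congr 1
              ring
      have hfi : ∫⁻ z, f z ∂ν ≤ ENNReal.ofReal ε := hcle
      calc lam * ν B ≤ lam * (ν {z | ∃ m : ℕ, lam * ENNReal.ofReal ((1 / 2) ^ m) <
            transportMean s f ((1 / 2) ^ m) z} + ν {z | lam ≤ f z}) := by
              gcongr
              exact (measure_mono hsub).trans (measure_union_le _ _)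
        _ ≤ ENNReal.ofReal ε + ENNReal.ofReal ε := by
              rw [mul_add]
              refine add_le_add ?_ ?_
              · exact (transport_weak_type hn hs hfm
                  (ne_of_lt (hfi.trans_lt ENNReal.ofReal_lt_top)) hlamt).trans hfi
              · exact (mul_meas_ge_le_lintegral hfm lam).trans hfi
        _ = 2 * ENNReal.ofReal ε := (two_mul _).symm
    have hzero : lam * ν B = 0 := by
      refine le_antisymm (ENNReal.le_of_forall_pos_le_add fun ε hε _ => ?_) zero_le
      have := hbound (ε / 2) (by positivity)
      rw [zero_add]
      refine this.trans (le_of_eq ?_)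
      rw [← ENNReal.ofReal_ofNat 2, ← ENNReal.ofReal_mul (by norm_num)]
      rw [mul_div_cancel₀ _ (by norm_num : (2 : ℝ) ≠ 0), ENNReal.ofReal_coe_nnreal]
    exact (mul_eq_zero.1 hzero).resolve_left hlam0
  have hall : ∀ᵐ z ∂ν, ∀ k : ℕ, 0 < z.1 → ∃ T > 0, ∀ b, 0 < b → b ≤ T →
      ∫⁻ a in Set.Ioc 0 b, ‖transportC s G z a - G z‖ₑ ≤
        ENNReal.ofReal (1 / ((k : ℝ) + 1)) * ENNReal.ofReal b :=
    ae_all_iff.2 fun k => hfix _ (by positivity)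
  filter_upwards [hall] with z hz hz0 ω hω
  obtain ⟨k, hk⟩ := exists_nat_one_div_lt hω
  obtain ⟨T, hT, h⟩ := hz k hz0
  refine ⟨T, hT, fun b hb0 hb => (h b hb0 hb).trans ?_⟩
  gcongr

end LebesguePoints

/-! ### Inversion of fractional integrals along the transport semigroup -/

/-- The function `u ↦ U_{-u} F(z)`, for `u ≤ 0`, of the transport semigroup `U`. -/
def orbitFun {n : ℕ} (s : ℝ) (F : ℝ × USphere n → ℂ) (z : ℝ × USphere n) (u : ℝ) : ℂ :=
  if u = 0 then F z else transportC s F z (-u)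

/-- The absolute integral `∫ a^{α-1} U_a |G|(z) da`. -/
def fracAbs {n : ℕ} (s α : ℝ) (G : ℝ × USphere n → ℂ) (z : ℝ × USphere n) : ℝ≥0∞ :=
  ∫⁻ a in Set.Ioi 0, ENNReal.ofReal (a ^ (α - 1)) * transport s a (fun y => ‖G y‖ₑ) z

/-- The hypotheses on a density `G` under which its fractional integral along the transport
semigroup is inverted. -/
structure FracDensity {n : ℕ} (s α : ℝ) (G : ℝ × USphere n → ℂ) : Prop where
  measurable : Measurable G
  integrable_local : ∀ r R : ℝ, 0 < r →
    IntegrableOn G (Set.Ioo r R ×ˢ Set.univ) (volume.prod (surf n))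
  lintegral_ne_top : ∀ᵐ t : ℝ, 0 < t →
    ∫⁻ a in Set.Ioi 0, ENNReal.ofReal (a ^ (α - 1)) * ∫⁻ η, ‖G (t - s * a, η)‖ₑ ∂(surf n) ≠ ∞

section Core

variable {n : ℕ} {s α : ℝ} {G : ℝ × USphere n → ℂ}

theorem measurable_fracAbs (s α : ℝ) (hG : Measurable G) : Measurable (fracAbs s α G) := by
  have h1 := measurable_transport_uncurry s (f := fun y => ‖G y‖ₑ) hG.enorm
  have h2 : Measurable fun w : (ℝ × USphere n) × ℝ =>
      ENNReal.ofReal (w.2 ^ (α - 1)) * transport s w.2 (fun y => ‖G y‖ₑ) w.1 :=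
    (by fun_prop : Measurable fun w : (ℝ × USphere n) × ℝ => ENNReal.ofReal (w.2 ^ (α - 1))).mul
      (h1.comp measurable_swap)
  exact h2.lintegral_prod_right' (ν := volume.restrict (Set.Ioi 0))

theorem lintegral_fracAbs_le (hn : 0 < n) (s α : ℝ) (hG : Measurable G) (t : ℝ) :
    ∫⁻ ξ, fracAbs s α G (t, ξ) ∂(surf n) ≤
      ∫⁻ a in Set.Ioi 0, ENNReal.ofReal (a ^ (α - 1)) * ∫⁻ η, ‖G (t - s * a, η)‖ₑ ∂(surf n) := by
  unfold fracAbs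
  have h1 := measurable_transport_uncurry s (f := fun y => ‖G y‖ₑ) hG.enorm
  rw [lintegral_lintegral_swap]
  · refine lintegral_mono fun a => ?_
    rw [lintegral_const_mul]
    · exact mul_le_mul_right (lintegral_transport_slice_le hn s a hG.enorm t) _
    · exact h1.comp (by fun_prop : Measurable fun ξ : USphere n => (a, (t, ξ)))
  · refine Measurable.aemeasurable ?_
    exact (by fun_prop : Measurable fun w : USphere n × ℝ => ENNReal.ofReal (w.2 ^ (α - 1))).mul
      (h1.comp (by fun_prop : Measurable fun w : USphere n × ℝ => (w.2, (t, w.1))))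

theorem FracDensity.ae_lintegral_fracAbs_ne_top (hn : 0 < n) (hG : FracDensity s α G) :
    ∀ᵐ t : ℝ, 0 < t → ∫⁻ ξ, fracAbs s α G (t, ξ) ∂(surf n) ≠ ∞ := by
  filter_upwards [hG.lintegral_ne_top] with t ht ht0
  exact ne_of_lt ((lintegral_fracAbs_le hn s α hG.measurable t).trans_lt (ht ht0).lt_top)

theorem ae_fracAbs_lt_top (hG : Measurable G) {t : ℝ}
    (ht : ∫⁻ ξ, fracAbs s α G (t, ξ) ∂(surf n) ≠ ∞) :
    ∀ᵐ ξ ∂(surf n), fracAbs s α G (t, ξ) < ∞ :=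
  ae_lt_top ((measurable_fracAbs s α hG).comp (by fun_prop : Measurable fun ξ => (t, ξ))) ht

theorem integrableOn_transportC (hG : Measurable G) {z : ℝ × USphere n}
    (hz : fracAbs s α G z ≠ ∞) :
    IntegrableOn (fun a => a ^ (α - 1) • transportC s G z a) (Set.Ioi 0) := by
  have hm : Measurable fun a : ℝ => a ^ (α - 1) := by fun_prop
  refine ⟨hm.aestronglyMeasurable.smul
    (stronglyMeasurable_transportC s hG z).aestronglyMeasurable, ?_⟩
  rw [HasFiniteIntegral]
  refine lt_of_le_of_lt ?_ hz.lt_top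
  refine setLIntegral_mono' measurableSet_Ioi fun a ha => ?_
  have ha : 0 < a := ha
  rw [enorm_smul, Real.enorm_eq_ofReal (by positivity)]
  gcongr
  exact enorm_transportC_le s G z a

theorem enorm_setIntegral_transportC_le (z : ℝ × USphere n) :
    ‖∫ a in Set.Ioi 0, a ^ (α - 1) • transportC s G z a‖ₑ ≤ fracAbs s α G z := by
  refine (enorm_integral_le_lintegral_enorm _).trans ?_
  refine setLIntegral_mono' measurableSet_Ioi fun a ha => ?_
  have ha : 0 < a := ha
  rw [enorm_smul, Real.enorm_eq_ofReal (by positivity)]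
  gcongr
  exact enorm_transportC_le s G z a

theorem transportC_eq_zero {z : ℝ × USphere n} {a : ℝ} (h : ¬ (0 < z.1 ∧ 0 < z.1 - s * a)) :
    transportC s G z a = 0 := by
  unfold transportC transKernel
  simp only [if_neg (fun h' : 0 < z.1 ∧ 0 < z.1 - s * a ∧ z.1 ≠ z.1 - s * a => h ⟨h'.1, h'.2.1⟩),
    zero_smul, integral_zero]

/-- For complex G the semigroup law requires Fubini, so integrability of the slice reached at time a
+ b is assumed; it holds for almost every time. -/
theorem transportC_transportC (hn : 0 < n) (hs : s = 1 ∨ s = -1) (hG : Measurable G) {t a b : ℝ}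
    (ξ : USphere n) (ha : 0 < a) (hb : 0 < b) (hv : 0 < t - s * b)
    (hint : 0 < t - s * (a + b) → Integrable (fun η => G (t - s * (a + b), η)) (surf n)) :
    ∫ η, transKernel t (t - s * b) ξ η • transportC s G (t - s * b, η) a ∂(surf n) =
      transportC s G (t, ξ) (a + b) := by
  have hadd : t - s * b - s * a = t - s * (a + b) := by ring
  by_cases h : 0 < t ∧ 0 < t - s * (a + b)
  · have hord : (t - s * (a + b) < t - s * b ∧ t - s * b < t) ∨
        (t < t - s * b ∧ t - s * b < t - s * (a + b)) := by
      rcases hs with rfl | rfl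
      · left; constructor <;> linarith
      · right; constructor <;> linarith
    have hi := hint h.2
    set u := t - s * (a + b) with hu
    set v := t - s * b with hvdef
    have hk : Measurable fun w : USphere n × USphere n => transKernel v u w.1 w.2 :=
      measurable_transKernel.comp (f := fun w : USphere n × USphere n =>
        ((v, u), w)) (by fun_prop)
    have hk1 : Measurable fun η : USphere n => transKernel t v ξ η :=
      (continuous_transKernel _ _ _).measurable
    have hGm : Measurable fun ζ : USphere n => G (u, ζ) := hG.comp (by fun_prop)
    have hprod : Integrable (Function.uncurry fun η ζ =>
        transKernel t v ξ η • (transKernel v u η ζ • G (u, ζ))) ((surf n).prod (surf n)) := by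
      refine ⟨(hk1.comp measurable_fst).aestronglyMeasurable.smul
        (hk.aestronglyMeasurable.smul (hGm.comp measurable_snd).aestronglyMeasurable), ?_⟩
      rw [HasFiniteIntegral, lintegral_prod]
      · have hle : ∀ η ζ, ‖transKernel t v ξ η • (transKernel v u η ζ • G (u, ζ))‖ₑ =
            (ENNReal.ofReal (transKernel t v ξ η) * ENNReal.ofReal (transKernel v u η ζ)) *
              ‖G (u, ζ)‖ₑ := by
          intro η ζ
          rw [enorm_smul, enorm_smul, Real.enorm_eq_ofReal (transKernel_nonneg _ _ _ _),
            Real.enorm_eq_ofReal (transKernel_nonneg _ _ _ _), mul_assoc]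
        simp only [Function.uncurry_apply_pair, hle]
        rw [lintegral_lintegral_swap]
        · have hin : ∀ ζ, ∫⁻ η, (ENNReal.ofReal (transKernel t v ξ η) *
              ENNReal.ofReal (transKernel v u η ζ)) * ‖G (u, ζ)‖ₑ ∂(surf n) =
              ENNReal.ofReal (transKernel t u ξ ζ) * ‖G (u, ζ)‖ₑ := by
            intro ζ
            rw [lintegral_mul_const, lintegral_transKernel_comp hn h.1 hv h.2 hord]
            exact hk1.ennreal_ofReal.mul
              (hk.comp (by fun_prop : Measurable fun η => (η, ζ))).ennreal_ofReal
          simp only [hin]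
          have := (integrable_transKernel_smul (t := t) (v := u) (ξ := ξ) hi).2
          rw [HasFiniteIntegral] at this
          refine lt_of_le_of_lt (le_of_eq ?_) this
          refine lintegral_congr fun ζ => ?_
          rw [enorm_smul, Real.enorm_eq_ofReal (transKernel_nonneg _ _ _ _)]
        · exact (((hk1.comp measurable_fst).ennreal_ofReal.mul hk.ennreal_ofReal).mul
            (hGm.comp measurable_snd).enorm).aemeasurable
      · exact ((hk1.comp measurable_fst).smul
          (hk.smul (hGm.comp measurable_snd))).enorm.aemeasurable
    calc ∫ η, transKernel t v ξ η • transportC s G (v, η) a ∂(surf n)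
        = ∫ η, ∫ ζ, transKernel t v ξ η • (transKernel v u η ζ • G (u, ζ)) ∂(surf n) ∂(surf n) := by
          refine integral_congr_ae (Eventually.of_forall fun η => ?_)
          simp only [transportC, hadd]
          rw [integral_smul]
      _ = ∫ ζ, ∫ η, transKernel t v ξ η • (transKernel v u η ζ • G (u, ζ)) ∂(surf n) ∂(surf n) :=
          integral_integral_swap hprod
      _ = transportC s G (t, ξ) (a + b) := by
          simp only [transportC, ← hu]
          refine integral_congr_ae (Eventually.of_forall fun ζ => ?_)
          simp only [smul_smul]
          rw [integral_smul_const, transKernel_comp hn h.1 hv h.2 hord]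
  · rw [transportC_eq_zero (z := (t, ξ)) h]
    by_cases ht : 0 < t
    · have h2 : ¬ 0 < t - s * (a + b) := fun h' => h ⟨ht, h'⟩
      have : ∀ η, transportC s G (t - s * b, η) a = 0 := fun η =>
        transportC_eq_zero fun h' => h2 (by rw [← hadd]; exact h'.2)
      simp [this]
    · have : ∀ η, transKernel t (t - s * b) ξ η = 0 := fun η => by
        unfold transKernel
        rw [if_neg fun h' => ht h'.1]
      simp [this]

theorem FracDensity.ae_integrable_slice (hG : FracDensity s α G) :
    ∀ᵐ v : ℝ, 0 < v → Integrable (fun η => G (v, η)) (surf n) := by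
  have h1 : ∀ k : ℕ, ∀ᵐ v : ℝ, v ∈ Set.Ioo (1 / ((k : ℝ) + 1)) (k + 1) →
      Integrable (fun η => G (v, η)) (surf n) := by
    intro k
    have h2 := hG.integrable_local (1 / ((k : ℝ) + 1)) (k + 1) (by positivity)
    rw [IntegrableOn, ← Measure.prod_restrict, Measure.restrict_univ] at h2
    exact (ae_restrict_iff' measurableSet_Ioo).1 h2.prod_right_ae
  filter_upwards [ae_all_iff.2 h1] with v hv hv0
  obtain ⟨k, hk⟩ := exists_nat_gt (max v (1 / v))
  refine hv k ⟨?_, ?_⟩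
  · rw [div_lt_comm₀ (by positivity) hv0]
    exact (le_max_right _ _).trans_lt (hk.trans (by linarith))
  · exact (le_max_left _ _).trans_lt (hk.trans (by linarith))

theorem quasiMeasurePreserving_time (hs : s = 1 ∨ s = -1) (t : ℝ) :
    Measure.QuasiMeasurePreserving (fun a : ℝ => t - s * a) volume volume := by
  rcases hs with rfl | rfl
  · simpa using (Measure.measurePreserving_sub_left volume t).quasiMeasurePreserving
  · simpa [sub_neg_eq_add] using (measurePreserving_add_left volume t).quasiMeasurePreserving

theorem integral_Ioi_shift (α : ℝ) {b : ℝ} (hb : 0 ≤ b) (H : ℝ → ℂ) :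
    ∫ a in Set.Ioi 0, plusPow (a - b) (α - 1) • H a =
      ∫ a in Set.Ioi 0, a ^ (α - 1) • H (a + b) := by
  have h1 : ∀ a, a ∉ Set.Ioi (0 : ℝ) → plusPow (a - b) (α - 1) • H a = 0 := by
    intro a ha
    have ha : a ≤ 0 := not_lt.1 ha
    rw [plusPow, if_neg (by linarith), zero_smul]
  rw [setIntegral_eq_integral_of_forall_compl_eq_zero h1]
  have h2 := integral_sub_right_eq_self (μ := volume)
    (fun a : ℝ => plusPow a (α - 1) • H (a + b)) b
  simp only [sub_add_cancel] at h2
  have h3 : ∀ a, a ∉ Set.Ioi (0 : ℝ) → plusPow a (α - 1) • H (a + b) = 0 := by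
    intro a ha
    rw [plusPow, if_neg (by simpa using ha), zero_smul]
  rw [h2, ← setIntegral_eq_integral_of_forall_compl_eq_zero h3]
  refine setIntegral_congr_fun measurableSet_Ioi fun a ha => ?_
  simp only [plusPow, if_pos (Set.mem_Ioi.1 ha)]

variable {F : ℝ × USphere n → ℂ}

/-- The semigroup property carried over to the fractional integral `F` of `G`. -/
theorem FracDensity.transportC_fracInt (hn : 0 < n) (hs : s = 1 ∨ s = -1)
    (hG : FracDensity s α G)
    (hF : ∀ z : ℝ × USphere n, 0 < z.1 → fracAbs s α G z ≠ ∞ →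
      F z = (Real.Gamma α)⁻¹ • ∫ a in Set.Ioi 0, a ^ (α - 1) • transportC s G z a)
    {t b : ℝ} (ht : 0 < t) (hb : 0 < b) (ξ : USphere n)
    (hfin : 0 < t - s * b → ∫⁻ η, fracAbs s α G (t - s * b, η) ∂(surf n) ≠ ∞) :
    transportC s F (t, ξ) b =
      (Real.Gamma α)⁻¹ • ∫ a in Set.Ioi 0, plusPow (a - b) (α - 1) • transportC s G (t, ξ) a := by
  rw [integral_Ioi_shift α hb.le]
  by_cases hv : 0 < t - s * b
  · have hfin' := hfin hv
    set v := t - s * b with hvdef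
    have hae := ae_fracAbs_lt_top hG.measurable hfin'
    -- On the slice t - s b the representation of F holds for almost every η, which suffices under
    -- the Poisson integral. After Fubini's theorem the semigroup law turns U_b U_a G into U_{a+b}
    -- G.
    have hiter : transportC s F (t, ξ) b = (Real.Gamma α)⁻¹ •
        ∫ η, (∫ a in Set.Ioi (0 : ℝ),
          a ^ (α - 1) • (transKernel t v ξ η • transportC s G (v, η) a)) ∂(surf n) := by
      rw [transportC, ← integral_smul]
      refine integral_congr_ae ?_
      filter_upwards [hae] with η hη
      simp only [← hvdef]
      rw [hF (v, η) hv hη.ne, smul_comm, ← integral_smul]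
      congr 1
      refine integral_congr_ae (Eventually.of_forall fun a => ?_)
      exact smul_comm _ _ _
    have hm1 : Measurable fun w : USphere n × ℝ => w.2 ^ (α - 1) := by fun_prop
    have hk1 : Measurable fun η : USphere n => transKernel t v ξ η :=
      (continuous_transKernel _ _ _).measurable
    have hH : StronglyMeasurable fun w : USphere n × ℝ => transportC s G (v, w.1) w.2 :=
      (stronglyMeasurable_transportC_uncurry s hG.measurable).comp_measurable
        (by fun_prop : Measurable fun w : USphere n × ℝ => (w.2, (v, w.1)))
    obtain ⟨C, hC⟩ := isCompact_univ.exists_bound_of_continuousOn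
      (continuous_transKernel t v ξ).continuousOn
    have hmeas : StronglyMeasurable (Function.uncurry fun (η : USphere n) (a : ℝ) =>
        a ^ (α - 1) • (transKernel t v ξ η • transportC s G (v, η) a)) :=
      hm1.stronglyMeasurable.smul ((hk1.comp measurable_fst).stronglyMeasurable.smul hH)
    have hprod : Integrable (Function.uncurry fun (η : USphere n) (a : ℝ) =>
        a ^ (α - 1) • (transKernel t v ξ η • transportC s G (v, η) a))
        ((surf n).prod (volume.restrict (Set.Ioi 0))) := by
      refine ⟨hmeas.aestronglyMeasurable, ?_⟩
      rw [HasFiniteIntegral, lintegral_prod _ hmeas.enorm.aemeasurable]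
      have hle : ∀ η, ∫⁻ a in Set.Ioi 0, ‖Function.uncurry (fun (η : USphere n) (a : ℝ) =>
          a ^ (α - 1) • (transKernel t v ξ η • transportC s G (v, η) a)) (η, a)‖ₑ ≤
          ENNReal.ofReal C * fracAbs s α G (v, η) := by
        intro η
        unfold fracAbs
        rw [← lintegral_const_mul]
        · refine setLIntegral_mono' measurableSet_Ioi fun a ha => ?_
          have ha : 0 < a := ha
          simp only [Function.uncurry_apply_pair]
          rw [enorm_smul, enorm_smul, Real.enorm_eq_ofReal (transKernel_nonneg _ _ _ _),
            Real.enorm_eq_ofReal (by positivity), mul_left_comm]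
          refine mul_le_mul' (ENNReal.ofReal_le_ofReal ?_)
            (mul_le_mul_right (enorm_transportC_le s G (v, η) a) _)
          exact (le_abs_self _).trans (hC η (Set.mem_univ _))
        · exact (by fun_prop : Measurable fun a : ℝ => ENNReal.ofReal (a ^ (α - 1))).mul
            (measurable_transport_time s hG.measurable.enorm (v, η))
      refine (lintegral_mono hle).trans_lt ?_
      rw [lintegral_const_mul]
      · exact ENNReal.mul_lt_top ENNReal.ofReal_lt_top hfin'.lt_top
      · exact (measurable_fracAbs s α hG.measurable).comp (by fun_prop : Measurable fun η => (v, η))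
    rw [hiter, integral_integral_swap hprod]
    congr 1
    refine integral_congr_ae ?_
    have hsl := (quasiMeasurePreserving_time hs v).ae hG.ae_integrable_slice
    filter_upwards [ae_restrict_mem measurableSet_Ioi, ae_restrict_of_ae hsl] with a ha h1
    rw [integral_smul]
    congr 1
    have hadd : v - s * a = t - s * (a + b) := by rw [hvdef]; ring
    exact transportC_transportC hn hs hG.measurable ξ ha hb hv (by rw [← hadd]; exact h1)
  · rw [transportC_eq_zero (z := (t, ξ)) fun h => hv h.2]
    have : ∀ a ∈ Set.Ioi (0 : ℝ), a ^ (α - 1) • transportC s G (t, ξ) (a + b) = 0 := by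
      intro a ha
      have ha : 0 < a := ha
      rw [transportC_eq_zero, smul_zero]
      intro h
      apply hv
      have h2 : 0 < t - s * (a + b) := h.2
      rcases hs with rfl | rfl <;> linarith
    rw [setIntegral_congr_fun measurableSet_Ioi this]
    simp

/-- Localization: G is integrable only over compact ranges of t > 0, so it is cut off to (1/(k+1),
k+1). For small times the transported slice stays in that interval, and the cut-off is not seen. -/
theorem FracDensity.ae_lebesgue_point (hn : 0 < n) (hs : s = 1 ∨ s = -1)
    (hG : FracDensity s α G) :
    ∀ᵐ z ∂((volume : Measure ℝ).prod (surf n)), 0 < z.1 → ∀ ω : ℝ, 0 < ω →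
      ∃ T > 0, ∀ b, 0 < b → b ≤ T →
      ∫⁻ a in Set.Ioc 0 b, ‖transportC s G z a - G z‖ₑ ≤
        ENNReal.ofReal ω * ENNReal.ofReal b := by
  set I : ℕ → Set ℝ := fun k => Set.Ioo (1 / ((k : ℝ) + 1)) (k + 1) with hI
  have hmI : ∀ k, MeasurableSet (I k ×ˢ (Set.univ : Set (USphere n))) := fun k =>
    measurableSet_Ioo.prod MeasurableSet.univ
  have h1 := fun k : ℕ => SphFrac.ae_lebesgue_point hn hs
    (G := (I k ×ˢ Set.univ).indicator G) (hG.measurable.indicator (hmI k))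
    ((integrable_indicator_iff (hmI k)).2 (hG.integrable_local _ _ (by positivity)))
  filter_upwards [ae_all_iff.2 h1] with z hz hz0 ω hω
  obtain ⟨k, hk⟩ : ∃ k : ℕ, z.1 ∈ I k := by
    obtain ⟨k, hk⟩ := exists_nat_gt (max z.1 (1 / z.1))
    refine ⟨k, ?_, ?_⟩
    · rw [div_lt_comm₀ (by positivity) hz0]
      exact (le_max_right _ _).trans_lt (hk.trans (by linarith))
    · exact (le_max_left _ _).trans_lt (hk.trans (by linarith))
  obtain ⟨T, hT, h⟩ := hz k hz0 ω hω
  have hev : ∀ᶠ a in 𝓝[>] (0 : ℝ), z.1 - s * a ∈ I k :=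
    (tendsto_time hs z.1).1.eventually (isOpen_Ioo.mem_nhds hk)
  obtain ⟨T', hT'0, hT'⟩ := (mem_nhdsGT_iff_exists_Ioc_subset).1 hev
  refine ⟨min T T', lt_min hT hT'0, fun b hb0 hb => ?_⟩
  refine le_trans (le_of_eq ?_) (h b hb0 (hb.trans (min_le_left _ _)))
  refine setLIntegral_congr_fun measurableSet_Ioc fun a ha => ?_
  have ha' : z.1 - s * a ∈ I k := hT' ⟨ha.1, ha.2.trans (hb.trans (min_le_right _ _))⟩
  have e1 : (I k ×ˢ (Set.univ : Set (USphere n))).indicator G z = G z :=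
    Set.indicator_of_mem (show z ∈ I k ×ˢ Set.univ from ⟨hk, Set.mem_univ _⟩) _
  have e2 : transportC s ((I k ×ˢ (Set.univ : Set (USphere n))).indicator G) z a =
      transportC s G z a := by
    unfold transportC
    congr 1
    funext η
    rw [Set.indicator_of_mem (show (z.1 - s * a, η) ∈ I k ×ˢ Set.univ from ⟨ha', Set.mem_univ _⟩)]
  simp only [e1, e2]

/-- The fractional integral of `G` is integrable over almost every parallel. -/
theorem FracDensity.integrable_fracInt (hn : 0 < n) (hG : FracDensity s α G)
    (hF : ∀ z : ℝ × USphere n, 0 < z.1 → fracAbs s α G z ≠ ∞ →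
      F z = (Real.Gamma α)⁻¹ • ∫ a in Set.Ioi 0, a ^ (α - 1) • transportC s G z a) :
    ∀ᵐ t : ℝ, 0 < t → Integrable (fun ξ => F (t, ξ)) (surf n) := by
  filter_upwards [hG.ae_lintegral_fracAbs_ne_top hn] with t ht ht0
  have hfin := ht ht0
  have hae := ae_fracAbs_lt_top hG.measurable hfin
  set F' : USphere n → ℂ := fun ξ =>
    (Real.Gamma α)⁻¹ • ∫ a in Set.Ioi 0, a ^ (α - 1) • transportC s G (t, ξ) a with hF'
  have hm1 : Measurable fun w : USphere n × ℝ => w.2 ^ (α - 1) := by fun_prop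
  have hH : StronglyMeasurable fun w : USphere n × ℝ => transportC s G (t, w.1) w.2 :=
    (stronglyMeasurable_transportC_uncurry s hG.measurable).comp_measurable
      (by fun_prop : Measurable fun w : USphere n × ℝ => (w.2, (t, w.1)))
  have hm2 : StronglyMeasurable fun w : USphere n × ℝ =>
      w.2 ^ (α - 1) • transportC s G (t, w.1) w.2 := hm1.stronglyMeasurable.smul hH
  have hm3 : StronglyMeasurable fun ξ : USphere n =>
      ∫ a in Set.Ioi 0, a ^ (α - 1) • transportC s G (t, ξ) a :=
    hm2.integral_prod_right' (ν := volume.restrict (Set.Ioi 0))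
  have hF'm : StronglyMeasurable F' := by
    have h := hm3.const_smul (Real.Gamma α)⁻¹
    exact h
  have hF'i : Integrable F' (surf n) := by
    refine ⟨hF'm.aestronglyMeasurable, ?_⟩
    rw [HasFiniteIntegral]
    have hle : ∀ ξ, ‖F' ξ‖ₑ ≤ ‖(Real.Gamma α)⁻¹‖ₑ * fracAbs s α G (t, ξ) := fun ξ => by
      simp only [hF']
      rw [enorm_smul]
      gcongr
      exact enorm_setIntegral_transportC_le (t, ξ)
    refine (lintegral_mono hle).trans_lt ?_
    rw [lintegral_const_mul]
    · exact ENNReal.mul_lt_top enorm_lt_top hfin.lt_top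
    · exact (measurable_fracAbs s α hG.measurable).comp (by fun_prop : Measurable fun η => (t, η))
  refine hF'i.congr ?_
  filter_upwards [hae] with ξ hξ using (hF (t, ξ) ht0 hξ.ne).symm

theorem FracDensity.ae_fracAbs_ne_top (hn : 0 < n) (hG : FracDensity s α G) :
    ∀ᵐ z ∂((volume : Measure ℝ).prod (surf n)), 0 < z.1 → fracAbs s α G z ≠ ∞ := by
  have hms : MeasurableSet {z : ℝ × USphere n | 0 < z.1 → fracAbs s α G z ≠ ∞} := by
    have h1 : MeasurableSet {z : ℝ × USphere n | 0 < z.1} :=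
      measurableSet_lt measurable_const measurable_fst
    have h2 : MeasurableSet {z : ℝ × USphere n | fracAbs s α G z = ∞} :=
      measurable_fracAbs s α hG.measurable (measurableSet_singleton ∞)
    have h3 : {z : ℝ × USphere n | 0 < z.1 → fracAbs s α G z ≠ ∞} =
        {z : ℝ × USphere n | 0 < z.1}ᶜ ∪ {z : ℝ × USphere n | fracAbs s α G z = ∞}ᶜ := by
      ext z
      simp only [Set.mem_ofPred_eq, Set.mem_union, Set.mem_compl_iff]
      tauto
    rw [h3]
    exact h1.compl.union h2.compl
  rw [Measure.ae_prod_iff_ae_ae hms]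
  filter_upwards [hG.ae_lintegral_fracAbs_ne_top hn] with t ht
  by_cases ht0 : 0 < t
  · filter_upwards [ae_fracAbs_lt_top hG.measurable (ht ht0)] with ξ hξ _ using hξ.ne
  · exact Eventually.of_forall fun ξ h => absurd h ht0

/-- Inversion of the fractional integral of `G` by truncated Marchaud derivatives. -/
theorem FracDensity.inversion (hn : 0 < n) (hs : s = 1 ∨ s = -1) (hα : 0 < α) {ℓ : ℕ}
    (hℓ : α < ℓ) (hG : FracDensity s α G)
    (hF : ∀ z : ℝ × USphere n, 0 < z.1 → fracAbs s α G z ≠ ∞ →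
      F z = (Real.Gamma α)⁻¹ • ∫ a in Set.Ioi 0, a ^ (α - 1) • transportC s G z a) :
    ∀ᵐ z ∂((volume : Measure ℝ).prod (surf n)), 0 < z.1 →
      (∀ ε : ℝ, 0 < ε → IntegrableOn (marchaudIntegrand α ℓ (orbitFun s F z)) (Set.Ioi ε)) ∧
      Tendsto (fun ε : ℝ => ∫ τ in Set.Ioi ε, marchaudIntegrand α ℓ (orbitFun s F z) τ) (𝓝[>] 0)
        (𝓝 (kappa α ℓ • G z)) := by
  filter_upwards [hG.ae_fracAbs_ne_top hn, hG.ae_lebesgue_point hn hs] with z h1 h2 hz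
  have hHm := stronglyMeasurable_transportC s hG.measurable z
  have hH := integrableOn_transportC hG.measurable (h1 hz)
  have h0 : orbitFun s F z 0 =
      (Real.Gamma α)⁻¹ • ∫ a in Set.Ioi 0, a ^ (α - 1) • transportC s G z a := by
    rw [orbitFun, if_pos rfl, hF z hz (h1 hz)]
  have hh : ∀ᵐ b ∂(volume.restrict (Set.Ioi (0 : ℝ))), orbitFun s F z (-b) =
      (Real.Gamma α)⁻¹ • ∫ a in Set.Ioi 0, plusPow (a - b) (α - 1) • transportC s G z a := by
    -- The representation of U_b F needs finite absolute mass on the slice t - s b. Since b ↦ t - s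
    -- b is nonsingular, this holds for almost every b, as `marchaud_eq_average` requires.
    have h3 := (quasiMeasurePreserving_time hs z.1).ae (hG.ae_lintegral_fracAbs_ne_top hn)
    filter_upwards [ae_restrict_mem measurableSet_Ioi, ae_restrict_of_ae h3] with b hb h4
    have hb : 0 < b := hb
    rw [orbitFun, if_neg (by linarith), neg_neg]
    exact hG.transportC_fracInt hn hs hF hz hb z.2 h4
  exact ⟨fun ε hε => (marchaud_eq_average hα ℓ hHm hH h0 hh hε).1,
    tendsto_marchaud hα hℓ hHm hH (h2 hz) h0 hh⟩

end Core

/-! ### Polar coordinates on the sphere -/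

theorem lintegral_eq_polar {d : ℕ} (hd : 0 < d) {g : EuclideanSpace ℝ (Fin d) → ℝ≥0∞}
    (hg : Measurable g) :
    ∫⁻ x, g x = ∫⁻ r in Set.Ioi (0 : ℝ), ENNReal.ofReal (r ^ (d - 1)) *
      ∫⁻ ξ : USphere d, g (r • (ξ : EuclideanSpace ℝ (Fin d))) ∂(surf d) := by
  have : NeZero d := ⟨hd.ne'⟩
  have hmp := (volume : Measure (EuclideanSpace ℝ (Fin d))).measurePreserving_homeomorphUnitSphereProd
  have hm : Measurable fun y : USphere d × Set.Ioi (0 : ℝ) =>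
      g ((y.2 : ℝ) • (y.1 : EuclideanSpace ℝ (Fin d))) := hg.comp (by fun_prop)
  have h1 := hmp.lintegral_comp_emb (Homeomorph.measurableEmbedding _)
    (fun y => g ((y.2 : ℝ) • (y.1 : EuclideanSpace ℝ (Fin d))))
  have h2 : ∀ x : ({0}ᶜ : Set (EuclideanSpace ℝ (Fin d))),
      g (((homeomorphUnitSphereProd (EuclideanSpace ℝ (Fin d)) x).2 : ℝ) •
        ((homeomorphUnitSphereProd (EuclideanSpace ℝ (Fin d)) x).1 : EuclideanSpace ℝ (Fin d))) =
      g x := fun x => by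
    rw [← homeomorphUnitSphereProd_symm_apply_coe, Homeomorph.symm_apply_apply]
  simp only [h2] at h1
  rw [lintegral_subtype_comap (measurableSet_singleton _).compl,
    restrict_compl_singleton] at h1
  have hm' : Measurable fun r : ℝ => ∫⁻ ξ : USphere d, g (r • (ξ : EuclideanSpace ℝ (Fin d)))
      ∂(surf d) :=
    (hg.comp (by fun_prop : Measurable fun y : ℝ × USphere d =>
      y.1 • (y.2 : EuclideanSpace ℝ (Fin d)))).lintegral_prod_right'
  rw [h1, lintegral_prod_symm' _ hm, Measure.volumeIoiPow]
  refine (lintegral_withDensity_eq_lintegral_mul _ (by fun_prop)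
    (hm'.comp measurable_subtype_coe)).trans ?_
  simp only [Pi.mul_apply, finrank_euclideanSpace_fin]
  exact lintegral_subtype_comap measurableSet_Ioi (fun r : ℝ => ENNReal.ofReal (r ^ (d - 1)) *
      ∫⁻ ξ : USphere d, g (r • (ξ : EuclideanSpace ℝ (Fin d))) ∂(surf d))

/-- The point `(y, z)` of `ℝ^n × ℝ = ℝ^{n+1}`. -/
def snocPoint {n : ℕ} (y : EuclideanSpace ℝ (Fin n)) (z : ℝ) : EuclideanSpace ℝ (Fin (n + 1)) :=
  WithLp.toLp 2 (Fin.snoc (α := fun _ => ℝ) (fun i => y i) z)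

theorem continuous_snocPoint {n : ℕ} :
    Continuous fun w : EuclideanSpace ℝ (Fin n) × ℝ => snocPoint w.1 w.2 := by
  refine (PiLp.continuous_toLp 2 _).comp (continuous_pi fun i => ?_)
  refine Fin.lastCases ?_ (fun i => ?_) i
  · simpa using continuous_snd
  · simp only [Fin.snoc_castSucc]
    fun_prop

theorem lintegral_eq_lintegral_snocPoint {n : ℕ} {g : EuclideanSpace ℝ (Fin (n + 1)) → ℝ≥0∞}
    (hg : Measurable g) :
    ∫⁻ x, g x = ∫⁻ z : ℝ, ∫⁻ y : EuclideanSpace ℝ (Fin n), g (snocPoint y z) := by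
  have e1 := (PiLp.volume_preserving_toLp (Fin (n + 1))).lintegral_comp hg
  have e2 := ((volume_preserving_piFinSuccAbove (fun _ : Fin (n + 1) => ℝ)
    (Fin.last n)).symm _).lintegral_comp
    (hg.comp (PiLp.volume_preserving_toLp (Fin (n + 1))).measurable)
  rw [← e1]
  refine e2.symm.trans ?_
  rw [Measure.volume_eq_prod, lintegral_prod]
  · refine lintegral_congr fun z => ?_
    have hgm : Measurable fun y : EuclideanSpace ℝ (Fin n) => g (snocPoint y z) :=
      hg.comp (continuous_snocPoint.measurable.comp (measurable_id.prodMk measurable_const))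
    rw [← (PiLp.volume_preserving_toLp (Fin n)).lintegral_comp hgm]
    refine lintegral_congr fun y => ?_
    simp only [Function.comp_apply]
    congr 2
    exact Fin.insertNth_last' z y
  · exact ((hg.comp (PiLp.volume_preserving_toLp (Fin (n + 1))).measurable).comp
      (MeasurableEquiv.measurable _)).aemeasurable

theorem smul_polarPoint {n : ℕ} (ρ θ : ℝ) (ξ : USphere n) :
    ρ • (polarPoint θ ξ : EuclideanSpace ℝ (Fin (n + 1))) =
      snocPoint ((ρ * Real.sin θ) • (ξ : EuclideanSpace ℝ (Fin n))) (-(ρ * Real.cos θ)) := by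
  ext i
  refine Fin.lastCases ?_ (fun i => ?_) i
  · simp [polarPoint, snocPoint]
  · simp [polarPoint, snocPoint, mul_assoc]

theorem continuous_polarPoint {n : ℕ} :
    Continuous fun w : ℝ × USphere n => polarPoint w.1 w.2 := by
  refine Continuous.subtype_mk (f := fun w : ℝ × USphere n =>
    (polarPoint w.1 w.2 : EuclideanSpace ℝ (Fin (n + 1)))) ?_ _
  have h : (fun w : ℝ × USphere n => (polarPoint w.1 w.2 : EuclideanSpace ℝ (Fin (n + 1)))) =
      fun w => snocPoint (Real.sin w.1 • (w.2 : EuclideanSpace ℝ (Fin n))) (-Real.cos w.1) := by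
    funext w
    simpa using smul_polarPoint 1 w.1 w.2
  rw [h]
  exact continuous_snocPoint.comp (f := fun w : ℝ × USphere n =>
    (Real.sin w.1 • (w.2 : EuclideanSpace ℝ (Fin n)), -Real.cos w.1)) (by fun_prop)

theorem continuous_polarPoint_right {n : ℕ} (θ : ℝ) :
    Continuous fun ξ : USphere n => polarPoint θ ξ :=
  Continuous.comp (g := fun w : ℝ × USphere n => polarPoint w.1 w.2)
    (f := fun ξ : USphere n => (θ, ξ)) continuous_polarPoint (by fun_prop)

/-- The punctured open unit ball. -/
def puncturedBall (d : ℕ) : Set (EuclideanSpace ℝ (Fin d)) := {x | x ≠ 0 ∧ ‖x‖ < 1}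

open Classical in
/-- The function `x ↦ f(x / |x|)` on the punctured unit ball, extended by zero. -/
def puncturedCone {d : ℕ} (f : USphere d → ℝ≥0∞) (x : EuclideanSpace ℝ (Fin d)) : ℝ≥0∞ :=
  if h : x ∈ puncturedBall d then f ⟨‖x‖⁻¹ • x, by
    rw [mem_sphere_zero_iff_norm, norm_smul, norm_inv, norm_norm,
      inv_mul_cancel₀ (norm_ne_zero_iff.2 h.1)]⟩ else 0

theorem measurable_puncturedCone {d : ℕ} {f : USphere d → ℝ≥0∞} (hf : Measurable f) :
    Measurable (puncturedCone f) := by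
  classical
  have hS : MeasurableSet (puncturedBall d) :=
    (measurableSet_singleton _).compl.inter (measurableSet_lt measurable_norm measurable_const)
  have hF : Measurable fun x : puncturedBall d => (⟨‖x.1‖⁻¹ • x.1, by
      rw [mem_sphere_zero_iff_norm, norm_smul, norm_inv, norm_norm,
        inv_mul_cancel₀ (norm_ne_zero_iff.2 x.2.1)]⟩ : USphere d) :=
    Measurable.subtype_mk (by fun_prop)
  unfold puncturedCone
  exact Measurable.dite (hf.comp hF) (g := fun _ => 0) measurable_const hS

theorem puncturedCone_smul {d : ℕ} (f : USphere d → ℝ≥0∞) (r : ℝ) (x : USphere d) (hr : 0 < r) :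
    puncturedCone f (r • (x : EuclideanSpace ℝ (Fin d))) =
      (Set.Iio (1 : ℝ)).indicator 1 r * f x := by
  have hx : ‖(x : EuclideanSpace ℝ (Fin d))‖ = 1 := mem_sphere_zero_iff_norm.1 x.2
  have hx0 : (x : EuclideanSpace ℝ (Fin d)) ≠ 0 := by
    rw [← norm_ne_zero_iff, hx]; exact one_ne_zero
  have hnorm : ‖r • (x : EuclideanSpace ℝ (Fin d))‖ = r := by
    rw [norm_smul, hx, mul_one, Real.norm_of_nonneg hr.le]
  by_cases h1 : r < 1
  · rw [Set.indicator_of_mem (Set.mem_Iio.2 h1), Pi.one_apply, one_mul]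
    unfold puncturedCone
    rw [dif_pos ⟨smul_ne_zero hr.ne' hx0, by rwa [hnorm]⟩]
    congr 1
    apply Subtype.ext
    simp only [hnorm]
    rw [smul_smul, inv_mul_cancel₀ hr.ne', one_smul]
  · rw [Set.indicator_of_notMem (by simpa using h1), zero_mul]
    unfold puncturedCone
    rw [dif_neg fun h => h1 (by rw [← hnorm]; exact h.2)]

/-- Integration over `S^n` in the coordinates `(θ, ξ')`. -/
theorem lintegral_surf_eq_angle {n : ℕ} (hn : 0 < n) {f : USphere (n + 1) → ℝ≥0∞}
    (hf : Measurable f) :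
    ∫⁻ x, f x ∂(surf (n + 1)) = ∫⁻ θ in Set.Ioo 0 Real.pi, ENNReal.ofReal (Real.sin θ ^ (n - 1)) *
      ∫⁻ ξ, f (polarPoint θ ξ) ∂(surf n) := by
  set g := puncturedCone f with hgdef
  have hgm : Measurable g := measurable_puncturedCone hf
  have hgr := puncturedCone_smul f
  rw [← hgdef] at hgr
  clear_value g
  -- The integral of x ↦ f(x/|x|) over the unit ball is computed twice, each time with the factor c
  -- = ∫_0^1 r^n dr: in polar coordinates of ℝ^{n+1}, and as an iterated integral over ℝ × ℝ^n.
  -- Cancelling c gives the formula.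
  set c : ℝ≥0∞ := ∫⁻ r in Set.Ioi (0 : ℝ), ENNReal.ofReal (r ^ n) * (Set.Iio (1 : ℝ)).indicator 1 r
    with hc
  have hm1 : Measurable fun r : ℝ => ENNReal.ofReal (r ^ n) * (Set.Iio (1 : ℝ)).indicator 1 r :=
    (by fun_prop : Measurable fun r : ℝ => ENNReal.ofReal (r ^ n)).mul
      (measurable_one.indicator measurableSet_Iio)
  have hc_eq : c = ∫⁻ r in Set.Iio (1 : ℝ) ∩ Set.Ioi 0, ENNReal.ofReal (r ^ n) := by
    rw [hc, ← setLIntegral_indicator measurableSet_Iio]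
    refine lintegral_congr fun r => ?_
    by_cases hr : r ∈ Set.Iio (1 : ℝ)
    · simp [Set.indicator_of_mem hr]
    · simp [Set.indicator_of_notMem hr]
  have hset : Set.Iio (1 : ℝ) ∩ Set.Ioi 0 = Set.Ioo 0 1 := Set.Iio_inter_Ioi
  have hc0 : c ≠ 0 := by
    rw [hc_eq, hset, ← pos_iff_ne_zero, setLIntegral_pos_iff (by fun_prop)]
    have hsub : Set.Ioo (0 : ℝ) 1 ⊆
        (Function.support fun r : ℝ => ENNReal.ofReal (r ^ n)) ∩ Set.Ioo 0 1 := fun r hr =>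
      ⟨(ENNReal.ofReal_pos.2 (pow_pos hr.1 n)).ne', hr⟩
    refine lt_of_lt_of_le ?_ (measure_mono hsub)
    simp
  have hctop : c ≠ ∞ := by
    rw [hc_eq, hset]
    refine ne_of_lt (lt_of_le_of_lt (setLIntegral_mono' (g := fun _ => 1) measurableSet_Ioo
      fun r hr => ENNReal.ofReal_le_one.2 (pow_le_one₀ hr.1.le hr.2.le)) ?_)
    simp
  have key1 : ∫⁻ x, g x = c * ∫⁻ x, f x ∂(surf (n + 1)) := by
    rw [lintegral_eq_polar (Nat.succ_pos n) hgm, hc, ← lintegral_mul_const _ hm1]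
    refine setLIntegral_congr_fun measurableSet_Ioi fun r hr => ?_
    simp only [hgr r _ hr]
    rw [lintegral_const_mul _ hf, mul_assoc]
    rfl
  have key2 : ∫⁻ x, g x = c * ∫⁻ θ in Set.Ioo 0 Real.pi, ENNReal.ofReal (Real.sin θ ^ (n - 1)) *
      ∫⁻ ξ, f (polarPoint θ ξ) ∂(surf n) := by
    -- Here w = (-x_{n+1}, |horizontal part|); the sign makes the plane polar angle of w count from
    -- the south pole. The indicator restricts the angle from (-π, π) to (0, π).
    set Q : ℝ × ℝ → ℝ≥0∞ := fun w => (Set.Ioi (0 : ℝ)).indicator 1 w.2 *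
      (ENNReal.ofReal (w.2 ^ (n - 1)) * ∫⁻ ξ : USphere n,
        g (snocPoint (w.2 • (ξ : EuclideanSpace ℝ (Fin n))) (-w.1)) ∂(surf n)) with hQ
    have hQm : Measurable Q := by
      have h0 : Measurable fun w : ℝ × ℝ => (Set.Ioi (0 : ℝ)).indicator (1 : ℝ → ℝ≥0∞) w.2 :=
        (measurable_one.indicator measurableSet_Ioi).comp measurable_snd
      refine h0.mul ((by fun_prop : Measurable fun w : ℝ × ℝ =>
        ENNReal.ofReal (w.2 ^ (n - 1))).mul ?_)
      have h3 : Measurable fun w : (ℝ × ℝ) × USphere n =>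
          g (snocPoint (w.1.2 • (w.2 : EuclideanSpace ℝ (Fin n))) (-w.1.1)) :=
        hgm.comp (continuous_snocPoint.measurable.comp (f := fun w : (ℝ × ℝ) × USphere n =>
          (w.1.2 • (w.2 : EuclideanSpace ℝ (Fin n)), -w.1.1)) (by fun_prop))
      exact h3.lintegral_prod_right'
    have hgQ : ∫⁻ x, g x = ∫⁻ w, Q w := by
      rw [lintegral_eq_lintegral_snocPoint hgm, Measure.volume_eq_prod, lintegral_prod _ hQm.aemeasurable]
      rw [← lintegral_neg_eq_self]
      refine lintegral_congr fun z => ?_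
      have hgz : Measurable fun y : EuclideanSpace ℝ (Fin n) => g (snocPoint y (-z)) :=
        hgm.comp (continuous_snocPoint.measurable.comp (measurable_id.prodMk measurable_const))
      rw [lintegral_eq_polar hn hgz, ← lintegral_indicator measurableSet_Ioi]
      refine lintegral_congr fun r => ?_
      simp only [hQ]
      by_cases hr : r ∈ Set.Ioi (0 : ℝ)
      · rw [Set.indicator_of_mem hr, Set.indicator_of_mem hr, Pi.one_apply, one_mul]
      · rw [Set.indicator_of_notMem hr, Set.indicator_of_notMem hr, zero_mul]
    have hfm : Measurable fun θ => ∫⁻ ξ, f (polarPoint θ ξ) ∂(surf n) :=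
      (hf.comp continuous_polarPoint.measurable).lintegral_prod_right'
    have hm2 : Measurable fun θ : ℝ => ENNReal.ofReal (Real.sin θ ^ (n - 1)) *
      ∫⁻ ξ, f (polarPoint θ ξ) ∂(surf n) :=
      (by fun_prop : Measurable fun θ : ℝ => ENNReal.ofReal (Real.sin θ ^ (n - 1))).mul hfm
    rw [hgQ, ← lintegral_comp_polarCoord_symm, polarCoord_target, Measure.volume_eq_prod,
      ← Measure.prod_restrict, hc, ← lintegral_mul_const _ hm1, lintegral_prod]
    · refine setLIntegral_congr_fun measurableSet_Ioi fun ρ hρ => ?_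
      have hρ : 0 < ρ := hρ
      simp only [polarCoord_symm_apply]
      rw [← lintegral_const_mul _ hm2]
      have hset' : Set.Ioo 0 Real.pi ∩ Set.Ioo (-Real.pi) Real.pi = Set.Ioo 0 Real.pi :=
        Set.inter_eq_left.2 (Set.Ioo_subset_Ioo (by linarith [Real.pi_pos]) le_rfl)
      rw [← hset', ← setLIntegral_indicator measurableSet_Ioo]
      refine setLIntegral_congr_fun measurableSet_Ioo fun θ hθ' => ?_
      by_cases hθ : θ ∈ Set.Ioo 0 Real.pi
      · rw [Set.indicator_of_mem hθ]
        have hsin : 0 < Real.sin θ := Real.sin_pos_of_pos_of_lt_pi hθ.1 hθ.2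
        simp only [hQ]
        rw [Set.indicator_of_mem (show ρ * Real.sin θ ∈ Set.Ioi (0 : ℝ) from mul_pos hρ hsin)]
        simp only [← smul_polarPoint, hgr ρ _ hρ, Pi.one_apply, one_mul, smul_eq_mul]
        have hfθ : Measurable fun ξ => f (polarPoint θ ξ) :=
          hf.comp (continuous_polarPoint_right θ).measurable
        rw [lintegral_const_mul _ hfθ]
        · have : ENNReal.ofReal (ρ ^ n) = ENNReal.ofReal ρ * ENNReal.ofReal (ρ ^ (n - 1)) := by
            rw [← ENNReal.ofReal_mul hρ.le, ← pow_succ', Nat.sub_add_cancel hn]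
          rw [this, mul_pow, ENNReal.ofReal_mul (by positivity)]
          simp only [mul_assoc, mul_left_comm]
      · have hs : Real.sin θ ≤ 0 := by
          apply Real.sin_nonpos_of_nonpos_of_neg_pi_le _ hθ'.1.le
          by_contra h
          exact hθ ⟨not_le.1 h, hθ'.2⟩
        rw [Set.indicator_of_notMem hθ]
        simp only [hQ]
        rw [Set.indicator_of_notMem (by simpa using mul_nonpos_of_nonneg_of_nonpos hρ.le hs)]
        simp
    · refine Measurable.aemeasurable ?_
      exact (by fun_prop : Measurable fun w : ℝ × ℝ => ENNReal.ofReal w.1).mul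
        (hQm.comp continuous_polarCoord_symm.measurable)
  exact (ENNReal.mul_right_inj hc0 hctop).1 (key1.symm.trans key2)

/-! ### The coordinate `t = tan²(θ/2)` -/

/-- The point `(θ, ξ')` of `S^n` with `tan²(θ/2) = t`. -/
def tanPoint {n : ℕ} (z : ℝ × USphere n) : USphere (n + 1) :=
  polarPoint (2 * Real.arctan (Real.sqrt z.1)) z.2

theorem continuous_tanPoint {n : ℕ} : Continuous (tanPoint (n := n)) :=
  Continuous.comp (g := fun w : ℝ × USphere n => polarPoint w.1 w.2)
    (f := fun z : ℝ × USphere n => (2 * Real.arctan (Real.sqrt z.1), z.2)) continuous_polarPoint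
    (((continuous_const.mul
      (Real.continuous_arctan.comp (Real.continuous_sqrt.comp continuous_fst)))).prodMk
      continuous_snd)

theorem cos_two_mul_arctan_sqrt {t : ℝ} (ht : 0 ≤ t) :
    Real.cos (2 * Real.arctan (Real.sqrt t)) = (1 - t) / (1 + t) := by
  have h : (1 + t) ≠ 0 := by positivity
  rw [Real.cos_two_mul, Real.cos_sq_arctan, Real.sq_sqrt ht]
  field_simp
  ring

theorem sin_two_mul_arctan_sqrt {t : ℝ} (ht : 0 ≤ t) :
    Real.sin (2 * Real.arctan (Real.sqrt t)) = 2 * Real.sqrt t / (1 + t) := by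
  have h : (1 + t) ≠ 0 := by positivity
  have h2 : Real.sqrt (1 + t) ^ 2 = 1 + t := Real.sq_sqrt (by positivity)
  have h3 : Real.sqrt (1 + t) ≠ 0 := (Real.sqrt_pos.2 (by positivity)).ne'
  rw [Real.sin_two_mul, Real.sin_arctan, Real.cos_arctan, Real.sq_sqrt ht]
  field_simp
  rw [h2]

theorem two_mul_arctan_sqrt_mem {t : ℝ} (ht : 0 < t) :
    2 * Real.arctan (Real.sqrt t) ∈ Set.Ioo 0 Real.pi := by
  have h1 : 0 < Real.arctan (Real.sqrt t) := Real.arctan_pos.2 (Real.sqrt_pos.2 ht)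
  have h2 := Real.arctan_lt_pi_div_two (Real.sqrt t)
  constructor <;> linarith

section Coordinates

variable {n : ℕ} {t v : ℝ} {ξ η : USphere n}

theorem lastCoord_polarPoint (θ : ℝ) (ξ : USphere n) :
    lastCoord (polarPoint θ ξ) = -Real.cos θ := by
  simp [lastCoord, polarPoint]

theorem horiz_polarPoint (θ : ℝ) (ξ : USphere n) :
    horiz (polarPoint θ ξ) = Real.sin θ • (ξ : EuclideanSpace ℝ (Fin n)) := by
  ext i
  simp [horiz, polarPoint]

theorem lastCoord_tanPoint (ht : 0 ≤ t) (ξ : USphere n) :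
    lastCoord (tanPoint (t, ξ)) = (t - 1) / (t + 1) := by
  rw [tanPoint, lastCoord_polarPoint, cos_two_mul_arctan_sqrt ht, ← neg_div, neg_sub, add_comm]

theorem tanSq_tanPoint (ht : 0 < t) (ξ : USphere n) : tanSq (tanPoint (t, ξ)) = t := by
  have h := two_mul_arctan_sqrt_mem ht
  rw [tanSq, angle, tanPoint, lastCoord_polarPoint, neg_neg, Real.arccos_cos h.1.le h.2.le,
    mul_div_cancel_left₀ _ two_ne_zero, Real.tan_arctan, Real.sq_sqrt ht.le]

theorem norm_usphere {d : ℕ} (ξ : USphere d) : ‖(ξ : EuclideanSpace ℝ (Fin d))‖ = 1 :=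
  mem_sphere_zero_iff_norm.1 ξ.2

theorem direction_tanPoint (ht : 0 < t) (ξ : USphere n) :
    direction (tanPoint (t, ξ)) = (ξ : EuclideanSpace ℝ (Fin n)) := by
  have h := two_mul_arctan_sqrt_mem ht
  have hs : 0 < Real.sin (2 * Real.arctan (Real.sqrt t)) := Real.sin_pos_of_pos_of_lt_pi h.1 h.2
  rw [direction, tanPoint, horiz_polarPoint, norm_smul, norm_usphere, mul_one,
    Real.norm_of_nonneg hs.le, smul_smul, inv_mul_cancel₀ hs.ne', one_smul]

theorem injOn_tanPoint : Set.InjOn (tanPoint (n := n)) (Set.Ioi 0 ×ˢ Set.univ) := by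
  rintro ⟨t, ξ⟩ ht ⟨v, η⟩ hv h
  have ht : 0 < t := ht.1
  have hv : 0 < v := hv.1
  have h1 : t = v := by rw [← tanSq_tanPoint ht ξ, h, tanSq_tanPoint hv η]
  have h2 : ξ = η := Subtype.ext (by rw [← direction_tanPoint ht ξ, h, direction_tanPoint hv η])
  rw [h1, h2]

theorem norm_sq_eq_horiz_add_lastCoord (x y : USphere (n + 1)) :
    dist x y ^ 2 = ‖horiz x - horiz y‖ ^ 2 + (lastCoord x - lastCoord y) ^ 2 := by
  rw [Subtype.dist_eq, dist_eq_norm, EuclideanSpace.real_norm_sq_eq, EuclideanSpace.real_norm_sq_eq,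
    Fin.sum_univ_castSucc]
  simp [horiz, lastCoord]

theorem norm_smul_sub_smul_sq (a b : ℝ) (ξ η : USphere n) :
    ‖a • (ξ : EuclideanSpace ℝ (Fin n)) - b • (η : EuclideanSpace ℝ (Fin n))‖ ^ 2 =
      a ^ 2 + b ^ 2 - 2 * a * b * inner ℝ (ξ : EuclideanSpace ℝ (Fin n)) η := by
  rw [norm_sub_sq_real, norm_smul, norm_smul, norm_usphere, norm_usphere, inner_smul_left,
    inner_smul_right]
  simp only [mul_one, Real.norm_eq_abs, sq_abs, conj_trivial]
  ring

/-- The chordal distance formula of stereographic projection, 4 |X - Y|² / ((1 + |X|²)(1 + |Y|²)),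
with X = √t ξ and Y = √v η. -/
theorem dist_tanPoint_sq (ht : 0 ≤ t) (hv : 0 ≤ v) :
    dist (tanPoint (t, ξ)) (tanPoint (v, η)) ^ 2 =
      4 / ((1 + t) * (1 + v)) *
      ‖Real.sqrt t • (ξ : EuclideanSpace ℝ (Fin n)) -
        Real.sqrt v • (η : EuclideanSpace ℝ (Fin n))‖ ^ 2 := by
  rw [norm_sq_eq_horiz_add_lastCoord, lastCoord_tanPoint ht, lastCoord_tanPoint hv]
  simp only [tanPoint, horiz_polarPoint]
  rw [norm_smul_sub_smul_sq, norm_smul_sub_smul_sq, sin_two_mul_arctan_sqrt ht,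
    sin_two_mul_arctan_sqrt hv, div_pow, div_pow, mul_pow, mul_pow, Real.sq_sqrt ht,
    Real.sq_sqrt hv]
  have h1 : (1 + t) ≠ 0 := by positivity
  have h2 : (1 + v) ≠ 0 := by positivity
  rw [add_comm t 1, add_comm v 1]
  field_simp
  ring

end Coordinates

/-- The density of the surface measure of `S^n` in the coordinates `(t, ξ')`. -/
def tanDensity (n : ℕ) (t : ℝ) : ℝ :=
  2 ^ ((n : ℝ) - 1) * t ^ ((n : ℝ) / 2 - 1) * (1 + t) ^ (-(n : ℝ))

theorem measurable_tanDensity (n : ℕ) : Measurable (tanDensity n) := by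
  unfold tanDensity
  fun_prop

theorem tanDensity_pos (n : ℕ) {t : ℝ} (ht : 0 < t) : 0 < tanDensity n t := by
  unfold tanDensity
  positivity

theorem hasDerivAt_two_mul_arctan_sqrt {t : ℝ} (ht : 0 < t) :
    HasDerivAt (fun t => 2 * Real.arctan (Real.sqrt t)) (1 / ((1 + t) * Real.sqrt t)) t := by
  have h := ((Real.hasDerivAt_sqrt ht.ne').arctan).const_mul 2
  rw [Real.sq_sqrt ht.le] at h
  have : 0 < Real.sqrt t := Real.sqrt_pos.2 ht
  have e : 1 / ((1 + t) * Real.sqrt t) = 2 * (1 / (1 + t) * (1 / (2 * Real.sqrt t))) := by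
    field_simp
  rw [e]
  exact h

theorem image_two_mul_arctan_sqrt :
    (fun t => 2 * Real.arctan (Real.sqrt t)) '' Set.Ioi 0 = Set.Ioo 0 Real.pi := by
  ext θ
  constructor
  · rintro ⟨t, ht, rfl⟩
    exact two_mul_arctan_sqrt_mem ht
  · intro hθ
    have h1 : 0 < Real.tan (θ / 2) :=
      Real.tan_pos_of_pos_of_lt_pi_div_two (by linarith [hθ.1]) (by linarith [hθ.2])
    refine ⟨Real.tan (θ / 2) ^ 2, by simp only [Set.mem_Ioi]; positivity, ?_⟩
    simp only
    rw [Real.sqrt_sq h1.le, Real.arctan_tan (by linarith [hθ.1, Real.pi_pos]) (by linarith [hθ.2])]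
    ring

theorem injOn_two_mul_arctan_sqrt :
    Set.InjOn (fun t => 2 * Real.arctan (Real.sqrt t)) (Set.Ioi 0) := by
  intro t ht v hv h
  have h1 : Real.sqrt t = Real.sqrt v := Real.arctan_injective (by simpa using h)
  exact (Real.sqrt_inj (le_of_lt ht) (le_of_lt hv)).1 h1

theorem tanDensity_eq {n : ℕ} (hn : 0 < n) {t : ℝ} (ht : 0 < t) :
    tanDensity n t = |1 / ((1 + t) * Real.sqrt t)| *
      Real.sin (2 * Real.arctan (Real.sqrt t)) ^ (n - 1) := by
  have h1 : 0 < 1 + t := by positivity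
  have hs : 0 < Real.sqrt t := Real.sqrt_pos.2 ht
  rw [abs_of_pos (by positivity), sin_two_mul_arctan_sqrt ht.le, ← Real.rpow_natCast,
    Nat.cast_sub hn, Nat.cast_one, Real.div_rpow (by positivity) h1.le,
    Real.mul_rpow two_pos.le hs.le, tanDensity, Real.sqrt_eq_rpow, ← Real.rpow_mul ht.le]
  have e1 : t ^ ((n : ℝ) / 2 - 1) = t ^ (1 / 2 * ((n : ℝ) - 1)) / t ^ (1 / 2 : ℝ) := by
    rw [← Real.rpow_sub ht]; congr 1; ring
  have e2 : (1 + t) ^ (-(n : ℝ)) = 1 / ((1 + t) * (1 + t) ^ ((n : ℝ) - 1)) := by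
    rw [← Real.rpow_one_add' h1.le (by simp; omega), Real.rpow_neg h1.le]
    simp
  rw [e1, e2]
  have : 0 < t ^ (1 / 2 : ℝ) := by positivity
  have : 0 < (1 + t) ^ ((n : ℝ) - 1) := by positivity
  field_simp

/-- Integration over `S^n` in the coordinates `(t, ξ')`. -/
theorem lintegral_surf_eq_tan {n : ℕ} (hn : 0 < n) {f : USphere (n + 1) → ℝ≥0∞}
    (hf : Measurable f) :
    ∫⁻ x, f x ∂(surf (n + 1)) = ∫⁻ t in Set.Ioi (0 : ℝ), ENNReal.ofReal (tanDensity n t) *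
      ∫⁻ ξ, f (tanPoint (t, ξ)) ∂(surf n) := by
  rw [lintegral_surf_eq_angle hn hf, ← image_two_mul_arctan_sqrt,
    lintegral_image_eq_lintegral_abs_deriv_mul measurableSet_Ioi
      (fun t ht => (hasDerivAt_two_mul_arctan_sqrt ht).hasDerivWithinAt)
      injOn_two_mul_arctan_sqrt]
  refine setLIntegral_congr_fun measurableSet_Ioi fun t ht => ?_
  rw [tanDensity_eq hn ht, ENNReal.ofReal_mul (abs_nonneg _), mul_assoc]
  rfl

/-- The surface measure of `S^n` in the coordinates `(t, ξ')`. -/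
def tanMeasure (n : ℕ) : Measure (ℝ × USphere n) :=
  ((volume.restrict (Set.Ioi 0)).prod (surf n)).withDensity
    fun z => ENNReal.ofReal (tanDensity n z.1)

theorem measurable_ofReal_tanDensity (n : ℕ) :
    Measurable fun z : ℝ × USphere n => ENNReal.ofReal (tanDensity n z.1) :=
  ((measurable_tanDensity n).comp measurable_fst).ennreal_ofReal

theorem lintegral_tanMeasure {n : ℕ} {f : ℝ × USphere n → ℝ≥0∞} (hf : Measurable f) :
    ∫⁻ z, f z ∂(tanMeasure n) = ∫⁻ t in Set.Ioi (0 : ℝ), ENNReal.ofReal (tanDensity n t) *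
      ∫⁻ ξ, f (t, ξ) ∂(surf n) := by
  have hd := measurable_ofReal_tanDensity n
  rw [tanMeasure, lintegral_withDensity_eq_lintegral_mul _ hd hf,
    lintegral_prod _ (hd.mul hf).aemeasurable]
  refine lintegral_congr fun t => ?_
  simp only [Pi.mul_apply]
  rw [lintegral_const_mul]
  exact hf.comp (measurable_const.prodMk measurable_id)

theorem map_tanPoint {n : ℕ} (hn : 0 < n) : (tanMeasure n).map tanPoint = surf (n + 1) := by
  refine Measure.ext_of_lintegral _ fun f hf => ?_
  rw [lintegral_map hf continuous_tanPoint.measurable, lintegral_surf_eq_tan hn hf]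
  exact lintegral_tanMeasure (hf.comp continuous_tanPoint.measurable)

theorem tanMeasure_absolutelyContinuous (n : ℕ) :
    tanMeasure n ≪ (volume : Measure ℝ).prod (surf n) := by
  refine (withDensity_absolutelyContinuous _ _).trans ?_
  refine Measure.AbsolutelyContinuous.prod ?_ (Measure.AbsolutelyContinuous.refl _)
  exact Measure.absolutelyContinuous_of_le Measure.restrict_le_self

theorem ae_tanMeasure_pos (n : ℕ) : ∀ᵐ z ∂(tanMeasure n), 0 < z.1 := by
  refine (withDensity_absolutelyContinuous _ _).ae_le ?_
  have h : ∀ᵐ t ∂((volume : Measure ℝ).restrict (Set.Ioi 0)), 0 < t :=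
    ae_restrict_mem measurableSet_Ioi
  exact Measure.quasiMeasurePreserving_fst.ae h

/-- Properties that hold almost everywhere in the coordinates `(t, ξ')` hold almost everywhere
on `S^n`. -/
theorem ae_surf_of_ae_tanPoint {n : ℕ} (hn : 0 < n) {P : USphere (n + 1) → Prop}
    (h : ∀ᵐ z ∂((volume : Measure ℝ).prod (surf n)), 0 < z.1 → P (tanPoint z)) :
    ∀ᵐ x ∂(surf (n + 1)), P x := by
  -- P need not be measurable, so the exceptional set is enlarged to a measurable null set. The
  -- image of the complement is measurable because the coordinate map is injective there.
  obtain ⟨A, hA, hAm, hA0⟩ := exists_measurable_superset_of_null (ae_iff.1 h)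
  set B : Set (ℝ × USphere n) := Aᶜ ∩ (Set.Ioi 0 ×ˢ Set.univ) with hB
  have hBm : MeasurableSet B := hAm.compl.inter (measurableSet_Ioi.prod MeasurableSet.univ)
  have hB' : MeasurableSet (tanPoint '' B) :=
    hBm.image_of_measurable_injOn continuous_tanPoint.measurable
      (injOn_tanPoint.mono Set.inter_subset_right)
  have hsub : ∀ x ∈ tanPoint '' B, P x := by
    rintro _ ⟨z, hz, rfl⟩
    by_contra hP
    exact hz.1 (hA (by
      simp only [Set.mem_ofPred_eq]
      exact fun h' => hP (h' hz.2.1)))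
  have hae : ∀ᵐ x ∂(surf (n + 1)), x ∈ tanPoint '' B := by
    rw [← map_tanPoint hn]
    refine (ae_map_iff (p := fun x => x ∈ tanPoint '' B)
      continuous_tanPoint.measurable.aemeasurable hB').2 ?_
    have hA0' : ∀ᵐ z ∂(tanMeasure n), z ∉ A :=
      (tanMeasure_absolutelyContinuous n).ae_le (measure_eq_zero_iff_ae_notMem.1 hA0)
    filter_upwards [hA0', ae_tanMeasure_pos n] with z h1 h2
    exact ⟨z, ⟨h1, h2, Set.mem_univ _⟩, rfl⟩
  filter_upwards [hae] with x hx using hsub x hx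

/-- Almost all `t > 0` correspond to almost all angles. -/
theorem ae_angle_of_ae_tan {P : ℝ → Prop}
    (h : ∀ᵐ t : ℝ, 0 < t → P (2 * Real.arctan (Real.sqrt t))) :
    ∀ᵐ θ ∂(volume.restrict (Set.Ioo 0 Real.pi)), P θ := by
  rw [ae_restrict_iff' measurableSet_Ioo, ae_iff]
  have h0 : volume ({t : ℝ | ¬ (0 < t → P (2 * Real.arctan (Real.sqrt t)))}) = 0 := ae_iff.1 h
  -- Differentiable maps of the line send null sets to null sets.
  have h1 := addHaar_image_eq_zero_of_differentiableOn_of_addHaar_eq_zero volume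
    (f := fun t => 2 * Real.arctan (Real.sqrt t))
    (s := {t : ℝ | ¬ (0 < t → P (2 * Real.arctan (Real.sqrt t)))})
    (fun t ht => ((hasDerivAt_two_mul_arctan_sqrt (by
      by_contra h'
      exact ht fun h'' => absurd h'' h')).differentiableAt).differentiableWithinAt) h0
  refine measure_mono_null ?_ h1
  intro θ hθ
  simp only [Set.mem_ofPred_eq, Classical.not_imp] at hθ
  obtain ⟨t, ht, rfl⟩ : θ ∈ (fun t => 2 * Real.arctan (Real.sqrt t)) '' Set.Ioi 0 := by
    rw [image_two_mul_arctan_sqrt]; exact hθ.1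
  refine ⟨t, ?_, rfl⟩
  simp only [Set.mem_ofPred_eq, Classical.not_imp]
  exact ⟨ht, hθ.2⟩

/-! ### Spherical fractional integrals in the coordinates `(t, ξ')` -/

/-- The two admissible pairs of a sign `s` and an exponent `β`: `s = 1`, `β = n/2 - 1` for the
left-sided integrals and `s = -1`, `β = 0` for the right-sided ones. -/
def IsSide (n : ℕ) (s β : ℝ) : Prop :=
  (s = 1 ∧ β = (n : ℝ) / 2 - 1) ∨ (s = -1 ∧ β = 0)

theorem IsSide.sign {n : ℕ} {s β : ℝ} (h : IsSide n s β) : s = 1 ∨ s = -1 :=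
  h.imp And.left And.left

/-- The integrand of the left-sided (`s = 1`) or right-sided (`s = -1`) fractional integral,
extended by zero. -/
def sideIntegrand {n : ℕ} (s α : ℝ) (φ : USphere (n + 1) → ℂ) (x y : USphere (n + 1)) : ℂ :=
  if 0 < s * (lastCoord x - lastCoord y) then
    ((s * (lastCoord x - lastCoord y)) ^ α / dist x y ^ n) • φ y
  else 0

/-- The left-sided (`s = 1`) or right-sided (`s = -1`) fractional integral. -/
def sideInt {n : ℕ} (s α : ℝ) (φ : USphere (n + 1) → ℂ) (x : USphere (n + 1)) : ℂ :=
  (2 / (Real.Gamma α * sphereArea n)) • ∫ y, sideIntegrand s α φ x y ∂(surf (n + 1))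

/-- The density that corresponds to `φ` on the half-line of the coordinate `t`. -/
def tanWeighted {n : ℕ} (β α : ℝ) (φ : USphere (n + 1) → ℂ) (z : ℝ × USphere n) : ℂ :=
  if 0 < z.1 then (2 ^ α * (1 + z.1) ^ (-α - (n : ℝ) / 2) * z.1 ^ β) • φ (tanPoint z) else 0

section Kernel

variable {n : ℕ} {s β α t v : ℝ} {ξ η : USphere n}

theorem norm_sqrt_smul_sub (ht : 0 < t) (hv : 0 < v) :
    ‖√t • (ξ : EuclideanSpace ℝ (Fin n)) - √v • (η : EuclideanSpace ℝ (Fin n))‖ =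
      √(max t v) * ‖√(min t v / max t v) • (ξ : EuclideanSpace ℝ (Fin n)) - η‖ := by
  have hmax : 0 < max t v := lt_max_of_lt_left ht
  have hmin : 0 < min t v := lt_min ht hv
  rw [← sq_eq_sq₀ (norm_nonneg _) (by positivity), mul_pow, norm_smul_sub_smul_sq]
  have h1 := norm_smul_sub_smul_sq (√(min t v / max t v)) 1 ξ η
  rw [one_smul] at h1
  rw [h1, Real.sq_sqrt ht.le, Real.sq_sqrt hv.le, Real.sq_sqrt hmax.le,
    Real.sq_sqrt (by positivity)]
  have h2 : √t * √v = max t v * √(min t v / max t v) := by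
    rw [← Real.sqrt_mul ht.le, ← min_mul_max, Real.sqrt_div hmin.le, Real.sqrt_mul hmin.le]
    have h3 : √(max t v) * √(max t v) = max t v := Real.mul_self_sqrt hmax.le
    have h4 : 0 < √(max t v) := Real.sqrt_pos.2 hmax
    nth_rewrite 2 [← h3]
    field_simp
  have h5 : t + v = min t v + max t v := (min_add_max t v).symm
  have h6 : max t v * (min t v / max t v) = min t v := by field_simp
  calc t + v - 2 * √t * √v * inner ℝ (ξ : EuclideanSpace ℝ (Fin n)) η
      = min t v + max t v -
        2 * (√t * √v) * inner ℝ (ξ : EuclideanSpace ℝ (Fin n)) η := by rw [h5]; ring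
    _ = max t v * (min t v / max t v) + max t v -
        2 * (max t v * √(min t v / max t v)) * inner ℝ (ξ : EuclideanSpace ℝ (Fin n)) η := by
        rw [h2, h6]
    _ = _ := by ring

/-- Pulling √(max t v) out of |√t ξ - √v η| puts the Poisson kernel in homogeneous form, with the
same denominator as the power of the chordal distance. -/
theorem transKernel_eq (ht : 0 < t) (hv : 0 < v) (h : t ≠ v) :
    transKernel t v ξ η = (sphereArea n)⁻¹ * (|t - v| * max t v ^ ((n : ℝ) / 2 - 1) /
      ‖√t • (ξ : EuclideanSpace ℝ (Fin n)) - √v • (η : EuclideanSpace ℝ (Fin n))‖ ^ n) := by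
  have hmax : 0 < max t v := lt_max_of_lt_left ht
  have hmin : 0 < min t v := lt_min ht hv
  rw [transKernel, if_pos ⟨ht, hv, h⟩, ballKernel, norm_smul_sphere (Real.sqrt_nonneg _),
    Real.sq_sqrt (by positivity), norm_sqrt_smul_sub ht hv, mul_pow]
  have h1 : √(max t v) ^ n = max t v * max t v ^ ((n : ℝ) / 2 - 1) := by
    rw [← Real.rpow_natCast, Real.sqrt_eq_rpow, ← Real.rpow_mul hmax.le]
    nth_rewrite 2 [← Real.rpow_one (max t v)]
    rw [← Real.rpow_add hmax]
    congr 1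
    ring
  have h2 : |t - v| = max t v - min t v := by rw [max_sub_min_eq_abs']
  have h3 : 0 < max t v ^ ((n : ℝ) / 2 - 1) := by positivity
  rw [h1, h2]
  congr 1
  field_simp

theorem dist_tanPoint_pow (ht : 0 < t) (hv : 0 < v) :
    dist (tanPoint (t, ξ)) (tanPoint (v, η)) ^ n =
      2 ^ (n : ℝ) * ((1 + t) ^ (-((n : ℝ) / 2)) * (1 + v) ^ (-((n : ℝ) / 2))) *
      ‖√t • (ξ : EuclideanSpace ℝ (Fin n)) - √v • (η : EuclideanSpace ℝ (Fin n))‖ ^ n := by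
  have h1 : 0 < 1 + t := by positivity
  have h2 : 0 < 1 + v := by positivity
  set N := ‖√t • (ξ : EuclideanSpace ℝ (Fin n)) - √v • (η : EuclideanSpace ℝ (Fin n))‖ with hN
  have hd : dist (tanPoint (t, ξ)) (tanPoint (v, η)) =
      2 * ((1 + t) ^ (-(1 / 2) : ℝ) * (1 + v) ^ (-(1 / 2) : ℝ)) * N := by
    rw [← sq_eq_sq₀ dist_nonneg (by positivity), dist_tanPoint_sq ht.le hv.le, ← hN, mul_pow,
      mul_pow, mul_pow, ← Real.rpow_natCast ((1 + t) ^ _), ← Real.rpow_natCast ((1 + v) ^ _),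
      ← Real.rpow_mul h1.le, ← Real.rpow_mul h2.le]
    norm_num
    rw [Real.rpow_neg_one, Real.rpow_neg_one]
    field_simp
    simp
  rw [hd, mul_pow, mul_pow, mul_pow, ← Real.rpow_natCast ((1 + t) ^ _),
    ← Real.rpow_natCast ((1 + v) ^ _), ← Real.rpow_mul h1.le, ← Real.rpow_mul h2.le,
    Real.rpow_natCast]
  congr 4 <;> ring

theorem lastCoord_sub (ht : 0 < t) (hv : 0 < v) :
    lastCoord (tanPoint (t, ξ)) - lastCoord (tanPoint (v, η)) =
      2 * (t - v) / ((1 + t) * (1 + v)) := by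
  rw [lastCoord_tanPoint ht.le, lastCoord_tanPoint hv.le]
  field_simp
  ring

/-- The Poisson kernel carries one factor |t - v|, which lowers the exponent α to α - 1. The other
powers separate into a function of t and one of v; the exponent β exists to absorb max(t,
v)^{n/2-1}. -/
theorem tanDensity_mul_kernel (hn : 0 < n) (hβ : IsSide n s β) (ht : 0 < t) (hv : 0 < v)
    (h : 0 < s * (t - v)) :
    tanDensity n v * ((s * (2 * (t - v) / ((1 + t) * (1 + v)))) ^ α /
        dist (tanPoint (t, ξ)) (tanPoint (v, η)) ^ n) =
      (sphereArea n / 2 * (1 + t) ^ ((n : ℝ) / 2 - α) * t ^ (-β)) *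
        ((s * (t - v)) ^ (α - 1) * (transKernel t v ξ η *
          (2 ^ α * (1 + v) ^ (-α - (n : ℝ) / 2) * v ^ β))) := by
  have h1 : 0 < 1 + t := by positivity
  have h2 : 0 < 1 + v := by positivity
  have hne : t ≠ v := fun h' => by simp [h'] at h
  have hσ := sphereArea_pos hn
  have habs : |t - v| = s * (t - v) := by
    rcases hβ.sign with rfl | rfl
    · rw [one_mul] at h ⊢; exact abs_of_pos h
    · rw [neg_one_mul] at h ⊢; exact abs_of_neg (by linarith)
  -- On the left side max(t, v) = t, so β = n/2 - 1 trades t for v. On the right side max(t, v) = v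
  -- and β = 0. Both give the power of v in the surface density.
  have hmax : t ^ (-β) * v ^ β * max t v ^ ((n : ℝ) / 2 - 1) = v ^ ((n : ℝ) / 2 - 1) := by
    rcases hβ with ⟨rfl, rfl⟩ | ⟨rfl, rfl⟩
    · rw [max_eq_left (by linarith), Real.rpow_neg ht.le]
      have : 0 < t ^ ((n : ℝ) / 2 - 1) := by positivity
      field_simp
    · rw [max_eq_right (by linarith)]
      simp
  rw [transKernel_eq ht hv hne, dist_tanPoint_pow ht hv, habs, tanDensity, ← hmax]
  set N := ‖√t • (ξ : EuclideanSpace ℝ (Fin n)) - √v • (η : EuclideanSpace ℝ (Fin n))‖ ^ n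
  have e1 : s * (2 * (t - v) / ((1 + t) * (1 + v))) =
      2 * (s * (t - v)) / ((1 + t) * (1 + v)) := by ring
  rw [e1]
  set d := s * (t - v) with hd
  have e2 : (2 * d / ((1 + t) * (1 + v))) ^ α =
      2 ^ α * (d ^ (α - 1) * d) * ((1 + t) ^ (-α) * (1 + v) ^ (-α)) := by
    rw [Real.div_rpow (by positivity) (by positivity), Real.mul_rpow (by positivity) h.le,
      Real.mul_rpow h1.le h2.le, Real.rpow_neg h1.le, Real.rpow_neg h2.le, Real.rpow_sub_one h.ne']
    field_simp
  have e3 : (2 : ℝ) ^ ((n : ℝ) - 1) = 2 ^ (n : ℝ) / 2 := Real.rpow_sub_one two_ne_zero _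
  have e4 : (1 + t) ^ ((n : ℝ) / 2 - α) = (1 + t) ^ (-α) / (1 + t) ^ (-((n : ℝ) / 2)) := by
    rw [← Real.rpow_sub h1]; congr 1; ring
  have e5 : (1 + v) ^ (-α - (n : ℝ) / 2) =
      (1 + v) ^ (-(n : ℝ)) * (1 + v) ^ (-α) / (1 + v) ^ (-((n : ℝ) / 2)) := by
    rw [← Real.rpow_add h2, ← Real.rpow_sub h2]; congr 1; ring
  rw [e2, e3, e4, e5]
  have p1 : 0 < (2 : ℝ) ^ (n : ℝ) := by positivity
  have p2 : 0 < (1 + t) ^ (-((n : ℝ) / 2)) := by positivity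
  have p3 : 0 < (1 + v) ^ (-((n : ℝ) / 2)) := by positivity
  generalize (2 : ℝ) ^ (n : ℝ) = A at *
  generalize (1 + t) ^ (-((n : ℝ) / 2)) = B at *
  generalize (1 + v) ^ (-((n : ℝ) / 2)) = C at *
  rw [div_eq_mul_inv _ (A * (B * C) * N), div_eq_mul_inv _ N, mul_inv]
  generalize N⁻¹ = M
  field_simp

theorem tanDensity_smul_sideIntegrand (hn : 0 < n) (hβ : IsSide n s β) (ht : 0 < t) (hv : 0 < v)
    (φ : USphere (n + 1) → ℂ) :
    tanDensity n v • sideIntegrand s α φ (tanPoint (t, ξ)) (tanPoint (v, η)) =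
      (sphereArea n / 2 * (1 + t) ^ ((n : ℝ) / 2 - α) * t ^ (-β)) •
        (plusPow (s * (t - v)) (α - 1) • (transKernel t v ξ η • tanWeighted β α φ (v, η))) := by
  have hp : 0 < (1 + t) * (1 + v) := by positivity
  have hiff : 0 < s * (2 * (t - v) / ((1 + t) * (1 + v))) ↔ 0 < s * (t - v) := by
    have : s * (2 * (t - v) / ((1 + t) * (1 + v))) = (s * (t - v)) * (2 / ((1 + t) * (1 + v))) := by
      ring
    rw [this, mul_pos_iff_of_pos_right (by positivity)]
  rw [sideIntegrand, lastCoord_sub ht hv, plusPow, tanWeighted, if_pos hv]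
  by_cases h : 0 < s * (t - v)
  · rw [if_pos (hiff.2 h), if_pos h, smul_smul, smul_smul, smul_smul, smul_smul,
      tanDensity_mul_kernel hn hβ ht hv h]
    congr 1
    ring
  · rw [if_neg (fun h' => h (hiff.1 h')), if_neg h]
    simp

end Kernel

/-! ### Change of variables in the one-sided integrals, and the functions A_x^± as semigroup orbits
-/

section SideIntegral

variable {n : ℕ} {s β α t : ℝ} {φ : USphere (n + 1) → ℂ}

theorem measurable_lastCoord : Measurable (lastCoord (n := n)) := by
  have h : Continuous (lastCoord (n := n)) := by
    unfold lastCoord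
    fun_prop
  exact h.measurable

theorem measurable_sideIntegrand (s α : ℝ) (hφ : Measurable φ) (x : USphere (n + 1)) :
    Measurable (sideIntegrand s α φ x) := by
  have h1 : Measurable fun y : USphere (n + 1) => s * (lastCoord x - lastCoord y) :=
    (measurable_const.sub measurable_lastCoord).const_mul s
  have h2 : Measurable fun y : USphere (n + 1) => dist x y := by fun_prop
  unfold sideIntegrand
  exact Measurable.ite (measurableSet_lt measurable_const h1)
    (((h1.pow_const α).div (h2.pow_const n)).smul hφ) measurable_const

theorem measurable_tanWeighted (β α : ℝ) (hφ : Measurable φ) :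
    Measurable (tanWeighted β α φ) := by
  have h := hφ.comp (continuous_tanPoint (n := n)).measurable
  have h1 : Measurable fun z : ℝ × USphere n =>
      2 ^ α * (1 + z.1) ^ (-α - (n : ℝ) / 2) * z.1 ^ β := by fun_prop
  unfold tanWeighted
  exact Measurable.ite (measurableSet_lt measurable_const measurable_fst)
    (h1.smul h) measurable_const

theorem measurePreserving_time (hs : s = 1 ∨ s = -1) (t : ℝ) :
    MeasurePreserving (fun a : ℝ => t - s * a) volume volume := by
  rcases hs with rfl | rfl
  · simpa using Measure.measurePreserving_sub_left volume t
  · simpa [sub_neg_eq_add] using measurePreserving_add_left volume t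

theorem measurableEmbedding_time (hs : s = 1 ∨ s = -1) (t : ℝ) :
    MeasurableEmbedding (fun a : ℝ => t - s * a) := by
  rcases hs with rfl | rfl
  · simpa using measurableEmbedding_subLeft t
  · simpa [sub_neg_eq_add] using measurableEmbedding_addLeft t

theorem sign_mul_sub_time (hs : s = 1 ∨ s = -1) (t a : ℝ) : s * (t - (t - s * a)) = a := by
  rcases hs with rfl | rfl <;> ring

theorem transKernel_of_nonpos {t v : ℝ} (hv : ¬ 0 < v) (ξ η : USphere n) :
    transKernel t v ξ η = 0 := by
  rw [transKernel, if_neg fun h => hv h.2.1]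

/-- The constant that relates the spherical integrals to those over the half-line. -/
def tanFactor (n : ℕ) (β α t : ℝ) : ℝ :=
  sphereArea n / 2 * (1 + t) ^ ((n : ℝ) / 2 - α) * t ^ (-β)

theorem tanFactor_pos (hn : 0 < n) (β α : ℝ) (ht : 0 < t) : 0 < tanFactor n β α t := by
  have := sphereArea_pos hn
  unfold tanFactor
  positivity

/-- The absolute form of the change of variables: absolute convergence of the spherical integral at
a point is equivalent to finiteness of `fracAbs` there. -/
theorem lintegral_sideIntegrand (hn : 0 < n) (hβ : IsSide n s β) (hφ : Measurable φ) (ht : 0 < t)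
    (ξ : USphere n) :
    ∫⁻ y, ‖sideIntegrand s α φ (tanPoint (t, ξ)) y‖ₑ ∂(surf (n + 1)) =
      ENNReal.ofReal (tanFactor n β α t) * fracAbs s α (tanWeighted β α φ) (t, ξ) := by
  have hG := measurable_tanWeighted β α hφ
  have hC := tanFactor_pos hn β α ht
  set G := tanWeighted β α φ with hGdef
  have hk : Measurable fun w : ℝ × USphere n => transKernel t w.1 ξ w.2 :=
    measurable_transKernel.comp (f := fun w : ℝ × USphere n => ((t, w.1), (ξ, w.2))) (by fun_prop)
  have hin : Measurable fun v => ∫⁻ η, ENNReal.ofReal (transKernel t v ξ η) * ‖G (v, η)‖ₑ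
      ∂(surf n) :=
    (hk.ennreal_ofReal.mul hG.enorm).lintegral_prod_right'
  have hpp : Measurable fun v : ℝ => ENNReal.ofReal (plusPow (s * (t - v)) (α - 1)) :=
    ((measurable_plusPow (α - 1)).comp (by fun_prop : Measurable fun v : ℝ =>
      s * (t - v))).ennreal_ofReal
  rw [lintegral_surf_eq_tan hn (measurable_sideIntegrand s α hφ _).enorm]
  have h1 : ∀ v ∈ Set.Ioi (0 : ℝ), ENNReal.ofReal (tanDensity n v) *
      ∫⁻ η, ‖sideIntegrand s α φ (tanPoint (t, ξ)) (tanPoint (v, η))‖ₑ ∂(surf n) =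
      ENNReal.ofReal (tanFactor n β α t) * (ENNReal.ofReal (plusPow (s * (t - v)) (α - 1)) *
        ∫⁻ η, ENNReal.ofReal (transKernel t v ξ η) * ‖G (v, η)‖ₑ ∂(surf n)) := by
    intro v hv
    have hmη : Measurable fun η : USphere n => (v, η) := by fun_prop
    rw [← lintegral_const_mul, ← lintegral_const_mul, ← lintegral_const_mul]
    · refine lintegral_congr fun η => ?_
      have h2 := tanDensity_smul_sideIntegrand (α := α) (ξ := ξ) (η := η) hn hβ ht hv φ
      have h3 := congrArg (fun c : ℂ => ‖c‖ₑ) h2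
      simp only [enorm_smul] at h3
      rw [Real.enorm_eq_ofReal (tanDensity_pos n hv).le,
        Real.enorm_eq_ofReal (transKernel_nonneg _ _ _ _),
        Real.enorm_eq_ofReal (plusPow_nonneg _ _)] at h3
      rw [h3, ← tanFactor, Real.enorm_eq_ofReal hC.le]
    · exact ((hk.comp hmη).ennreal_ofReal.mul (hG.comp hmη).enorm).const_mul _
    · exact (hk.comp hmη).ennreal_ofReal.mul (hG.comp hmη).enorm
    · exact ((measurable_sideIntegrand s α hφ _).comp
        ((continuous_tanPoint (n := n)).measurable.comp hmη)).enorm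
  have hpi : Measurable fun v : ℝ => ENNReal.ofReal (plusPow (s * (t - v)) (α - 1)) *
      ∫⁻ η, ENNReal.ofReal (transKernel t v ξ η) * ‖G (v, η)‖ₑ ∂(surf n) := hpp.mul hin
  rw [setLIntegral_congr_fun measurableSet_Ioi h1, lintegral_const_mul _ hpi]
  congr 1
  -- The transport kernel vanishes for v ≤ 0, so the integral extends to the whole line, where v = t
  -- - s a is a measure-preserving substitution.
  have h4 : ∫⁻ v in Set.Ioi (0 : ℝ), ENNReal.ofReal (plusPow (s * (t - v)) (α - 1)) *
        ∫⁻ η, ENNReal.ofReal (transKernel t v ξ η) * ‖G (v, η)‖ₑ ∂(surf n) =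
      ∫⁻ v : ℝ, ENNReal.ofReal (plusPow (s * (t - v)) (α - 1)) *
        ∫⁻ η, ENNReal.ofReal (transKernel t v ξ η) * ‖G (v, η)‖ₑ ∂(surf n) := by
    rw [← lintegral_indicator measurableSet_Ioi]
    refine lintegral_congr fun v => ?_
    by_cases hv : v ∈ Set.Ioi (0 : ℝ)
    · rw [Set.indicator_of_mem hv]
    · rw [Set.indicator_of_notMem hv]
      simp [transKernel_of_nonpos (t := t) hv]
  rw [h4, ← (measurePreserving_time hβ.sign t).lintegral_comp hpi, fracAbs,
    ← lintegral_indicator measurableSet_Ioi]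
  refine lintegral_congr fun a => ?_
  simp only [sign_mul_sub_time hβ.sign, transport]
  by_cases ha : a ∈ Set.Ioi (0 : ℝ)
  · rw [Set.indicator_of_mem ha, plusPow, if_pos (show 0 < a from ha)]
  · rw [Set.indicator_of_notMem ha, plusPow, if_neg (show ¬ 0 < a from ha)]
    simp

theorem integrable_sideIntegrand_iff (hn : 0 < n) (hβ : IsSide n s β) (hφ : Measurable φ)
    (ht : 0 < t) (ξ : USphere n) :
    Integrable (sideIntegrand s α φ (tanPoint (t, ξ))) (surf (n + 1)) ↔
      fracAbs s α (tanWeighted β α φ) (t, ξ) ≠ ∞ := by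
  have hC : ENNReal.ofReal (tanFactor n β α t) ≠ 0 :=
    (ENNReal.ofReal_pos.2 (tanFactor_pos hn β α ht)).ne'
  constructor
  · intro h h'
    have h1 := h.2
    rw [HasFiniteIntegral, lintegral_sideIntegrand hn hβ hφ ht, h', ENNReal.mul_top hC] at h1
    exact lt_irrefl _ h1
  · intro h
    refine ⟨(measurable_sideIntegrand s α hφ _).aestronglyMeasurable, ?_⟩
    rw [HasFiniteIntegral, lintegral_sideIntegrand hn hβ hφ ht]
    exact ENNReal.mul_lt_top ENNReal.ofReal_lt_top h.lt_top

theorem integral_sideIntegrand (hn : 0 < n) (hβ : IsSide n s β) (hφ : Measurable φ) (ht : 0 < t)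
    (ξ : USphere n) (hfin : fracAbs s α (tanWeighted β α φ) (t, ξ) ≠ ∞) :
    ∫ y, sideIntegrand s α φ (tanPoint (t, ξ)) y ∂(surf (n + 1)) =
      tanFactor n β α t •
        ∫ a in Set.Ioi (0 : ℝ), a ^ (α - 1) • transportC s (tanWeighted β α φ) (t, ξ) a := by
  have hint := (integrable_sideIntegrand_iff (α := α) hn hβ hφ ht ξ).2 hfin
  have hd := measurable_ofReal_tanDensity n
  have hJ := measurable_sideIntegrand s α hφ (tanPoint (t, ξ))
  have hC := tanFactor_pos hn β α ht
  set G := tanWeighted β α φ with hGdef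
  set J := sideIntegrand s α φ (tanPoint (t, ξ)) with hJdef
  have h1 : Integrable (fun z => J (tanPoint z)) (tanMeasure n) := by
    rw [← map_tanPoint hn] at hint
    exact hint.comp_measurable continuous_tanPoint.measurable
  have htop : ∀ᵐ z ∂((volume.restrict (Set.Ioi (0 : ℝ))).prod (surf n)),
      ENNReal.ofReal (tanDensity n z.1) < ∞ := Eventually.of_forall fun _ => ENNReal.ofReal_lt_top
  have hpos : ∀ᵐ z ∂((volume.restrict (Set.Ioi (0 : ℝ))).prod (surf n)), 0 < z.1 :=
    Measure.quasiMeasurePreserving_fst.ae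
      (ae_restrict_mem measurableSet_Ioi : ∀ᵐ t ∂(volume.restrict (Set.Ioi (0 : ℝ))), 0 < t)
  have hcongr : (fun z : ℝ × USphere n => (ENNReal.ofReal (tanDensity n z.1)).toReal •
      J (tanPoint z)) =ᵐ[(volume.restrict (Set.Ioi (0 : ℝ))).prod (surf n)]
      fun z => tanFactor n β α t • (plusPow (s * (t - z.1)) (α - 1) •
        (transKernel t z.1 ξ z.2 • G z)) := by
    filter_upwards [hpos] with z hz
    rw [ENNReal.toReal_ofReal (tanDensity_pos n hz).le]
    exact tanDensity_smul_sideIntegrand hn hβ ht hz φ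
  have h2 := h1
  rw [tanMeasure, integrable_withDensity_iff_integrable_smul' hd htop] at h2
  have h3 := h2.congr hcongr
  have h4 : Integrable (fun z : ℝ × USphere n => plusPow (s * (t - z.1)) (α - 1) •
        (transKernel t z.1 ξ z.2 • G z)) ((volume.restrict (Set.Ioi (0 : ℝ))).prod (surf n)) :=
    (integrable_smul_iff hC.ne' _).1 h3
  have h5 : ∫ y, J y ∂(surf (n + 1)) = ∫ z, J (tanPoint z) ∂(tanMeasure n) := by
    rw [← map_tanPoint hn, integral_map continuous_tanPoint.measurable.aemeasurable
      hJ.aestronglyMeasurable]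
  rw [h5, tanMeasure, integral_withDensity_eq_integral_toReal_smul hd htop,
    integral_congr_ae hcongr, integral_smul, integral_prod _ h4]
  congr 1
  simp only [integral_smul]
  set K : ℝ → ℂ := fun v => plusPow (s * (t - v)) (α - 1) •
    ∫ η, transKernel t v ξ η • G (v, η) ∂(surf n) with hK
  have hK0 : ∀ v, v ∉ Set.Ioi (0 : ℝ) → K v = 0 := by
    intro v hv
    simp [hK, transKernel_of_nonpos (t := t) hv]
  rw [setIntegral_eq_integral_of_forall_compl_eq_zero hK0,
    ← (measurePreserving_time hβ.sign t).integral_comp (measurableEmbedding_time hβ.sign t)]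
  have hK1 : ∀ a, K (t - s * a) = plusPow a (α - 1) • transportC s G (t, ξ) a := by
    intro a
    simp only [hK, sign_mul_sub_time hβ.sign, transportC]
  simp only [hK1]
  rw [← setIntegral_eq_integral_of_forall_compl_eq_zero (s := Set.Ioi (0 : ℝ))]
  · refine setIntegral_congr_fun measurableSet_Ioi fun a ha => ?_
    simp only [plusPow, if_pos (Set.mem_Ioi.1 ha)]
  · intro a ha
    rw [plusPow, if_neg (show ¬ 0 < a from ha), zero_smul]

/-- The fractional integral of `tanWeighted β α φ`, expressed through that of `φ`. -/
def tanFracInt {n : ℕ} (s β α : ℝ) (φ : USphere (n + 1) → ℂ) (z : ℝ × USphere n) : ℂ :=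
  ((1 + z.1) ^ (α - (n : ℝ) / 2) * z.1 ^ β) • sideInt s α φ (tanPoint z)

/-- The weights of `tanFracInt` cancel the powers in `tanFactor`, and the constants combine as
(2/(Γ(α)σ)) (σ/2) = 1/Γ(α). -/
theorem tanFracInt_eq (hn : 0 < n) (hβ : IsSide n s β) (hφ : Measurable φ)
    (z : ℝ × USphere n) (hz : 0 < z.1) (hfin : fracAbs s α (tanWeighted β α φ) z ≠ ∞) :
    tanFracInt s β α φ z = (Real.Gamma α)⁻¹ •
      ∫ a in Set.Ioi (0 : ℝ), a ^ (α - 1) • transportC s (tanWeighted β α φ) z a := by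
  obtain ⟨t, ξ⟩ := z
  have hz : 0 < t := hz
  have h1 : 0 < 1 + t := by positivity
  have hσ := sphereArea_pos hn
  rw [tanFracInt, sideInt, integral_sideIntegrand hn hβ hφ hz ξ hfin, smul_smul, smul_smul]
  congr 1
  simp only [tanFactor]
  have e1 : (1 + t) ^ (α - (n : ℝ) / 2) * (1 + t) ^ ((n : ℝ) / 2 - α) = 1 := by
    rw [← Real.rpow_add h1]; simp
  have e2 : t ^ β * t ^ (-β) = 1 := by rw [← Real.rpow_add hz]; simp
  calc _ = ((1 + t) ^ (α - (n : ℝ) / 2) * (1 + t) ^ ((n : ℝ) / 2 - α)) * (t ^ β * t ^ (-β)) *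
        (sphereArea n * (sphereArea n)⁻¹) * (Real.Gamma α)⁻¹ := by
        rw [div_eq_mul_inv 2 (Real.Gamma α * sphereArea n), mul_inv]; ring
    _ = _ := by rw [e1, e2, mul_inv_cancel₀ hσ.ne']; ring

/-- The Poisson integral in terms of the transport kernel. -/
theorem poisson_eq_transKernel {t v : ℝ} (ht : 0 < t) (hv : 0 < v) (h : t ≠ v) (ξ : USphere n)
    (ψ : USphere n → ℂ) :
    poisson ψ (ξ : EuclideanSpace ℝ (Fin n)) (√(min t v / max t v)) =
      ∫ η, transKernel t v ξ η • ψ η ∂(surf n) := by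
  rw [poisson, ← integral_smul]
  refine integral_congr_ae (Eventually.of_forall fun η => ?_)
  simp only [transKernel, if_pos (And.intro ht (And.intro hv h)), ballKernel,
    norm_smul_sphere (Real.sqrt_nonneg _), smul_smul]

theorem transportC_tanFracInt (α : ℝ) {b : ℝ} (ξ : USphere n) :
    transportC s (tanFracInt s β α φ) (t, ξ) b =
      ((1 + (t - s * b)) ^ (α - (n : ℝ) / 2) * (t - s * b) ^ β) •
        ∫ η, transKernel t (t - s * b) ξ η • sideInt s α φ (tanPoint (t - s * b, η)) ∂(surf n) := by
  rw [transportC, ← integral_smul]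
  refine integral_congr_ae (Eventually.of_forall fun η => ?_)
  simp only [tanFracInt]
  exact smul_comm _ _ _

/-- Here 1 + u/t = (t + u)/t, whose square root is the Poisson ratio of the transport kernel and
whose power n/2 - 1 equals t^{-β}(t + u)^β. For t + u ≤ 0 both sides vanish. -/
theorem Aplus_tanPoint (ht : 0 < t) (ξ : USphere n) {u : ℝ} (hu : u ≤ 0) :
    Aplus α (sideInt 1 α φ) (tanPoint (t, ξ)) u =
      t ^ (-((n : ℝ) / 2 - 1)) •
        orbitFun 1 (tanFracInt 1 ((n : ℝ) / 2 - 1) α φ) (t, ξ) u := by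
  have e2 : t ^ (-((n : ℝ) / 2 - 1)) * t ^ ((n : ℝ) / 2 - 1) = 1 := by
    rw [← Real.rpow_add ht]; simp
  rw [Aplus, orbitFun, tanSq_tanPoint ht, direction_tanPoint ht]
  by_cases hu0 : u = 0
  · rw [if_pos hu0, if_pos hu0, tanFracInt, smul_smul]
    congr 1
    rw [mul_left_comm, e2, mul_one]
  · rw [if_neg hu0, if_neg hu0, transportC_tanFracInt]
    have hlt : u < 0 := lt_of_le_of_ne hu hu0
    have hv : t - 1 * -u = t + u := by ring
    rw [hv]
    have hdiv : 1 + u / t = (t + u) / t := by field_simp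
    by_cases hpos : 0 < t + u
    · have hp : 0 < (t + u) / t := by positivity
      rw [hdiv, plusPow, if_pos hp, ← Real.sqrt_eq_rpow]
      have hmm : (t + u) / t = min t (t + u) / max t (t + u) := by
        rw [min_eq_right (by linarith), max_eq_left (by linarith)]
      nth_rewrite 2 [hmm]
      rw [poisson_eq_transKernel ht hpos (by linarith), smul_smul]
      congr 1
      rw [Real.div_rpow hpos.le ht.le, Real.rpow_neg ht.le, add_assoc, div_eq_mul_inv]
      ring
    · have hp : ¬ 0 < (t + u) / t := fun h => hpos ((div_pos_iff_of_pos_right ht).1 h)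
      rw [hdiv, plusPow, if_neg hp, zero_mul, zero_smul]
      simp [transKernel_of_nonpos (t := t) hpos]

/-- The parallel moves up from t to t - u > t, so the ratio is √(t/(t - u)), which accounts for the
exponent -1/2. With β = 0 there is no extra power of t. -/
theorem Aminus_tanPoint (ht : 0 < t) (ξ : USphere n) {u : ℝ} (hu : u ≤ 0) :
    Aminus α (sideInt (-1) α φ) (tanPoint (t, ξ)) u =
      t ^ (-(0 : ℝ)) • orbitFun (-1) (tanFracInt (-1) 0 α φ) (t, ξ) u := by
  rw [neg_zero, Real.rpow_zero, one_smul, Aminus, orbitFun, tanSq_tanPoint ht,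
    direction_tanPoint ht]
  by_cases hu0 : u = 0
  · rw [if_pos hu0, if_pos hu0, tanFracInt, Real.rpow_zero, mul_one]
  · rw [if_neg hu0, if_neg hu0, transportC_tanFracInt]
    have hlt : u < 0 := lt_of_le_of_ne hu hu0
    have hv : t - -1 * -u = t - u := by ring
    have hpos : 0 < t - u := by linarith
    have hmm : (1 - u / t) ^ (-(1 / 2) : ℝ) = √(min t (t - u) / max t (t - u)) := by
      rw [min_eq_left (by linarith), max_eq_right (by linarith), Real.sqrt_eq_rpow,
        ← inv_div (t - u) t, Real.inv_rpow (by positivity), ← Real.rpow_neg (by positivity)]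
      congr 1
      field_simp
    rw [hv, Real.rpow_zero, mul_one, hmm, poisson_eq_transKernel ht hpos (by linarith), add_sub]
    rfl

theorem marchaudIntegrand_congr {ℓ : ℕ} {h h' : ℝ → ℂ} {c : ℝ}
    (heq : ∀ u ≤ 0, h u = c • h' u) {τ : ℝ} (hτ : 0 ≤ τ) :
    marchaudIntegrand α ℓ h τ = c • marchaudIntegrand α ℓ h' τ := by
  simp only [marchaudIntegrand, finDiff]
  rw [smul_comm c]
  congr 1
  rw [Finset.smul_sum]
  refine Finset.sum_congr rfl fun j _ => ?_
  rw [heq _ (by simp only [zero_sub, Left.neg_nonpos_iff]; positivity), smul_comm]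

end SideIntegral

/-! ### Integrability of densities on the half-line -/

theorem rpow_le_add_of_mem {a x b : ℝ} (ha : 0 < a) (hax : a ≤ x) (hxb : x ≤ b) (e : ℝ) :
    x ^ e ≤ a ^ e + b ^ e := by
  have hx : 0 < x := ha.trans_le hax
  have hb : 0 < b := hx.trans_le hxb
  rcases le_total 0 e with he | he
  · exact (Real.rpow_le_rpow hx.le hxb he).trans (le_add_of_nonneg_left (by positivity))
  · exact (Real.rpow_le_rpow_of_nonpos ha hax he).trans (le_add_of_nonneg_right (by positivity))

theorem lintegral_rpow_Ioo_ne_top {e : ℝ} (he : -1 < e) (A : ℝ) :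
    ∫⁻ a in Set.Ioo 0 A, ENNReal.ofReal (a ^ e) ≠ ∞ := by
  rcases le_total A 0 with hA | hA
  · simp [Set.Ioo_eq_empty (not_lt.2 hA)]
  have h := (intervalIntegrable_iff_integrableOn_Ioc_of_le hA).1
    (intervalIntegral.intervalIntegrable_rpow' (a := 0) (b := A) he)
  have h2 := (h.mono_set Set.Ioo_subset_Ioc_self).2
  rw [HasFiniteIntegral] at h2
  refine ne_of_lt (lt_of_le_of_lt (setLIntegral_mono' measurableSet_Ioo fun a ha => ?_) h2)
  have ha0 : 0 < a := ha.1
  rw [Real.enorm_eq_ofReal (by positivity)]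

/-- Integrate over t in U and swap: the convolution has finite integral because a^{α-1} is
integrable at 0 for α > 0, hence it is finite almost everywhere. -/
theorem ae_lintegral_convolution_ne_top {α : ℝ} (hα : 0 < α) (s : ℝ) {g : ℝ → ℝ≥0∞}
    (hg : Measurable g) {A : ℝ} {U V : Set ℝ} (hU : MeasurableSet U) (hV : MeasurableSet V)
    (hUV : ∀ t ∈ U, ∀ a ∈ Set.Ioo 0 A, t - s * a ∈ V) (hfin : ∫⁻ v in V, g v ≠ ∞) :
    ∀ᵐ t : ℝ, t ∈ U →
      ∫⁻ a in Set.Ioo 0 A, ENNReal.ofReal (a ^ (α - 1)) * g (t - s * a) ≠ ∞ := by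
  have hm : Measurable fun w : ℝ × ℝ => ENNReal.ofReal (w.2 ^ (α - 1)) * g (w.1 - s * w.2) :=
    (by fun_prop : Measurable fun w : ℝ × ℝ => ENNReal.ofReal (w.2 ^ (α - 1))).mul
      (hg.comp (by fun_prop))
  have h1 : ∫⁻ t in U, ∫⁻ a in Set.Ioo 0 A, ENNReal.ofReal (a ^ (α - 1)) * g (t - s * a) ≠ ∞ := by
    rw [lintegral_lintegral_swap hm.aemeasurable]
    have h2 : ∀ a ∈ Set.Ioo 0 A, ∫⁻ t in U, ENNReal.ofReal (a ^ (α - 1)) * g (t - s * a) ≤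
        ENNReal.ofReal (a ^ (α - 1)) * ∫⁻ v in V, g v := by
      intro a ha
      have hga : Measurable fun t => g (t - s * a) := hg.comp (by fun_prop)
      rw [lintegral_const_mul _ hga]
      refine mul_le_mul_right ?_ _
      rw [← lintegral_indicator hV, ← lintegral_sub_right_eq_self (V.indicator g) (s * a),
        ← lintegral_indicator hU]
      refine lintegral_mono fun t => ?_
      by_cases ht : t ∈ U
      · rw [Set.indicator_of_mem ht, Set.indicator_of_mem (hUV t ht a ha)]
      · rw [Set.indicator_of_notMem ht]
        exact zero_le
    refine ne_of_lt (lt_of_le_of_lt (setLIntegral_mono' measurableSet_Ioo h2) ?_)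
    rw [lintegral_mul_const _ (by fun_prop)]
    exact ENNReal.mul_lt_top (lintegral_rpow_Ioo_ne_top (by linarith) A).lt_top hfin.lt_top
  have h3 := ae_lt_top (hm.lintegral_prod_right' (ν := volume.restrict (Set.Ioo 0 A))) h1
  filter_upwards [(ae_restrict_iff' hU).1 h3] with t ht htU using (ht htU).ne

section Criteria

variable {n : ℕ} {α : ℝ} {G : ℝ × USphere n → ℂ}

theorem integrableOn_of_slices (hG : Measurable G) {r R : ℝ}
    (h : ∫⁻ v in Set.Ioo r R, ∫⁻ η, ‖G (v, η)‖ₑ ∂(surf n) ≠ ∞) :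
    IntegrableOn G (Set.Ioo r R ×ˢ Set.univ) (volume.prod (surf n)) := by
  rw [IntegrableOn, ← Measure.prod_restrict, Measure.restrict_univ]
  refine ⟨hG.aestronglyMeasurable, ?_⟩
  rw [HasFiniteIntegral, lintegral_prod _ hG.enorm.aemeasurable]
  exact h.lt_top

theorem measurable_slices (hG : Measurable G) :
    Measurable fun v => ∫⁻ η, ‖G (v, η)‖ₑ ∂(surf n) :=
  hG.enorm.lintegral_prod_right'

/-- Since G vanishes for t ≤ 0, only times a < t contribute. Finiteness is thus a local convolution
statement, with no condition at infinity. -/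
theorem fracDensity_left (hα : 0 < α) (hG : Measurable G) (h0 : ∀ z, z.1 ≤ 0 → G z = 0)
    (hfin : ∀ R : ℝ, ∫⁻ v in Set.Iio R, ∫⁻ η, ‖G (v, η)‖ₑ ∂(surf n) ≠ ∞) :
    FracDensity 1 α G := by
  refine ⟨hG, fun r R _ => integrableOn_of_slices hG ?_, ?_⟩
  · exact ne_of_lt ((lintegral_mono_set Set.Ioo_subset_Iio_self).trans_lt (hfin R).lt_top)
  · have h1 := fun k : ℕ => ae_lintegral_convolution_ne_top hα 1 (measurable_slices hG) (A := k)
      (U := Set.Iio (k : ℝ)) (V := Set.Iio (k : ℝ)) measurableSet_Iio measurableSet_Iio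
      (fun t ht a ha => by
        have ht : t < k := ht
        have := ha.1
        simp only [Set.mem_Iio]
        linarith) (hfin k)
    filter_upwards [ae_all_iff.2 h1] with t ht ht0
    obtain ⟨k, hk⟩ := exists_nat_gt t
    refine ne_of_lt (lt_of_le_of_lt (le_of_eq ?_) (ht k hk).lt_top)
    rw [← lintegral_indicator measurableSet_Ioi, ← lintegral_indicator measurableSet_Ioo]
    refine lintegral_congr fun a => ?_
    by_cases ha : a ∈ Set.Ioo 0 (k : ℝ)
    · rw [Set.indicator_of_mem ha, Set.indicator_of_mem (show a ∈ Set.Ioi (0 : ℝ) from ha.1)]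
    · rw [Set.indicator_of_notMem ha]
      by_cases ha0 : a ∈ Set.Ioi (0 : ℝ)
      · rw [Set.indicator_of_mem ha0]
        have hka : (k : ℝ) ≤ a := by
          by_contra h
          exact ha ⟨ha0, not_le.1 h⟩
        have h2 : ∀ η, G (t - 1 * a, η) = 0 := fun η => h0 _ (by simp only; linarith)
        simp only [h2]
        simp
      · rw [Set.indicator_of_notMem ha0]

/-- Split at a = k + 1 > t. Small a is a local convolution; for large a, the ratio (t + a)/a lies in
[1, 2], so a^{α-1} is comparable with v^{α-1} at v = t + a and the assumption at infinity applies.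
-/
theorem fracDensity_right (hα : 0 < α) (hG : Measurable G)
    (hfin : ∀ r : ℝ, 0 < r → ∫⁻ v in Set.Ioi r,
      ENNReal.ofReal (v ^ (α - 1)) * ∫⁻ η, ‖G (v, η)‖ₑ ∂(surf n) ≠ ∞) :
    FracDensity (-1) α G := by
  have hloc : ∀ r R : ℝ, 0 < r → ∫⁻ v in Set.Ioo r R, ∫⁻ η, ‖G (v, η)‖ₑ ∂(surf n) ≠ ∞ := by
    intro r R hr
    have h1 : ∀ v ∈ Set.Ioo r R, ∫⁻ η, ‖G (v, η)‖ₑ ∂(surf n) ≤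
        ENNReal.ofReal (r ^ (1 - α) + R ^ (1 - α)) *
          (ENNReal.ofReal (v ^ (α - 1)) * ∫⁻ η, ‖G (v, η)‖ₑ ∂(surf n)) := by
      intro v hv
      have hv0 : 0 < v := hr.trans hv.1
      have hR : 0 < R := hv0.trans hv.2
      rw [← mul_assoc, ← ENNReal.ofReal_mul (by positivity)]
      refine le_mul_of_one_le_left' ?_
      rw [ENNReal.one_le_ofReal]
      calc (1 : ℝ) = v ^ (1 - α) * v ^ (α - 1) := by rw [← Real.rpow_add hv0]; simp
        _ ≤ _ := by
          gcongr
          exact rpow_le_add_of_mem hr hv.1.le hv.2.le _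
    refine ne_of_lt (lt_of_le_of_lt (setLIntegral_mono' measurableSet_Ioo h1) ?_)
    rw [lintegral_const_mul' _ _ ENNReal.ofReal_ne_top]
    exact ENNReal.mul_lt_top ENNReal.ofReal_lt_top
      ((lintegral_mono_set Set.Ioo_subset_Ioi_self).trans_lt (hfin r hr).lt_top)
  refine ⟨hG, fun r R hr => integrableOn_of_slices hG (hloc r R hr), ?_⟩
  have h1 := fun k : ℕ => ae_lintegral_convolution_ne_top hα (-1) (measurable_slices hG)
    (A := (k : ℝ) + 1)
    (U := Set.Ioo (1 / ((k : ℝ) + 1)) (k + 1)) (V := Set.Ioo (1 / ((k : ℝ) + 1)) (2 * (k + 1)))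
    measurableSet_Ioo measurableSet_Ioo
    (fun t ht a ha => by
      have h1 := ht.1
      have h2 := ht.2
      have h3 := ha.1
      have h4 := ha.2
      constructor <;> linarith) (hloc _ _ (by positivity))
  filter_upwards [ae_all_iff.2 h1] with t ht ht0
  obtain ⟨k, hk⟩ := exists_nat_gt (max t (1 / t))
  have hkt : t < k := (le_max_left _ _).trans_lt hk
  have htk : t ∈ Set.Ioo (1 / ((k : ℝ) + 1)) (k + 1) := by
    refine ⟨?_, by linarith⟩
    rw [div_lt_comm₀ (by positivity) ht0]
    exact (le_max_right _ _).trans_lt (hk.trans (by linarith))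
  have hk1 : (0 : ℝ) < (k : ℝ) + 1 := by positivity
  have htail : ∫⁻ a in Set.Ici ((k : ℝ) + 1), ENNReal.ofReal (a ^ (α - 1)) *
      ∫⁻ η, ‖G (t - -1 * a, η)‖ₑ ∂(surf n) ≠ ∞ := by
    have h2 : ∀ a ∈ Set.Ici ((k : ℝ) + 1), ENNReal.ofReal (a ^ (α - 1)) *
        ∫⁻ η, ‖G (t - -1 * a, η)‖ₑ ∂(surf n) ≤ ENNReal.ofReal (1 ^ (1 - α) + 2 ^ (1 - α)) *
          (Set.Ioi t).indicator (fun v => ENNReal.ofReal (v ^ (α - 1)) *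
            ∫⁻ η, ‖G (v, η)‖ₑ ∂(surf n)) (t + a) := by
      intro a ha
      have ha : (k : ℝ) + 1 ≤ a := ha
      have ha0 : 0 < a := hk1.trans_le ha
      have hta : 0 < t + a := by positivity
      rw [Set.indicator_of_mem (show t + a ∈ Set.Ioi t by simpa using ha0), ← mul_assoc,
        ← ENNReal.ofReal_mul (by positivity), show t - -1 * a = t + a by ring]
      refine mul_le_mul_left (ENNReal.ofReal_le_ofReal ?_) _
      have h3 : a ^ (α - 1) = ((t + a) / a) ^ (1 - α) * (t + a) ^ (α - 1) := by
        rw [Real.div_rpow hta.le ha0.le, ← neg_sub α 1, Real.rpow_neg hta.le, Real.rpow_neg ha0.le]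
        have : 0 < (t + a) ^ (α - 1) := by positivity
        field_simp
      rw [h3]
      gcongr
      refine rpow_le_add_of_mem one_pos ?_ ?_ _
      · rw [le_div_iff₀ ha0]; linarith
      · rw [div_le_iff₀ ha0]; linarith
    refine ne_of_lt (lt_of_le_of_lt (setLIntegral_mono' measurableSet_Ici h2) ?_)
    rw [lintegral_const_mul' _ _ ENNReal.ofReal_ne_top]
    refine ENNReal.mul_lt_top ENNReal.ofReal_lt_top ?_
    refine (setLIntegral_le_lintegral _ _).trans_lt ?_
    rw [lintegral_add_left_eq_self _ t, lintegral_indicator measurableSet_Ioi]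
    exact (hfin t ht0).lt_top
  have hunion : Set.Ioi (0 : ℝ) = Set.Ioo 0 ((k : ℝ) + 1) ∪ Set.Ici ((k : ℝ) + 1) :=
    (Set.Ioo_union_Ici_eq_Ioi hk1).symm
  rw [hunion]
  refine ne_of_lt ((lintegral_union_le _ _ _).trans_lt ?_)
  exact ENNReal.add_lt_top.2 ⟨(ht k htk).lt_top, htail.lt_top⟩

end Criteria

/-! ### The densities of functions that are integrable away from a pole -/

section Densities

variable {n : ℕ} {α : ℝ} {φ : USphere (n + 1) → ℂ}

theorem enorm_tanWeighted (β α : ℝ) (φ : USphere (n + 1) → ℂ) {v : ℝ} (hv : 0 < v)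
    (η : USphere n) :
    ‖tanWeighted β α φ (v, η)‖ₑ =
      ENNReal.ofReal (2 ^ α * (1 + v) ^ (-α - (n : ℝ) / 2) * v ^ β) * ‖φ (tanPoint (v, η))‖ₑ := by
  rw [tanWeighted, if_pos hv, enorm_smul, Real.enorm_eq_ofReal (by positivity)]

theorem tanWeighted_of_nonpos (β α : ℝ) (φ : USphere (n + 1) → ℂ) (z : ℝ × USphere n)
    (hz : z.1 ≤ 0) : tanWeighted β α φ z = 0 := by
  rw [tanWeighted, if_neg (not_lt.2 hz)]

/-- A weighted integral of the slices is dominated by an integral over a part of the sphere. -/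
theorem lintegral_slices_ne_top (hn : 0 < n) (hφ : Measurable φ) {β C : ℝ} {S : Set ℝ}
    (hS : MeasurableSet S) (hS0 : S ⊆ Set.Ioi 0) {E : Set (USphere (n + 1))}
    (hE : MeasurableSet E) (hint : IntegrableOn φ E (surf (n + 1)))
    (hSE : ∀ v ∈ S, ∀ η : USphere n, tanPoint (v, η) ∈ E) (c : ℝ → ℝ) (hc0 : ∀ v ∈ S, 0 ≤ c v)
    (hc : ∀ v ∈ S, c v * (2 ^ α * (1 + v) ^ (-α - (n : ℝ) / 2) * v ^ β) ≤ C * tanDensity n v) :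
    ∫⁻ v in S, ENNReal.ofReal (c v) * ∫⁻ η, ‖tanWeighted β α φ (v, η)‖ₑ ∂(surf n) ≠ ∞ := by
  have h1 := hint.2
  rw [HasFiniteIntegral, ← lintegral_indicator hE,
    lintegral_surf_eq_tan hn (hφ.enorm.indicator hE)] at h1
  have hmη : ∀ v, Measurable fun η : USphere n => ‖φ (tanPoint (v, η))‖ₑ := fun v =>
    (hφ.comp (continuous_tanPoint.measurable.comp
      (by fun_prop : Measurable fun η : USphere n => (v, η)))).enorm
  have h2 : ∀ v ∈ S, ENNReal.ofReal (c v) * ∫⁻ η, ‖tanWeighted β α φ (v, η)‖ₑ ∂(surf n) ≤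
      ENNReal.ofReal C * (ENNReal.ofReal (tanDensity n v) *
        ∫⁻ η, E.indicator (fun x => ‖φ x‖ₑ) (tanPoint (v, η)) ∂(surf n)) := by
    intro v hv
    have hv0 : 0 < v := hS0 hv
    have e1 : ∀ η : USphere n, E.indicator (fun x => ‖φ x‖ₑ) (tanPoint (v, η)) =
        ‖φ (tanPoint (v, η))‖ₑ := fun η => Set.indicator_of_mem (hSE v hv η) _
    simp only [e1, enorm_tanWeighted β α φ hv0]
    rw [lintegral_const_mul _ (hmη v), ← mul_assoc, ← mul_assoc, ← ENNReal.ofReal_mul (hc0 v hv),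
      ← ENNReal.ofReal_mul' (tanDensity_pos n hv0).le]
    exact mul_le_mul_left (ENNReal.ofReal_le_ofReal (hc v hv)) _
  refine ne_of_lt (lt_of_le_of_lt (setLIntegral_mono' hS h2) ?_)
  rw [lintegral_const_mul' _ _ ENNReal.ofReal_ne_top]
  exact ENNReal.mul_lt_top ENNReal.ofReal_lt_top ((lintegral_mono_set hS0).trans_lt h1)

theorem lastCoord_tanPoint_lt {v R : ℝ} (hv : 0 < v) (hvR : v < R) (η : USphere n) :
    lastCoord (tanPoint (v, η)) < (R - 1) / (R + 1) := by
  rw [lastCoord_tanPoint hv.le, div_lt_div_iff₀ (by linarith) (by linarith)]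
  nlinarith

theorem lt_lastCoord_tanPoint {v r : ℝ} (hr : 0 < r) (hrv : r < v) (η : USphere n) :
    (r - 1) / (r + 1) < lastCoord (tanPoint (v, η)) := by
  rw [lastCoord_tanPoint (hr.trans hrv).le, div_lt_div_iff₀ (by linarith) (by linarith)]
  nlinarith

/-- For v < R, which describes a cap away from the north pole, v^{n/2-1} is exactly the power in the
surface density and the powers of 1 + v are comparable up to a constant. -/
theorem fracDensity_tanWeighted_left (hn : 0 < n) (hα : 0 < α) (hφ : Measurable φ)
    (hint : ∀ c < 1, IntegrableOn φ {x | lastCoord x < c} (surf (n + 1))) :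
    FracDensity 1 α (tanWeighted ((n : ℝ) / 2 - 1) α φ) := by
  refine fracDensity_left hα (measurable_tanWeighted _ α hφ) (tanWeighted_of_nonpos _ α φ)
    fun R => ?_
  rcases le_or_gt R 0 with hR | hR
  · have : ∀ v ∈ Set.Iio R, ∫⁻ η, ‖tanWeighted ((n : ℝ) / 2 - 1) α φ (v, η)‖ₑ ∂(surf n) = 0 := by
      intro v hv
      have hv : v < R := hv
      simp [tanWeighted_of_nonpos _ α φ (v, _) (hv.le.trans hR)]
    rw [setLIntegral_congr_fun measurableSet_Iio this]
    simp
  have h1 := lintegral_slices_ne_top (α := α) hn hφ (β := (n : ℝ) / 2 - 1)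
    (C := 2 ^ α * (1 + R) ^ ((n : ℝ) / 2))
    (S := Set.Ioo 0 R) measurableSet_Ioo Set.Ioo_subset_Ioi_self
    (E := {x | lastCoord x < (R - 1) / (R + 1)})
    (measurableSet_lt measurable_lastCoord measurable_const)
    (hint _ (by rw [div_lt_one (by linarith)]; linarith))
    (fun v hv η => lastCoord_tanPoint_lt hv.1 hv.2 η) (fun _ => 1) (fun _ _ => zero_le_one)
    (fun v hv => by
      have hv0 := hv.1
      have hv1 : 0 < 1 + v := by linarith
      have e1 : (1 + v) ^ (-α - (n : ℝ) / 2) ≤ (1 + R) ^ ((n : ℝ) / 2) * (1 + v) ^ (-(n : ℝ)) := by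
        calc (1 + v) ^ (-α - (n : ℝ) / 2) ≤ (1 + v) ^ ((n : ℝ) / 2 + -(n : ℝ)) :=
              Real.rpow_le_rpow_of_exponent_le (by linarith) (by linarith)
          _ = (1 + v) ^ ((n : ℝ) / 2) * (1 + v) ^ (-(n : ℝ)) := Real.rpow_add hv1 _ _
          _ ≤ _ := by
            gcongr
            exact hv.2.le
      have e2 : (1 : ℝ) ≤ 2 ^ ((n : ℝ) - 1) :=
        Real.one_le_rpow one_le_two (by
          have : (1 : ℝ) ≤ n := by exact_mod_cast hn
          linarith)
      rw [one_mul, tanDensity]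
      calc 2 ^ α * (1 + v) ^ (-α - (n : ℝ) / 2) * v ^ ((n : ℝ) / 2 - 1)
          ≤ 2 ^ α * ((1 + R) ^ ((n : ℝ) / 2) * (1 + v) ^ (-(n : ℝ))) * v ^ ((n : ℝ) / 2 - 1) := by
            gcongr
        _ = 2 ^ α * (1 + R) ^ ((n : ℝ) / 2) *
            (1 * v ^ ((n : ℝ) / 2 - 1) * (1 + v) ^ (-(n : ℝ))) := by ring
        _ ≤ _ := by gcongr)
  simp only [ENNReal.ofReal_one, one_mul] at h1
  refine ne_of_lt (lt_of_le_of_lt (le_of_eq ?_) h1.lt_top)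
  rw [← lintegral_indicator measurableSet_Iio, ← lintegral_indicator measurableSet_Ioo]
  refine lintegral_congr fun v => ?_
  by_cases hv : v ∈ Set.Ioo 0 R
  · rw [Set.indicator_of_mem hv, Set.indicator_of_mem (show v ∈ Set.Iio R from hv.2)]
  · rw [Set.indicator_of_notMem hv]
    by_cases hvR : v ∈ Set.Iio R
    · have hv0 : v ≤ 0 := by
        by_contra h
        exact hv ⟨not_le.1 h, hvR⟩
      rw [Set.indicator_of_mem hvR]
      simp [tanWeighted_of_nonpos _ α φ (v, _) hv0]
    · rw [Set.indicator_of_notMem hvR]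

/-- For v > r the quotient (1 + v)/v is bounded, so v^{α-1} (1 + v)^{-α-n/2} is dominated by the
surface density. Integrability of φ on caps around the north pole is therefore enough. -/
theorem fracDensity_tanWeighted_right (hn : 0 < n) (hα : 0 < α) (hφ : Measurable φ)
    (hint : ∀ c > -1, IntegrableOn φ {x | c < lastCoord x} (surf (n + 1))) :
    FracDensity (-1) α (tanWeighted 0 α φ) := by
  refine fracDensity_right hα (measurable_tanWeighted _ α hφ) fun r hr => ?_
  refine lintegral_slices_ne_top (α := α) hn hφ (β := 0)
    (C := 2 ^ α * (1 + 1 / r) ^ ((n : ℝ) / 2))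
    (S := Set.Ioi r) measurableSet_Ioi (Set.Ioi_subset_Ioi hr.le)
    (E := {x | (r - 1) / (r + 1) < lastCoord x})
    (measurableSet_lt measurable_const measurable_lastCoord)
    (hint _ (by
      rw [gt_iff_lt, lt_div_iff₀ (by linarith)]
      linarith))
    (fun v hv η => lt_lastCoord_tanPoint hr hv η) (fun v => v ^ (α - 1))
    (fun v hv => Real.rpow_nonneg (hr.trans hv).le _) fun v hv => ?_
  have hrv : r < v := hv
  have hv0 : 0 < v := hr.trans hrv
  have hv1 : 0 < 1 + v := by linarith
  have e0 : (1 + v) / v ≤ 1 + 1 / r := by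
    rw [add_div, div_self hv0.ne', add_comm]
    gcongr
  have e1 : v ^ (α - 1) * (1 + v) ^ (-α - (n : ℝ) / 2) ≤
      (1 + 1 / r) ^ ((n : ℝ) / 2) * (v ^ ((n : ℝ) / 2 - 1) * (1 + v) ^ (-(n : ℝ))) := by
    have e2 : v ^ (α - 1) * (1 + v) ^ (-α - (n : ℝ) / 2) =
        ((1 + v) / v) ^ ((n : ℝ) / 2 - α) * (v ^ ((n : ℝ) / 2 - 1) * (1 + v) ^ (-(n : ℝ))) := by
      rw [Real.div_rpow hv1.le hv0.le, div_eq_mul_inv ((1 + v) ^ ((n : ℝ) / 2 - α)),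
        ← Real.rpow_neg hv0.le]
      calc _ = v ^ (-((n : ℝ) / 2 - α) + ((n : ℝ) / 2 - 1)) *
            (1 + v) ^ (((n : ℝ) / 2 - α) + -(n : ℝ)) := by congr 2 <;> ring
        _ = _ := by rw [Real.rpow_add hv0, Real.rpow_add hv1]; ring
    rw [e2]
    refine mul_le_mul_of_nonneg_right ?_ (by positivity)
    calc ((1 + v) / v) ^ ((n : ℝ) / 2 - α) ≤ ((1 + v) / v) ^ ((n : ℝ) / 2) :=
          Real.rpow_le_rpow_of_exponent_le (by rw [le_div_iff₀ hv0]; linarith) (by linarith)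
      _ ≤ _ := Real.rpow_le_rpow (by positivity) e0 (by positivity)
  have e2 : (1 : ℝ) ≤ 2 ^ ((n : ℝ) - 1) :=
    Real.one_le_rpow one_le_two (by
      have : (1 : ℝ) ≤ n := by exact_mod_cast hn
      linarith)
  rw [Real.rpow_zero, mul_one, tanDensity]
  calc v ^ (α - 1) * (2 ^ α * (1 + v) ^ (-α - (n : ℝ) / 2))
      = 2 ^ α * (v ^ (α - 1) * (1 + v) ^ (-α - (n : ℝ) / 2)) := by ring
    _ ≤ 2 ^ α * ((1 + 1 / r) ^ ((n : ℝ) / 2) *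
        (v ^ ((n : ℝ) / 2 - 1) * (1 + v) ^ (-(n : ℝ)))) := by gcongr
    _ = 2 ^ α * (1 + 1 / r) ^ ((n : ℝ) / 2) *
        (1 * v ^ ((n : ℝ) / 2 - 1) * (1 + v) ^ (-(n : ℝ))) := by ring
    _ ≤ _ := by gcongr

end Densities

/-! ### Hölder's inequality in the weighted spaces -/

section Weighted

variable {n : ℕ} {μ ν : ℝ} {φ : USphere (n + 1) → ℂ}

theorem ae_lastCoord_mem (hn : 0 < n) :
    ∀ᵐ x ∂(surf (n + 1)), lastCoord x ∈ Set.Ioo (-1) 1 := by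
  refine ae_surf_of_ae_tanPoint hn (Eventually.of_forall fun z hz => ?_)
  obtain ⟨t, ξ⟩ := z
  have hz : 0 < t := hz
  rw [lastCoord_tanPoint hz.le]
  constructor
  · rw [lt_div_iff₀ (by linarith)]; linarith
  · rw [div_lt_one (by linarith)]; linarith

theorem weight_pos (μ ν : ℝ) {x : USphere (n + 1)} (hx : lastCoord x ∈ Set.Ioo (-1) 1) :
    0 < weight μ ν x := by
  have h1 : 0 < 1 + lastCoord x := by linarith [hx.1]
  have h2 : 0 < 1 - lastCoord x := by linarith [hx.2]
  unfold weight
  positivity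

theorem measurable_weight (μ ν : ℝ) : Measurable (weight (n := n) μ ν) := by
  have := measurable_lastCoord (n := n)
  unfold weight
  fun_prop

theorem MemWeightedLp.aestronglyMeasurable (hn : 0 < n) {p : ℝ≥0∞}
    (hφ : MemWeightedLp φ p (weight μ ν)) : AEStronglyMeasurable φ (surf (n + 1)) := by
  have h1 : AEStronglyMeasurable (fun x => (weight μ ν x)⁻¹ • (weight μ ν x • φ x))
      (surf (n + 1)) :=
    (measurable_weight μ ν).inv.aestronglyMeasurable.smul hφ.1
  refine h1.congr ?_
  filter_upwards [ae_lastCoord_mem hn] with x hx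
  rw [smul_smul, inv_mul_cancel₀ (weight_pos μ ν hx).ne', one_smul]

theorem weight_tanPoint (μ ν : ℝ) {v : ℝ} (hv : 0 < v) (η : USphere n) :
    weight μ ν (tanPoint (v, η)) = 2 ^ (μ + ν) * v ^ μ * (1 + v) ^ (-μ - ν) := by
  have h1 : 0 < 1 + v := by linarith
  have e1 : 1 + (v - 1) / (v + 1) = 2 * v / (1 + v) := by field_simp; ring
  have e2 : 1 - (v - 1) / (v + 1) = 2 / (1 + v) := by field_simp; ring
  rw [weight, lastCoord_tanPoint hv.le, e1, e2, Real.div_rpow (by positivity) h1.le,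
    Real.div_rpow (by positivity) h1.le, Real.mul_rpow two_pos.le hv.le, Real.rpow_add two_pos,
    sub_eq_add_neg, Real.rpow_add h1, Real.rpow_neg h1.le, Real.rpow_neg h1.le]
  field_simp

/-- Towards the south pole, v → 0, the density times the weight to the power -q behaves like
v^{n/2-1-qμ}, integrable when μ < n/(2q). On a cap away from the north pole v is bounded, so ν only
affects constants. -/
theorem memLp_inv_weight (hn : 0 < n) {q : ℝ≥0∞} (hq0 : q ≠ 0) (hq : q ≠ ∞)
    (hμ : μ < n / (2 * q.toReal)) {c : ℝ} (hc : c < 1) :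
    MemLp ({x | lastCoord x < c}.indicator fun x => (weight μ ν x)⁻¹) q (surf (n + 1)) := by
  have hE : MeasurableSet {x : USphere (n + 1) | lastCoord x < c} :=
    measurableSet_lt measurable_lastCoord measurable_const
  have hm : Measurable ({x : USphere (n + 1) | lastCoord x < c}.indicator
      fun x => (weight μ ν x)⁻¹) := (measurable_weight μ ν).inv.indicator hE
  refine ⟨hm.aestronglyMeasurable, ?_⟩
  rw [eLpNorm_lt_top_iff_lintegral_rpow_enorm_lt_top hq0 hq,
    lintegral_surf_eq_tan hn (hm.enorm.pow_const _)]
  set r := q.toReal with hr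
  have hr0 : 0 < r := ENNReal.toReal_pos hq0 hq
  -- R is the value of t on the parallel x_{n+1} = c.
  set R := (1 + c) / (1 - c) with hR
  set e := (n : ℝ) / 2 - 1 - r * μ with he
  set E := r * (μ + ν) - n with hEdef
  have he1 : -1 < e := by
    rw [lt_div_iff₀ (by positivity)] at hμ
    rw [he]
    nlinarith
  set K := 2 ^ ((n : ℝ) - 1 - r * (μ + ν)) * (1 ^ E + (1 + R) ^ E) with hK
  have hbound : ∀ v ∈ Set.Ioi (0 : ℝ), ENNReal.ofReal (tanDensity n v) *
      ∫⁻ η, ‖{x : USphere (n + 1) | lastCoord x < c}.indicator (fun x => (weight μ ν x)⁻¹)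
        (tanPoint (v, η))‖ₑ ^ r ∂(surf n) ≤
      (ENNReal.ofReal K * surf n Set.univ) *
        (Set.Ioo 0 R).indicator (fun v => ENNReal.ofReal (v ^ e)) v := by
    intro v hv
    have hv : 0 < v := hv
    have h1 : 0 < 1 + v := by linarith
    by_cases hvR : v < R
    · rw [Set.indicator_of_mem (show v ∈ Set.Ioo 0 R from ⟨hv, hvR⟩)]
      have hle : ∀ η : USphere n, ‖{x : USphere (n + 1) | lastCoord x < c}.indicator
          (fun x => (weight μ ν x)⁻¹) (tanPoint (v, η))‖ₑ ^ r ≤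
          ENNReal.ofReal ((2 ^ (μ + ν) * v ^ μ * (1 + v) ^ (-μ - ν)) ^ (-r)) := by
        intro η
        have hw : 0 < 2 ^ (μ + ν) * v ^ μ * (1 + v) ^ (-μ - ν) := by positivity
        have h2 : ‖{x : USphere (n + 1) | lastCoord x < c}.indicator
            (fun x => (weight μ ν x)⁻¹) (tanPoint (v, η))‖ₑ ≤ ‖(weight μ ν (tanPoint (v, η)))⁻¹‖ₑ :=
          enorm_indicator_le_enorm_self _ _
        refine (ENNReal.rpow_le_rpow h2 hr0.le).trans (le_of_eq ?_)
        rw [weight_tanPoint μ ν hv, Real.enorm_eq_ofReal (by positivity),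
          ENNReal.ofReal_rpow_of_nonneg (by positivity) hr0.le, Real.inv_rpow hw.le,
          Real.rpow_neg hw.le]
      refine (mul_le_mul_right (lintegral_mono hle) _).trans ?_
      rw [lintegral_const, ← mul_assoc, mul_right_comm (ENNReal.ofReal K),
        ← ENNReal.ofReal_mul (tanDensity_pos n hv).le,
        ← ENNReal.ofReal_mul' (by positivity)]
      refine mul_le_mul_left (ENNReal.ofReal_le_ofReal ?_) _
      have e1 : (2 ^ (μ + ν) * v ^ μ * (1 + v) ^ (-μ - ν)) ^ (-r) =
          2 ^ (-(r * (μ + ν))) * v ^ (-(r * μ)) * (1 + v) ^ (r * (μ + ν)) := by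
        rw [Real.mul_rpow (by positivity) (by positivity),
          Real.mul_rpow (by positivity) (by positivity), ← Real.rpow_mul two_pos.le,
          ← Real.rpow_mul hv.le, ← Real.rpow_mul h1.le]
        congr 2 <;> ring_nf
      have e2 : tanDensity n v * (2 ^ (μ + ν) * v ^ μ * (1 + v) ^ (-μ - ν)) ^ (-r) =
          2 ^ ((n : ℝ) - 1 - r * (μ + ν)) * (1 + v) ^ E * v ^ e := by
        rw [e1, tanDensity, hEdef, he, sub_eq_add_neg ((n : ℝ) - 1) (r * (μ + ν)),
          Real.rpow_add two_pos, sub_eq_add_neg (r * (μ + ν)), Real.rpow_add h1,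
          sub_eq_add_neg ((n : ℝ) / 2 - 1) (r * μ), Real.rpow_add hv]
        ring
      rw [e2, hK]
      gcongr
      exact rpow_le_add_of_mem one_pos (by linarith) (by linarith) _
    · have hnot : ∀ η : USphere n, tanPoint (v, η) ∉ {x : USphere (n + 1) | lastCoord x < c} := by
        intro η h
        apply hvR
        have h : lastCoord (tanPoint (v, η)) < c := h
        rw [lastCoord_tanPoint hv.le, div_lt_iff₀ (by linarith)] at h
        rw [hR, lt_div_iff₀ (by linarith)]
        linarith
      simp [Set.indicator_of_notMem (hnot _), ENNReal.zero_rpow_of_pos hr0]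
  refine lt_of_le_of_lt (setLIntegral_mono' measurableSet_Ioi hbound) ?_
  have hKtop : ENNReal.ofReal K * surf n Set.univ ≠ ∞ :=
    ENNReal.mul_ne_top ENNReal.ofReal_ne_top (measure_ne_top _ _)
  rw [lintegral_const_mul' _ _ hKtop]
  refine ENNReal.mul_lt_top hKtop.lt_top ((setLIntegral_le_lintegral _ _).trans_lt ?_)
  rw [lintegral_indicator measurableSet_Ioo]
  exact (lintegral_rpow_Ioo_ne_top he1 R).lt_top

/-- Hölder's inequality for φ = w⁻¹ · (wφ); the condition p > 1 makes p' finite. -/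
theorem MemWeightedLp.integrableOn_south (hn : 0 < n) {p p' : ℝ≥0∞} (hp : 1 < p)
    (hpp' : p.HolderConjugate p') (hμ : μ < n / (2 * p'.toReal))
    (hφ : MemWeightedLp φ p (weight μ ν)) {c : ℝ} (hc : c < 1) :
    IntegrableOn φ {x | lastCoord x < c} (surf (n + 1)) := by
  have hE : MeasurableSet {x : USphere (n + 1) | lastCoord x < c} :=
    measurableSet_lt measurable_lastCoord measurable_const
  have hq0 : p' ≠ 0 := ENNReal.HolderConjugate.ne_zero p' p
  have hq : p' ≠ ∞ := ((ENNReal.HolderConjugate.lt_top_iff_one_lt p' p).2 hp).ne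
  have h1 := memLp_inv_weight (ν := ν) hn hq0 hq hμ hc
  have h2 : MemLp (({x | lastCoord x < c}.indicator fun x => (weight μ ν x)⁻¹) •
      fun x => weight μ ν x • φ x) 1 (surf (n + 1)) := MemLp.smul hφ h1
  rw [← integrable_indicator_iff hE]
  refine (memLp_one_iff_integrable.1 h2).congr ?_
  filter_upwards [ae_lastCoord_mem hn] with x hx
  simp only [Pi.smul_apply']
  by_cases hxc : x ∈ {x : USphere (n + 1) | lastCoord x < c}
  · rw [Set.indicator_of_mem hxc, Set.indicator_of_mem hxc, smul_smul,
      inv_mul_cancel₀ (weight_pos μ ν hx).ne', one_smul]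
  · rw [Set.indicator_of_notMem hxc, Set.indicator_of_notMem hxc, zero_smul]

/-- The antipodal map. -/
def antipode {d : ℕ} : USphere d → USphere d := sphereMap (LinearIsometryEquiv.neg ℝ)

theorem lastCoord_antipode (x : USphere (n + 1)) : lastCoord (antipode x) = -lastCoord x := by
  simp [antipode, sphereMap, lastCoord]

theorem antipode_antipode {d : ℕ} (x : USphere d) : antipode (antipode x) = x :=
  Subtype.ext (by simp [antipode, sphereMap])

/-- The antipodal map preserves the surface measure, exchanges the two poles and swaps the exponents
μ and ν. -/
theorem MemWeightedLp.integrableOn_north (hn : 0 < n) {p p' : ℝ≥0∞} (hp : 1 < p)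
    (hpp' : p.HolderConjugate p') (hν : ν < n / (2 * p'.toReal))
    (hφ : MemWeightedLp φ p (weight μ ν)) {c : ℝ} (hc : c > -1) :
    IntegrableOn φ {x | c < lastCoord x} (surf (n + 1)) := by
  have hmp : MeasurePreserving (antipode (d := n + 1)) (surf (n + 1)) (surf (n + 1)) :=
    measurePreserving_sphereMap _
  have hE : MeasurableSet {x : USphere (n + 1) | lastCoord x < -c} :=
    measurableSet_lt measurable_lastCoord measurable_const
  have hE' : MeasurableSet {x : USphere (n + 1) | c < lastCoord x} :=
    measurableSet_lt measurable_const measurable_lastCoord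
  have h1 : MemWeightedLp (φ ∘ antipode) p (weight ν μ) := by
    have h2 := MemLp.comp_measurePreserving hφ hmp
    refine h2.ae_eq (Eventually.of_forall fun x => ?_)
    simp only [Function.comp_apply, weight, lastCoord_antipode, sub_neg_eq_add, ← sub_eq_add_neg]
    rw [mul_comm]
  have h3 := h1.integrableOn_south hn hp hpp' hν (c := -c) (by linarith)
  rw [← integrable_indicator_iff hE] at h3
  rw [← integrable_indicator_iff hE']
  have h4 := hmp.integrable_comp_of_integrable h3
  refine h4.congr (Eventually.of_forall fun x => ?_)
  simp only [Function.comp_apply, Set.indicator_apply, Set.mem_ofPred_eq, lastCoord_antipode,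
    neg_lt_neg_iff, antipode_antipode]

end Weighted

/-! ### The inversion theorem on the sphere -/

section Inversion

variable {n : ℕ} {s β α : ℝ} {φ φ' : USphere (n + 1) → ℂ}

theorem sideIntegrand_congr (s α : ℝ) (h : φ =ᵐ[surf (n + 1)] φ') (x : USphere (n + 1)) :
    sideIntegrand s α φ x =ᵐ[surf (n + 1)] sideIntegrand s α φ' x := by
  filter_upwards [h] with y hy
  simp only [sideIntegrand, hy]

theorem sideInt_congr (s α : ℝ) (h : φ =ᵐ[surf (n + 1)] φ') :
    sideInt s α φ = sideInt s α φ' := by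
  funext x
  rw [sideInt, sideInt, integral_congr_ae (sideIntegrand_congr s α h x)]

theorem measurableSet_sphSegment (a b : ℝ) : MeasurableSet (sphSegment n a b) :=
  (measurableSet_lt measurable_const measurable_lastCoord).inter
    (measurableSet_lt measurable_lastCoord measurable_const)

theorem indicator_leftIntegrand (hn : 0 < n) (α : ℝ) (φ : USphere (n + 1) → ℂ)
    (x : USphere (n + 1)) :
    (sphSegment n (-1) (lastCoord x)).indicator (leftIntegrand α φ x) =ᵐ[surf (n + 1)]
      sideIntegrand 1 α φ x := by
  classical
  filter_upwards [ae_lastCoord_mem hn] with y hy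
  rw [sideIntegrand, one_mul, Set.indicator_apply]
  exact if_congr ⟨fun h => sub_pos.2 h.2, fun h => ⟨hy.1, sub_pos.1 h⟩⟩ rfl rfl

theorem indicator_rightIntegrand (hn : 0 < n) (α : ℝ) (φ : USphere (n + 1) → ℂ)
    (x : USphere (n + 1)) :
    (sphSegment n (lastCoord x) 1).indicator (rightIntegrand α φ x) =ᵐ[surf (n + 1)]
      sideIntegrand (-1) α φ x := by
  classical
  filter_upwards [ae_lastCoord_mem hn] with y hy
  rw [sideIntegrand, neg_one_mul, neg_sub, Set.indicator_apply]
  exact if_congr ⟨fun h => sub_pos.2 h.1, fun h => ⟨sub_pos.1 h, hy.2⟩⟩ rfl rfl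

theorem Splus_eq_sideInt (hn : 0 < n) (α : ℝ) (φ : USphere (n + 1) → ℂ) :
    Splus α φ = sideInt 1 α φ := by
  funext x
  rw [Splus, leftInt, sideInt, ← integral_indicator (measurableSet_sphSegment _ _),
    integral_congr_ae (indicator_leftIntegrand hn α φ x)]

theorem Sminus_eq_sideInt (hn : 0 < n) (α : ℝ) (φ : USphere (n + 1) → ℂ) :
    Sminus α φ = sideInt (-1) α φ := by
  funext x
  rw [Sminus, rightInt, sideInt, ← integral_indicator (measurableSet_sphSegment _ _),
    integral_congr_ae (indicator_rightIntegrand hn α φ x)]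

theorem integrableOn_leftIntegrand_iff (hn : 0 < n) (x : USphere (n + 1)) :
    IntegrableOn (leftIntegrand α φ x) (sphSegment n (-1) (lastCoord x)) (surf (n + 1)) ↔
      Integrable (sideIntegrand 1 α φ x) (surf (n + 1)) := by
  rw [← integrable_indicator_iff (measurableSet_sphSegment _ _)]
  exact integrable_congr (indicator_leftIntegrand hn α φ x)

theorem integrableOn_rightIntegrand_iff (hn : 0 < n) (x : USphere (n + 1)) :
    IntegrableOn (rightIntegrand α φ x) (sphSegment n (lastCoord x) 1) (surf (n + 1)) ↔
      Integrable (sideIntegrand (-1) α φ x) (surf (n + 1)) := by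
  rw [← integrable_indicator_iff (measurableSet_sphSegment _ _)]
  exact integrable_congr (indicator_rightIntegrand hn α φ x)

theorem ae_integrable_sideIntegrand (hn : 0 < n) (hβ : IsSide n s β) (hφ : Measurable φ)
    (hG : FracDensity s α (tanWeighted β α φ)) :
    ∀ᵐ x ∂(surf (n + 1)), Integrable (sideIntegrand s α φ x) (surf (n + 1)) := by
  refine ae_surf_of_ae_tanPoint hn ?_
  filter_upwards [hG.ae_fracAbs_ne_top hn] with z hz hz0
  exact (integrable_sideIntegrand_iff hn hβ hφ hz0 z.2).2 (hz hz0)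

theorem integrableOnParallels_sideInt (hn : 0 < n) (hβ : IsSide n s β) (hφ : Measurable φ)
    (hG : FracDensity s α (tanWeighted β α φ)) : IntegrableOnParallels (sideInt s α φ) := by
  refine ae_angle_of_ae_tan ?_
  filter_upwards [hG.integrable_fracInt hn (tanFracInt_eq hn hβ hφ)] with t ht ht0
  have h1 : (1 + t) ^ (α - (n : ℝ) / 2) * t ^ β ≠ 0 := by positivity
  exact (integrable_smul_iff h1 _).1 (ht ht0)

/-- Marchaud inversion for one side, with `A` the family of functions on the half-line that is
used in the Marchaud derivative. -/
theorem ae_marchaud_sideInt (hn : 0 < n) (hβ : IsSide n s β) (hα : 0 < α) {ℓ : ℕ} (hℓ : α < ℓ)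
    (hφ : Measurable φ) (hG : FracDensity s α (tanWeighted β α φ))
    {A : USphere (n + 1) → ℝ → ℂ}
    (hA : ∀ (t : ℝ) (ξ : USphere n), 0 < t → ∀ u ≤ 0, A (tanPoint (t, ξ)) u =
      t ^ (-β) • orbitFun s (tanFracInt s β α φ) (t, ξ) u) :
    ∀ᵐ x ∂(surf (n + 1)),
      (∀ ε : ℝ, 0 < ε → IntegrableOn (marchaudIntegrand α ℓ (A x)) (Set.Ioi ε)) ∧
      Tendsto (fun ε : ℝ => marchaudFactor α ℓ x •
        ∫ τ in Set.Ioi ε, marchaudIntegrand α ℓ (A x) τ) (𝓝[>] 0) (𝓝 (φ x)) := by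
  refine ae_surf_of_ae_tanPoint hn ?_
  filter_upwards [hG.inversion hn hβ.sign hα hℓ (tanFracInt_eq hn hβ hφ)] with z hz hz0
  obtain ⟨t, ξ⟩ := z
  have ht : 0 < t := hz0
  have h1 : 0 < 1 + t := by linarith
  obtain ⟨hint, hlim⟩ := hz ht
  have hcongr : ∀ ε : ℝ, 0 < ε → Set.EqOn
      (fun τ => t ^ (-β) • marchaudIntegrand α ℓ (orbitFun s (tanFracInt s β α φ) (t, ξ)) τ)
      (marchaudIntegrand α ℓ (A (tanPoint (t, ξ)))) (Set.Ioi ε) := fun ε hε τ hτ =>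
    (marchaudIntegrand_congr (hA t ξ ht) (hε.le.trans (le_of_lt hτ))).symm
  refine ⟨fun ε hε => ?_, ?_⟩
  · exact IntegrableOn.congr_fun ((hint ε hε).smul (t ^ (-β))) (hcongr ε hε) measurableSet_Ioi
  · have h2 := (hlim.const_smul (t ^ (-β))).const_smul (marchaudFactor α ℓ (tanPoint (t, ξ)))
    -- The factor in front undoes ϰ(α, ℓ) and the weight of `tanWeighted` except for t^β, which is
    -- cancelled by the factor t^{-β} in A_x.
    have h3 : marchaudFactor α ℓ (tanPoint (t, ξ)) • (t ^ (-β) •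
        (kappa α ℓ • tanWeighted β α φ (t, ξ))) = φ (tanPoint (t, ξ)) := by
      have hκ := kappa_pos hα hℓ
      rw [tanWeighted, if_pos ht, smul_smul, smul_smul, smul_smul, marchaudFactor,
        tanSq_tanPoint ht]
      have e1 : (2 : ℝ) ^ (-α) * 2 ^ α = 1 := by rw [← Real.rpow_add two_pos]; simp
      have e2 : (1 + t) ^ (α + (n : ℝ) / 2) * (1 + t) ^ (-α - (n : ℝ) / 2) = 1 := by
        rw [← Real.rpow_add h1]; ring_nf; simp
      have e3 : t ^ (-β) * t ^ β = 1 := by rw [← Real.rpow_add ht]; simp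
      have e4 : 2 ^ (-α) / kappa α ℓ * (1 + t) ^ (α + (n : ℝ) / 2) * (t ^ (-β)) * kappa α ℓ *
          (2 ^ α * (1 + t) ^ (-α - (n : ℝ) / 2) * t ^ β) =
          ((2 : ℝ) ^ (-α) * 2 ^ α) * ((1 + t) ^ (α + (n : ℝ) / 2) *
            (1 + t) ^ (-α - (n : ℝ) / 2)) * (t ^ (-β) * t ^ β) := by
        field_simp
      have e5 := e4.trans (by rw [e1, e2, e3, one_mul, one_mul])
      simp only at e5 ⊢
      rw [e5, one_smul]
    rw [h3] at h2
    refine h2.congr' ?_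
    filter_upwards [self_mem_nhdsWithin] with ε hε
    rw [← integral_smul, setIntegral_congr_fun measurableSet_Ioi (hcongr ε hε)]

end Inversion

end SphFrac

end

theorem mainTheorem4 (n : ℕ) (hn : 2 ≤ n) (α : ℝ) (hα : 0 < α) (ℓ : ℕ) (hℓ : α < ℓ)
    (p p' : ℝ≥0∞) (hp : 1 < p) (hpp' : p.HolderConjugate p') (μ ν : ℝ)
    (φ : USphere (n + 1) → ℂ) (hφ : MemWeightedLp φ p (weight μ ν)) :
    (μ < n / (2 * p'.toReal) →
      (∀ᵐ x ∂(surf (n + 1)),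
        IntegrableOn (leftIntegrand α φ x) (sphSegment n (-1) (lastCoord x)) (surf (n + 1))) ∧
      IntegrableOnParallels (Splus α φ) ∧
      (∀ᵐ x ∂(surf (n + 1)), ∀ ε : ℝ, 0 < ε →
        IntegrableOn (marchaudIntegrand α ℓ (Aplus α (Splus α φ) x)) (Set.Ioi ε)) ∧
      ∀ᵐ x ∂(surf (n + 1)),
        Tendsto (fun ε : ℝ => Tplus α ℓ ε (Splus α φ) x) (𝓝[>] 0) (𝓝 (φ x))) ∧
    (ν < n / (2 * p'.toReal) →
      (∀ᵐ x ∂(surf (n + 1)),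
        IntegrableOn (rightIntegrand α φ x) (sphSegment n (lastCoord x) 1) (surf (n + 1))) ∧
      IntegrableOnParallels (Sminus α φ) ∧
      (∀ᵐ x ∂(surf (n + 1)), ∀ ε : ℝ, 0 < ε →
        IntegrableOn (marchaudIntegrand α ℓ (Aminus α (Sminus α φ) x)) (Set.Ioi ε)) ∧
      ∀ᵐ x ∂(surf (n + 1)),
        Tendsto (fun ε : ℝ => Tminus α ℓ ε (Sminus α φ) x) (𝓝[>] 0) (𝓝 (φ x))) := by
  have hn0 : 0 < n := by omega
  have hmeas := hφ.aestronglyMeasurable hn0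
  -- The integrals S^α_± are unchanged at every point when φ is altered on a null set, so φ may be
  -- replaced by a Borel representative throughout.
  obtain ⟨φ', hφ', heq⟩ : ∃ φ', Measurable φ' ∧ φ =ᵐ[surf (n + 1)] φ' :=
    ⟨hmeas.mk φ, hmeas.stronglyMeasurable_mk.measurable, hmeas.ae_eq_mk⟩
  constructor
  · intro hμ
    have hβ : IsSide n 1 ((n : ℝ) / 2 - 1) := Or.inl ⟨rfl, rfl⟩
    have hG : FracDensity 1 α (tanWeighted ((n : ℝ) / 2 - 1) α φ') :=
      fracDensity_tanWeighted_left hn0 hα hφ' fun c hc =>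
        (hφ.integrableOn_south hn0 hp hpp' hμ hc).congr (ae_restrict_of_ae heq)
    have hmain := ae_marchaud_sideInt hn0 hβ hα hℓ hφ' hG
      (A := Aplus α (sideInt 1 α φ')) fun t ξ ht u hu => Aplus_tanPoint ht ξ hu
    rw [Splus_eq_sideInt hn0, sideInt_congr 1 α heq]
    refine ⟨?_, integrableOnParallels_sideInt hn0 hβ hφ' hG, hmain.mono fun x hx => hx.1, ?_⟩
    · filter_upwards [ae_integrable_sideIntegrand hn0 hβ hφ' hG] with x hx
      exact (integrableOn_leftIntegrand_iff hn0 x).2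
        (hx.congr (sideIntegrand_congr 1 α heq x).symm)
    · filter_upwards [hmain, heq] with x hx hxe
      rw [hxe]
      exact hx.2
  · intro hν
    have hβ : IsSide n (-1) 0 := Or.inr ⟨rfl, rfl⟩
    have hG : FracDensity (-1) α (tanWeighted 0 α φ') :=
      fracDensity_tanWeighted_right hn0 hα hφ' fun c hc =>
        (hφ.integrableOn_north hn0 hp hpp' hν hc).congr (ae_restrict_of_ae heq)
    have hmain := ae_marchaud_sideInt hn0 hβ hα hℓ hφ' hG
      (A := Aminus α (sideInt (-1) α φ')) fun t ξ ht u hu => Aminus_tanPoint ht ξ hu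
    rw [Sminus_eq_sideInt hn0, sideInt_congr (-1) α heq]
    refine ⟨?_, integrableOnParallels_sideInt hn0 hβ hφ' hG, hmain.mono fun x hx => hx.1, ?_⟩
    · filter_upwards [ae_integrable_sideIntegrand hn0 hβ hφ' hG] with x hx
      exact (integrableOn_rightIntegrand_iff hn0 x).2
        (hx.congr (sideIntegrand_congr (-1) α heq x).symm)
    · filter_upwards [hmain, heq] with x hx hxe
      rw [hxe]
      exact hx.2
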